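/- Let $\mathcal G$ be a three-dimensional nilpotent Lie group with Lie algebra $\mathfrak g$, let $M$ be a compact one-dimensional manifold (without boundary), and let $\pi:P\to M$ be a smooth principal $\mathcal G$-bundle. Let $T>0$ and let $(\bar g(t),\bar H(t))$, $t\in(0,T)$, be a smooth family of $\mathcal G$-invariant Riemannian metrics and $\mathcal G$-invariant closed three-forms on $P$ (for example a solution on $[0,T)$, restricted to positive times). Notation. Let $\mathfrak G=P\times_{\mathrm{Ad}}\mathfrak g$ be the adjoint bundle and $\mathcal E=\mathfrak G\oplus TM$. Let $\bar A(t)$ be the principal connection whose horizontal spaces are the $\bar g(t)$-orthogonal complements of the fibres of $P$. The isomorphism $\delta:TP\to\pi^*\mathcal E$, $\delta(Z)=\{p,\bar A Z\}+\pi_*Z$ for $Z\in T_pP$, identifies invariant tensors on $P$ with tensors on $\mathcal E$. Under it $\bar g$ corresponds to $G\oplus g$, with $G$ a metric on $\mathfrak G$ and $g$ a metric on $M$, and $\bar H$ corresponds to $H\in\Gamma(\Lambda^3\mathcal E^*)$; the Lie bracket of invariant vector fields gives a bracket $[,]$ on $\Gamma(\mathcal E)$, which on each fibre of $\mathfrak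 G$ is the Lie bracket $[\{p,x\},\{p,y\}]=-\{p,[x,y]\}$; $d$ is the operator on $\Gamma(\Lambda^k\mathcal E^*)$ corresponding to the exterior derivative of invariant forms on $P$; $D$ is the connection on $\mathfrak G$ induced by $\bar A$, extended to $\mathcal E$ by the Levi-Civita connection of $g$; $\frac{\partial A}{\partial t}\in\Gamma(T^*M\otimes\mathfrak G)$ corresponds to $\frac{\partial\bar A}{\partial t}$. A repeated dot means a trace over orthonormal bases (over $TM$ in the differentiation slot of $D$, over $\mathfrak G$ in the slots of $G$ and of $[,]$), $*$ marks free arguments, $\pi_{\mathfrak G}:\mathcal E\to\mathfrak G$ is the projection, $(\alpha\wedge\beta)(X,Y)=\alpha(X)\beta(Y)-\alpha(Y)\beta(X)$ for one-forms, and $H^2(X,Y)=\sum_{a,b}H(X,e_a,e_b)H(Y,e_a,e_b)$ for an orthonormal basis $(e_a)$ of the fibre of $\mathcal E$. Suppose that for all $t\in(0,T)$ the invariant generalized Ricci flow equations in the canonical gauge hold, which over a one-dimensional base read $$\begin{aligned} \tfrac{\partial G}{\partial t}(\eta_1,\eta_2)={}&(D_\cdot DG)_\cdot(\eta_1,\eta_2)-D_{\cdot_2}G(\eta_1,\cdot_1)D_{\cdot_2}G(\cdot_1,\eta_2)+\mathrm{tr}_G\,G([\cdot,\eta_1],[\cdot,\eta_2])\\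 &-\tfrac12\mathrm{tr}_G\,G([\cdot_1,\cdot_2],\eta_1)G([\cdot_1,\cdot_2],\eta_2)+\tfrac12H^2(\eta_1,\eta_2),\\ G\big(\tfrac{\partial A}{\partial t}v,\eta\big)={}&\mathrm{tr}_G\,D_vG([\cdot,\eta],\cdot)+\tfrac12H^2(v,\eta),\\ \tfrac{\partial g}{\partial t}(v_1,v_2)={}&\tfrac12D_{v_1}G(\cdot_1,\cdot_2)D_{v_2}G(\cdot_1,\cdot_2)+\tfrac12H^2(v_1,v_2),\\ (\delta_p^{-1})^*\tfrac{\partial\bar H}{\partial t}={}&dB,\\ B={}&D_\cdot H(\cdot,*,*)-D_{\cdot_1}G(\cdot_2,\pi_{\mathfrak G}*)\wedge H(\cdot_1,\cdot_2,*)+\tfrac12\mathrm{tr}_G\,G([\cdot_1,\cdot_2],\pi_{\mathfrak G}*)\wedge H(\cdot_1,\cdot_2,*), \end{aligned}$$ for $\eta,\eta_1,\eta_2\in\mathfrak G$, $v,v_1,v_2\in TM$. Then at every point of $M$ and every time $t\in(0,T)$, $$|[,]|^2\le\frac{2}{3t},\qquad |H^{\mathfrak G}|^2\le\frac2t,\qquad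 |DG|^2+\mathrm{tr}_gH^2\le\frac2t,$$ where, for an orthonormal basis $\eta_1,\eta_2,\eta_3$ of the fibre of $(\mathfrak G,G)$ and a unit tangent vector $v$ of $(M,g)$, $|[,]|^2=\sum_{i,j}|[\eta_i,\eta_j]|_G^2$, $|H^{\mathfrak G}|^2=\sum_{i,j,k}H(\eta_i,\eta_j,\eta_k)^2$, $|DG|^2=\sum_{i,j}(D_vG(\eta_i,\eta_j))^2$ and $\mathrm{tr}_gH^2=H^2(v,v)$. -/

import Mathlib

open scoped Manifold ContDiff Topology
open Set

noncomputable section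

namespace InvariantFlow

/-- A smooth Lie group has the regularity Mathlib asks for the Lie bracket of its Lie algebra. -/
instance instLieGroupMinSmoothness {𝒢 : Type*} [Group 𝒢] [TopologicalSpace 𝒢]
    [ChartedSpace (EuclideanSpace ℝ (Fin 3)) 𝒢] [LieGroup (𝓡 3) ∞ 𝒢] :
    LieGroup (𝓡 3) (minSmoothness ℝ 3) 𝒢 := by
  rw [minSmoothness_of_isRCLikeNormedField]
  infer_instance

section Bundles

variable (𝒢 M P : Type*)
  [Group 𝒢] [TopologicalSpace 𝒢] [ChartedSpace (EuclideanSpace ℝ (Fin 3)) 𝒢]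
  [TopologicalSpace M] [ChartedSpace (EuclideanSpace ℝ (Fin 1)) M]
  [TopologicalSpace P] [ChartedSpace (EuclideanSpace ℝ (Fin 4)) P]

/-- A smooth principal `𝒢`-bundle `proj : P → M` with right action `act p a = p · a`, where `𝒢` has
dimension three and `M` has dimension one. Local triviality says that over a neighbourhood `U` of
any point there are a smooth section `s` and a smooth map `κ`, such that `p ↦ (proj p, κ p)` is
inverse to `(m, a) ↦ s m · a`. -/
structure PrincipalBundle where
  /-- the projection -/
  proj : P → M
  /-- the right action -/
  act : P → 𝒢 → P
  contMDiff_proj : ContMDiff (𝓡 4) (𝓡 1) ∞ proj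
  contMDiff_act : ContMDiff ((𝓡 4).prod (𝓡 3)) (𝓡 4) ∞ (fun q : P × 𝒢 => act q.1 q.2)
  act_one : ∀ p, act p 1 = p
  act_mul : ∀ p a b, act p (a * b) = act (act p a) b
  proj_act : ∀ p a, proj (act p a) = proj p
  locally_trivial : ∀ m : M, ∃ U : Set M, IsOpen U ∧ m ∈ U ∧ ∃ (s : M → P) (κ : P → 𝒢),
    ContMDiffOn (𝓡 1) (𝓡 4) ∞ s U ∧ ContMDiffOn (𝓡 4) (𝓡 3) ∞ κ (proj ⁻¹' U) ∧
    (∀ y ∈ U, proj (s y) = y) ∧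
    (∀ p, proj p ∈ U → act (s (proj p)) (κ p) = p) ∧
    (∀ y ∈ U, ∀ a, κ (act (s y) a) = a)

end Bundles

section VectorFields

variable {P : Type*} [TopologicalSpace P] [ChartedSpace (EuclideanSpace ℝ (Fin 4)) P]
  [IsManifold (𝓡 4) ∞ P]

/-- A vector field on `P` that is smooth on `U`. -/
def SmoothField (U : Set P) (X : (p : P) → TangentSpace (𝓡 4) p) : Prop :=
  ContMDiffOn (𝓡 4) (𝓡 4).tangent ∞ (fun p => (⟨p, X p⟩ : TangentBundle (𝓡 4) P)) U

/-- The derivative `v[f]` of a function at `p` in the direction of the tangent vector `v`. -/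
def dirDeriv (p : P) (v : TangentSpace (𝓡 4) p) (f : P → ℝ) : ℝ :=
  mfderiv (𝓡 4) 𝓘(ℝ, ℝ) f p v

/-- The exterior derivative of a 2-form, evaluated on three vector fields. -/
def extDerivTwo (B : (p : P) → TangentSpace (𝓡 4) p → TangentSpace (𝓡 4) p → ℝ)
    (X Y Z : (p : P) → TangentSpace (𝓡 4) p) (p : P) : ℝ :=
  dirDeriv p (X p) (fun q => B q (Y q) (Z q))
    - dirDeriv p (Y p) (fun q => B q (X q) (Z q))
    + dirDeriv p (Z p) (fun q => B q (X q) (Y q))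
    - B p (VectorField.mlieBracket (𝓡 4) X Y p) (Z p)
    + B p (VectorField.mlieBracket (𝓡 4) X Z p) (Y p)
    - B p (VectorField.mlieBracket (𝓡 4) Y Z p) (X p)

/-- The exterior derivative of a 3-form, evaluated on four vector fields. -/
def extDerivThree (H : (p : P) → TangentSpace (𝓡 4) p [⋀^Fin 3]→L[ℝ] ℝ)
    (X Y Z W : (p : P) → TangentSpace (𝓡 4) p) (p : P) : ℝ :=
  dirDeriv p (X p) (fun q => H q ![Y q, Z q, W q])
    - dirDeriv p (Y p) (fun q => H q ![X q, Z q, W q])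
    + dirDeriv p (Z p) (fun q => H q ![X q, Y q, W q])
    - dirDeriv p (W p) (fun q => H q ![X q, Y q, Z q])
    - H p ![VectorField.mlieBracket (𝓡 4) X Y p, Z p, W p]
    + H p ![VectorField.mlieBracket (𝓡 4) X Z p, Y p, W p]
    - H p ![VectorField.mlieBracket (𝓡 4) X W p, Y p, Z p]
    - H p ![VectorField.mlieBracket (𝓡 4) Y Z p, X p, W p]
    + H p ![VectorField.mlieBracket (𝓡 4) Y W p, X p, Z p]
    - H p ![VectorField.mlieBracket (𝓡 4) Z W p, X p, Y p]

variable (P) in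
/-- Smooth Riemannian metrics on `P`. -/
abbrev Metric : Type _ :=
  Bundle.ContMDiffRiemannianMetric (𝓡 4) ∞ (EuclideanSpace ℝ (Fin 4))
    (fun p : P => TangentSpace (𝓡 4) p)

end VectorFields

section Geometry

variable {𝒢 M P : Type*}
  [Group 𝒢] [TopologicalSpace 𝒢] [ChartedSpace (EuclideanSpace ℝ (Fin 3)) 𝒢]
  [TopologicalSpace M] [ChartedSpace (EuclideanSpace ℝ (Fin 1)) M]
  [TopologicalSpace P] [ChartedSpace (EuclideanSpace ℝ (Fin 4)) P]

/-! Sections of bundles associated with `P` are handled as equivariant functions on `P`. At `p`, the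
fibre of the adjoint bundle is identified with the Lie algebra by `x ↦ {p, x}`, and `{p, x}`
corresponds to the vertical vector `fund p x`. Thus the fibre of `𝔊 ⊕ TM` at the base point of `p`
is identified with the tangent space of `P` at `p`, and tensors on `𝔊 ⊕ TM` with invariant tensors
on `P`. -/

/-- The value at `p` of the fundamental vector field of `x`. -/
def PrincipalBundle.fund (𝔓 : PrincipalBundle 𝒢 M P) (p : P) (x : GroupLieAlgebra (𝓡 3) 𝒢) :
    TangentSpace (𝓡 4) p :=
  mfderiv (𝓡 3) (𝓡 4) (fun a : 𝒢 => 𝔓.act p a) 1 x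

/-- The Lie bracket of the fibre of the adjoint bundle, coming from the Lie bracket of invariant
vector fields on `P`: `[{p, x}, {p, y}] = -{p, [x, y]}`. -/
def fibreBracket (x y : GroupLieAlgebra (𝓡 3) 𝒢) : GroupLieAlgebra (𝓡 3) 𝒢 := -⁅x, y⁆

/-- Right translation by `a` preserves the metric. -/
def PrincipalBundle.InvariantMetric [IsManifold (𝓡 4) ∞ P] (𝔓 : PrincipalBundle 𝒢 M P)
    (g : Metric P) : Prop :=
  ∀ (p : P) (a : 𝒢) (X Y : TangentSpace (𝓡 4) p),
    g.inner (𝔓.act p a) (mfderiv (𝓡 4) (𝓡 4) (fun q => 𝔓.act q a) p X)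
      (mfderiv (𝓡 4) (𝓡 4) (fun q => 𝔓.act q a) p Y) = g.inner p X Y

/-- Right translation by `a` preserves the 3-form. -/
def PrincipalBundle.InvariantForm (𝔓 : PrincipalBundle 𝒢 M P)
    (H : (p : P) → TangentSpace (𝓡 4) p [⋀^Fin 3]→L[ℝ] ℝ) : Prop :=
  ∀ (p : P) (a : 𝒢) (X Y Z : TangentSpace (𝓡 4) p),
    H (𝔓.act p a) ![mfderiv (𝓡 4) (𝓡 4) (fun q => 𝔓.act q a) p X,
      mfderiv (𝓡 4) (𝓡 4) (fun q => 𝔓.act q a) p Y,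
      mfderiv (𝓡 4) (𝓡 4) (fun q => 𝔓.act q a) p Z] = H p ![X, Y, Z]

variable [IsManifold (𝓡 4) ∞ P]

/-- The fibre metric `G({p, x}, {p, y})`. -/
def PrincipalBundle.fibreMetric (𝔓 : PrincipalBundle 𝒢 M P) (g : Metric P) (p : P)
    (x y : GroupLieAlgebra (𝓡 3) 𝒢) : ℝ :=
  g.inner p (𝔓.fund p x) (𝔓.fund p y)

/-- The connection form of the metric: `conn g p Z` is the unique `x` for which
`Z - fund p x` is orthogonal to the fibre through `p`. -/
def PrincipalBundle.conn (𝔓 : PrincipalBundle 𝒢 M P) (g : Metric P) (p : P)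
    (Z : TangentSpace (𝓡 4) p) : GroupLieAlgebra (𝓡 3) 𝒢 :=
  Classical.epsilon fun x => ∀ y, g.inner p (Z - 𝔓.fund p x) (𝔓.fund p y) = 0

/-- The metric on the base, on the projections of `Z` and `W`: the inner product of their horizontal
parts. -/
def PrincipalBundle.baseMetric (𝔓 : PrincipalBundle 𝒢 M P) (g : Metric P) (p : P)
    (Z W : TangentSpace (𝓡 4) p) : ℝ :=
  g.inner p (Z - 𝔓.fund p (𝔓.conn g p Z)) (W - 𝔓.fund p (𝔓.conn g p W))

/-- The covariant derivative `D_v G` of the fibre metric, for `v` horizontal: for equivariant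
functions on `P`, covariant differentiation is differentiation in horizontal directions. -/
def PrincipalBundle.covG (𝔓 : PrincipalBundle 𝒢 M P) (g : Metric P) (p : P)
    (v : TangentSpace (𝓡 4) p) (x y : GroupLieAlgebra (𝓡 3) 𝒢) : ℝ :=
  dirDeriv p v (fun q => 𝔓.fibreMetric g q x y)

/-- `v` is a unit vector orthogonal to the fibre through `p` (the horizontal lift of a unit tangent
vector of the base), and `x` is an orthonormal basis of the Lie algebra for the fibre metric. -/
structure PrincipalBundle.IsFrameAt (𝔓 : PrincipalBundle 𝒢 M P) (g : Metric P) (p : P)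
    (v : TangentSpace (𝓡 4) p) (x : Fin 3 → GroupLieAlgebra (𝓡 3) 𝒢) : Prop where
  unit : g.inner p v v = 1
  horizontal : ∀ y, g.inner p v (𝔓.fund p y) = 0
  orthonormal : ∀ i j, 𝔓.fibreMetric g p (x i) (x j) = if i = j then 1 else 0

/-- A frame at each point of `U`, with `V` smooth. The functions `x i` need not be smooth: they are
only used to write traces at single points, and these do not depend on the orthonormal basis. -/
structure PrincipalBundle.IsFrameOn (𝔓 : PrincipalBundle 𝒢 M P) (g : Metric P) (U : Set P)
    (V : (p : P) → TangentSpace (𝓡 4) p) (x : P → Fin 3 → GroupLieAlgebra (𝓡 3) 𝒢) : Prop where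
  smooth : SmoothField U V
  frame : ∀ q ∈ U, 𝔓.IsFrameAt g q (V q) (x q)

/-- The orthonormal basis `v, x₀, x₁, x₂` of the tangent space of `P`. -/
def PrincipalBundle.fullFrame (𝔓 : PrincipalBundle 𝒢 M P) (p : P)
    (v : TangentSpace (𝓡 4) p) (x : Fin 3 → GroupLieAlgebra (𝓡 3) 𝒢) :
    Fin 4 → TangentSpace (𝓡 4) p :=
  Fin.cons v (fun i => 𝔓.fund p (x i))

/-- `H²(X, Y) = ⟨i_X H, i_Y H⟩`, the inner product taken over all pairs of indices. -/
def PrincipalBundle.formSq (𝔓 : PrincipalBundle 𝒢 M P)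
    (H : (p : P) → TangentSpace (𝓡 4) p [⋀^Fin 3]→L[ℝ] ℝ) (p : P)
    (v : TangentSpace (𝓡 4) p) (x : Fin 3 → GroupLieAlgebra (𝓡 3) 𝒢)
    (X Y : TangentSpace (𝓡 4) p) : ℝ :=
  ∑ a, ∑ b, H p ![X, 𝔓.fullFrame p v x a, 𝔓.fullFrame p v x b] *
    H p ![Y, 𝔓.fullFrame p v x a, 𝔓.fullFrame p v x b]

/-- The 2-form
`B = D_·H(·,*,*) - D_{·₁}G(·₂,π*) ∧ H(·₁,·₂,*) + (1/2) tr_G G([·₁,·₂],π*) ∧ H(·₁,·₂,*)`,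
with `π` the projection to the vertical part. Here `V` is parallel on the one-dimensional base. -/
def PrincipalBundle.flowForm (𝔓 : PrincipalBundle 𝒢 M P) (g : Metric P)
    (H : (p : P) → TangentSpace (𝓡 4) p [⋀^Fin 3]→L[ℝ] ℝ)
    (V : (p : P) → TangentSpace (𝓡 4) p) (x : P → Fin 3 → GroupLieAlgebra (𝓡 3) 𝒢)
    (p : P) (X Y : TangentSpace (𝓡 4) p) : ℝ :=
  dirDeriv p (V p) (fun q => H q ![V q, 𝔓.fund q (𝔓.conn g p X), 𝔓.fund q (𝔓.conn g p Y)])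
    - (∑ i, (𝔓.covG g p (V p) (x p i) (𝔓.conn g p X) * H p ![V p, 𝔓.fund p (x p i), Y]
          - 𝔓.covG g p (V p) (x p i) (𝔓.conn g p Y) * H p ![V p, 𝔓.fund p (x p i), X]))
    + (1 / 2) * ∑ i, ∑ j,
        (𝔓.fibreMetric g p (fibreBracket (x p i) (x p j)) (𝔓.conn g p X) *
            H p ![𝔓.fund p (x p i), 𝔓.fund p (x p j), Y]
          - 𝔓.fibreMetric g p (fibreBracket (x p i) (x p j)) (𝔓.conn g p Y) *
            H p ![𝔓.fund p (x p i), 𝔓.fund p (x p j), X])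

/-- A solution for times in `(0, T)` of the flow equations for an invariant metric `g t` and an
invariant closed 3-form `H t` on `P`, over a one-dimensional base (where the curvature of the
connection and the Ricci curvature of the base vanish). `V, x` run over all local frames; `V` is the
horizontal lift of a local unit field `v` with `∇_v v = 0`, so that `(D_· DG)_·` is `V[V[G]]`. -/
structure PrincipalBundle.IsFlow (𝔓 : PrincipalBundle 𝒢 M P) (T : ℝ) (g : ℝ → Metric P)
    (H : ℝ → (p : P) → TangentSpace (𝓡 4) p [⋀^Fin 3]→L[ℝ] ℝ) : Prop where
  smooth_metric : ∀ (U : Set P), IsOpen U → ∀ X Y, SmoothField U X → SmoothField U Y →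
    ContMDiffOn (𝓘(ℝ, ℝ).prod (𝓡 4)) 𝓘(ℝ, ℝ) ∞
      (fun q : ℝ × P => (g q.1).inner q.2 (X q.2) (Y q.2)) (Ioo 0 T ×ˢ U)
  smooth_form : ∀ (U : Set P), IsOpen U → ∀ X Y Z, SmoothField U X → SmoothField U Y →
    SmoothField U Z → ContMDiffOn (𝓘(ℝ, ℝ).prod (𝓡 4)) 𝓘(ℝ, ℝ) ∞
      (fun q : ℝ × P => H q.1 q.2 ![X q.2, Y q.2, Z q.2]) (Ioo 0 T ×ˢ U)
  invariant_metric : ∀ t ∈ Ioo 0 T, 𝔓.InvariantMetric (g t)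
  invariant_form : ∀ t ∈ Ioo 0 T, 𝔓.InvariantForm (H t)
  closed : ∀ t ∈ Ioo 0 T, ∀ (U : Set P), IsOpen U → ∀ X Y Z W, SmoothField U X →
    SmoothField U Y → SmoothField U Z → SmoothField U W →
    ∀ p ∈ U, extDerivThree (H t) X Y Z W p = 0
  flow_fibreMetric : ∀ t ∈ Ioo 0 T, ∀ (U : Set P), IsOpen U → ∀ V x, 𝔓.IsFrameOn (g t) U V x →
    ∀ p ∈ U, ∀ y z : GroupLieAlgebra (𝓡 3) 𝒢,
      deriv (fun s => 𝔓.fibreMetric (g s) p y z) t =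
        dirDeriv p (V p) (fun q => 𝔓.covG (g t) q (V q) y z)
          - (∑ i, 𝔓.covG (g t) p (V p) y (x p i) * 𝔓.covG (g t) p (V p) (x p i) z)
          + (∑ i, 𝔓.fibreMetric (g t) p (fibreBracket (x p i) y) (fibreBracket (x p i) z))
          - (1 / 2) * (∑ i, ∑ j,
              𝔓.fibreMetric (g t) p (fibreBracket (x p i) (x p j)) y *
                𝔓.fibreMetric (g t) p (fibreBracket (x p i) (x p j)) z)
          + (1 / 2) * 𝔓.formSq (H t) p (V p) (x p) (𝔓.fund p y) (𝔓.fund p z)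
  flow_conn : ∀ t ∈ Ioo 0 T, ∀ (U : Set P), IsOpen U → ∀ V x, 𝔓.IsFrameOn (g t) U V x →
    ∀ p ∈ U, ∀ y : GroupLieAlgebra (𝓡 3) 𝒢,
      𝔓.fibreMetric (g t) p (deriv (fun s => 𝔓.conn (g s) p (V p)) t) y =
        (∑ i, 𝔓.covG (g t) p (V p) (fibreBracket (x p i) y) (x p i))
          + (1 / 2) * 𝔓.formSq (H t) p (V p) (x p) (V p) (𝔓.fund p y)
  flow_baseMetric : ∀ t ∈ Ioo 0 T, ∀ (U : Set P), IsOpen U → ∀ V x, 𝔓.IsFrameOn (g t) U V x →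
    ∀ p ∈ U,
      deriv (fun s => 𝔓.baseMetric (g s) p (V p) (V p)) t =
        (1 / 2) * (∑ i, ∑ j, 𝔓.covG (g t) p (V p) (x p i) (x p j) ^ 2)
          + (1 / 2) * 𝔓.formSq (H t) p (V p) (x p) (V p) (V p)
  flow_form : ∀ t ∈ Ioo 0 T, ∀ (U : Set P), IsOpen U → ∀ V x, 𝔓.IsFrameOn (g t) U V x →
    ∀ X Y Z, SmoothField U X → SmoothField U Y → SmoothField U Z → ∀ p ∈ U,
      deriv (fun s => H s p ![X p, Y p, Z p]) t =
        extDerivTwo (𝔓.flowForm (g t) (H t) V x) X Y Z p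

/-- `|[,]|²` in an orthonormal basis `x` of the fibre. -/
def PrincipalBundle.bracketNormSq (𝔓 : PrincipalBundle 𝒢 M P) (g : Metric P) (p : P)
    (x : Fin 3 → GroupLieAlgebra (𝓡 3) 𝒢) : ℝ :=
  ∑ i, ∑ j, 𝔓.fibreMetric g p (fibreBracket (x i) (x j)) (fibreBracket (x i) (x j))

/-- `|H^𝔊|²` in an orthonormal basis `x` of the fibre, `H^𝔊` being the vertical part of `H`. -/
def PrincipalBundle.verticalNormSq (𝔓 : PrincipalBundle 𝒢 M P)
    (H : (p : P) → TangentSpace (𝓡 4) p [⋀^Fin 3]→L[ℝ] ℝ) (p : P)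
    (x : Fin 3 → GroupLieAlgebra (𝓡 3) 𝒢) : ℝ :=
  ∑ i, ∑ j, ∑ k, H p ![𝔓.fund p (x i), 𝔓.fund p (x j), 𝔓.fund p (x k)] ^ 2

/-- `|DG|²` in an orthonormal frame `v, x`. -/
def PrincipalBundle.covGNormSq (𝔓 : PrincipalBundle 𝒢 M P) (g : Metric P) (p : P)
    (v : TangentSpace (𝓡 4) p) (x : Fin 3 → GroupLieAlgebra (𝓡 3) 𝒢) : ℝ :=
  ∑ i, ∑ j, 𝔓.covG g p v (x i) (x j) ^ 2

end Geometry

end InvariantFlow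

end

noncomputable section

set_option linter.unusedSectionVars false

namespace InvariantFlow

/-! ### Lie brackets with the infinitesimal generators of an action -/

section Bracket

variable {E E' : Type*} [NormedAddCommGroup E] [NormedSpace ℝ E] [NormedAddCommGroup E']
  [NormedSpace ℝ E']

/-! The bounds come from a maximum principle that needs no initial data. An invariant scalar `f` on
`P` lives on the compact base. If `∂f/∂t ≤ -c f²` at every positive spatial maximum, then looking at
the maximum of `(t - ε) f` on `[ε, t]` and letting `ε → 0` gives `f ≤ 1 / (c t)`
(`PrincipalBundle.le_of_maximum_principle`). This is applied to `|[,]|²` with `c = 3/2`, and to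
`|H^𝔊|²` and `|DG|² + tr_g H²` with `c = 1/2`.

To verify the differential inequality at a point, everything is turned into 3×3 matrices. A
nilpotent Lie algebra of dimension three has a basis with `[e₀, e₁] = l e₂` and `e₂` central, and
Gram–Schmidt begun at the centre makes it orthonormal at the given point and time. Near the point
there is also an invariant unit horizontal field `V`. With `e` and `V` frozen, the unknowns are the
Gram matrix `Γ` of the fibre metric, the number `h = H(e₀, e₁, e₂)` and the skew matrix `κ = H(V, ·,
·)`; write `N = VΓ`, `A = VVΓ`, `J = Γ⁻¹`. Closedness of `H` makes `h` constant in space, and the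
vanishing of `dB` on three vertical vectors makes it constant in time.

In these terms `|[,]|² = 2 l² Γ₂₂² / det Γ` and `|H^𝔊|² = 6 h² / det Γ`. For both, the evolution of
`Γ` (`metricFlow`) and the first and second derivative tests along an integral curve of `V` give the
inequality at once.

The third quantity is `φ = tr(JNJN) - tr(JκJκ)`. As time passes, `V` stops being unit and
horizontal, so `φ` is expressed through the normalised horizontal part of the frozen field
(`flowEnergy`). The base metric grows at rate `φ/2`, which contributes `-φ²/2`; the motion of the
connection contributes further terms. An explicit computation (`energy_identity`) gives `∂φ/∂t = VVφ
- φ²/2` minus a sum of squares, and `VVφ ≤ 0` at a maximum.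

The geometric input is the computation of `dH` and `dB` on `V` and fundamental fields. It rests on
the bracket of a fundamental field with an equivariant field, obtained by differentiating the
equivariance relation (`mlieBracket_eq_of_related`). -/

theorem lieBracket_eq_of_related {F : E × E' → E} {u₀ : E} {w₀ y : E'} {X Y : E → E} {ξ : E' → E}
    (hF : ContDiffAt ℝ 2 F (u₀, w₀)) (hid : ∀ᶠ u in 𝓝 u₀, F (u, w₀) = u)
    (hX : DifferentiableAt ℝ X u₀) (hξ : DifferentiableAt ℝ ξ w₀)
    (hrel : ∀ᶠ w in 𝓝 w₀, X (F (u₀, w)) = fderiv ℝ F (u₀, w) (ξ w, 0))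
    (hY : ∀ᶠ u in 𝓝 u₀, Y u = fderiv ℝ F (u, w₀) (0, y)) :
    VectorField.lieBracket ℝ Y X u₀ = fderiv ℝ ξ w₀ y := by
  have hF1 : DifferentiableAt ℝ F (u₀, w₀) := hF.differentiableAt (by norm_num)
  have hD : DifferentiableAt ℝ (fderiv ℝ F) (u₀, w₀) :=
    (hF.fderiv_right (m := 1) (by norm_num)).differentiableAt (by norm_num)
  have hF0 : F (u₀, w₀) = u₀ := hid.self_of_nhds
  have hsymm : IsSymmSndFDerivAt ℝ F (u₀, w₀) := hF.isSymmSndFDerivAt (by simp)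
  have hleft : ∀ v, fderiv ℝ F (u₀, w₀) (v, 0) = v := by
    intro v
    have h1 : HasFDerivAt (fun u => F (u, w₀))
        ((fderiv ℝ F (u₀, w₀)).comp (ContinuousLinearMap.inl ℝ E E')) u₀ :=
      hF1.hasFDerivAt.comp u₀ (hasFDerivAt_prodMk_left u₀ w₀)
    have h2 : HasFDerivAt (fun u => F (u, w₀)) (ContinuousLinearMap.id ℝ E) u₀ :=
      (hasFDerivAt_id u₀).congr_of_eventuallyEq hid
    simpa using congrArg (fun L => L v) (h1.unique h2)
  have hYu : Y u₀ = fderiv ℝ F (u₀, w₀) (0, y) := hY.self_of_nhds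
  have hXu : X u₀ = ξ w₀ := by
    have := hrel.self_of_nhds
    rwa [hF0, hleft] at this
  have hY' : fderiv ℝ Y u₀ = fderiv ℝ (fun u => fderiv ℝ F (u, w₀) (0, y)) u₀ :=
    Filter.EventuallyEq.fderiv_eq hY
  have h3 : HasFDerivAt (fun u => fderiv ℝ F (u, w₀) (0, y))
      (((fderiv ℝ (fderiv ℝ F) (u₀, w₀)).comp (ContinuousLinearMap.inl ℝ E E')).flip (0, y)) u₀ := by
    have h0 : HasFDerivAt (fun u => fderiv ℝ F (u, w₀))
        ((fderiv ℝ (fderiv ℝ F) (u₀, w₀)).comp (ContinuousLinearMap.inl ℝ E E')) u₀ :=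
      hD.hasFDerivAt.comp u₀ (hasFDerivAt_prodMk_left u₀ w₀)
    have := h0.clm_apply (hasFDerivAt_const ((0 : E), y) u₀)
    refine this.congr_fderiv ?_
    ext v
    simp
  -- Differentiating `hrel` at `w₀` along `y` gives `DX(Y u₀)` on the left by the chain rule, and on
  -- the right a mixed second derivative of `F` plus `Dξ(y)`.
  have h4 : fderiv ℝ (fun w => X (F (u₀, w))) w₀ =
      fderiv ℝ (fun w => fderiv ℝ F (u₀, w) (ξ w, 0)) w₀ := Filter.EventuallyEq.fderiv_eq hrel
  have h5 : HasFDerivAt (fun w => X (F (u₀, w)))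
      ((fderiv ℝ X u₀).comp ((fderiv ℝ F (u₀, w₀)).comp (ContinuousLinearMap.inr ℝ E E'))) w₀ := by
    have hX' : HasFDerivAt X (fderiv ℝ X u₀) (F (u₀, w₀)) := by rw [hF0]; exact hX.hasFDerivAt
    exact HasFDerivAt.comp (f := fun w => F (u₀, w)) w₀ hX' (hF1.hasFDerivAt.comp w₀ (hasFDerivAt_prodMk_right u₀ w₀))
  have h0 : HasFDerivAt (fun w => fderiv ℝ F (u₀, w))
      ((fderiv ℝ (fderiv ℝ F) (u₀, w₀)).comp (ContinuousLinearMap.inr ℝ E E')) w₀ :=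
    hD.hasFDerivAt.comp w₀ (hasFDerivAt_prodMk_right u₀ w₀)
  have hξ0 : HasFDerivAt (fun w => (ξ w, (0 : E'))) ((fderiv ℝ ξ w₀).prod (0 : E' →L[ℝ] E')) w₀ :=
    hξ.hasFDerivAt.prodMk (hasFDerivAt_const _ _)
  have h6 := h0.clm_apply hξ0
  have h7 := h6.fderiv
  rw [h5.fderiv, h7] at h4
  have h8 := congrArg (fun L => L y) h4
  simp only [ContinuousLinearMap.comp_apply, ContinuousLinearMap.inr_apply, ← hYu,
    add_apply, ContinuousLinearMap.flip_apply,
    ContinuousLinearMap.prod_apply, zero_apply, hleft] at h8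
  rw [VectorField.lieBracket, h8, hY', h3.fderiv, hXu]
  simp only [ContinuousLinearMap.flip_apply, ContinuousLinearMap.comp_apply,
    ContinuousLinearMap.inl_apply]
  -- `DY(X u₀)` is the same mixed second derivative in the other order, so only `Dξ(y)` survives in
  -- the bracket.
  rw [hsymm.eq (ξ w₀, 0) (0, y)]
  abel

variable {N 𝒢 : Type*} [TopologicalSpace N] [ChartedSpace E N] [TopologicalSpace 𝒢]
  [ChartedSpace E' 𝒢]

theorem hasFDerivAt_writtenInCharts [IsManifold 𝓘(ℝ, E) 1 N] [IsManifold 𝓘(ℝ, E') 1 𝒢]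
    {f : 𝒢 → N} {a : 𝒢} (hf : MDifferentiableAt 𝓘(ℝ, E') 𝓘(ℝ, E) f a) {p : N}
    (hp : f a ∈ (extChartAt 𝓘(ℝ, E) p).source) :
    HasFDerivAt (fun w => extChartAt 𝓘(ℝ, E) p (f ((extChartAt 𝓘(ℝ, E') a).symm w)))
      ((mfderiv 𝓘(ℝ, E) 𝓘(ℝ, E) (extChartAt 𝓘(ℝ, E) p) (f a)).comp
        (mfderiv 𝓘(ℝ, E') 𝓘(ℝ, E) f a) : E' →L[ℝ] E) (extChartAt 𝓘(ℝ, E') a a) := by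
  have h0 : HasMFDerivAt 𝓘(ℝ, E') 𝓘(ℝ, E') (extChartAt 𝓘(ℝ, E') a).symm (extChartAt 𝓘(ℝ, E') a a)
      (ContinuousLinearMap.id ℝ E') := by
    have h := (mdifferentiableWithinAt_extChartAt_symm (I := 𝓘(ℝ, E'))
      (mem_extChartAt_target (I := 𝓘(ℝ, E')) a)).hasMFDerivWithinAt
    rw [mfderivWithin_range_extChartAt_symm, modelWithCornersSelf_coe, range_id] at h
    exact hasMFDerivWithinAt_univ.mp h
  have h1 : MDifferentiableAt 𝓘(ℝ, E) 𝓘(ℝ, E) (extChartAt 𝓘(ℝ, E) p) (f a) :=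
    mdifferentiableAt_extChartAt (by simpa using hp)
  have h2 := h1.hasMFDerivAt.comp a hf.hasMFDerivAt
  let L : E' →L[ℝ] E := (mfderiv 𝓘(ℝ, E) 𝓘(ℝ, E) (extChartAt 𝓘(ℝ, E) p) (f a)).comp
    (mfderiv 𝓘(ℝ, E') 𝓘(ℝ, E) f a)
  have h3 : HasMFDerivAt 𝓘(ℝ, E') 𝓘(ℝ, E) (extChartAt 𝓘(ℝ, E) p ∘ f)
      ((extChartAt 𝓘(ℝ, E') a).symm (extChartAt 𝓘(ℝ, E') a a)) L := by
    rw [extChartAt_to_inv]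
    exact h2
  have h4 : HasMFDerivAt 𝓘(ℝ, E') 𝓘(ℝ, E)
      ((extChartAt 𝓘(ℝ, E) p ∘ f) ∘ (extChartAt 𝓘(ℝ, E') a).symm) (extChartAt 𝓘(ℝ, E') a a)
      L := h3.comp _ h0
  exact hasMFDerivAt_iff_hasFDerivAt.mp h4

/-- If `X` is related to `ξ` under `q ↦ F q a`, then the Lie bracket of `X` with the infinitesimal
generator of `F` is the derivative of `ξ`. -/
theorem mlieBracket_eq_of_related [CompleteSpace E] [IsManifold 𝓘(ℝ, E) ∞ N]
    [IsManifold 𝓘(ℝ, E') ∞ 𝒢] {F : N → 𝒢 → N}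
    (hF : ContMDiff (𝓘(ℝ, E).prod 𝓘(ℝ, E')) 𝓘(ℝ, E) ∞ (fun q : N × 𝒢 => F q.1 q.2))
    {p : N} {o : 𝒢} (hid : ∀ q, F q o = q) (y : TangentSpace 𝓘(ℝ, E') o)
    {X Y : (q : N) → TangentSpace 𝓘(ℝ, E) q} {ξ : 𝒢 → E}
    (hX : MDifferentiableAt 𝓘(ℝ, E) 𝓘(ℝ, E).tangent (fun q => (⟨q, X q⟩ : TangentBundle 𝓘(ℝ, E) N)) p)
    (hξ : MDifferentiableAt 𝓘(ℝ, E') 𝓘(ℝ, E) ξ o)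
    (hrel : ∀ᶠ a in 𝓝 o, X (F p a) = mfderiv 𝓘(ℝ, E) 𝓘(ℝ, E) (fun q => F q a) p (ξ a))
    (hY : ∀ q, Y q = mfderiv 𝓘(ℝ, E') 𝓘(ℝ, E) (fun a => F q a) o y) :
    VectorField.mlieBracket 𝓘(ℝ, E) Y X p = mfderiv 𝓘(ℝ, E') 𝓘(ℝ, E) ξ o y := by
  set φ := extChartAt 𝓘(ℝ, E) p with hφ
  set ψ := extChartAt 𝓘(ℝ, E') o with hψ
  have : IsManifold 𝓘(ℝ, E) 1 N := .of_le (n := ∞) (by simp)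
  have : IsManifold 𝓘(ℝ, E') 1 𝒢 := .of_le (n := ∞) (by simp)
  have : IsManifold 𝓘(ℝ, E) 2 N := .of_le (n := ∞) (by norm_cast)
  let T : ((q : N) → TangentSpace 𝓘(ℝ, E) q) → N → E :=
    fun Z q => mfderiv 𝓘(ℝ, E) 𝓘(ℝ, E) φ q (Z q)
  -- The bracket on the manifold is defined by pulling fields back along the inverse chart. On the
  -- chart target this is the pushforward `T` by the chart, which is easier to compare with
  -- derivatives of `F'`.
  have key : ∀ Z : (q : N) → TangentSpace 𝓘(ℝ, E) q, ∀ u ∈ φ.target,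
      (VectorField.mpullbackWithin 𝓘(ℝ, E) 𝓘(ℝ, E) φ.symm Z univ u : E) =
        T Z (φ.symm u) := by
    intro Z u hu
    rw [← range_id, ← modelWithCornersSelf_coe ℝ E, VectorField.mpullbackWithin_apply]
    have h1 := mfderivWithin_extChartAt_symm_comp_mfderiv_extChartAt (I := 𝓘(ℝ, E)) hu
    have h2 := mfderiv_extChartAt_comp_mfderivWithin_extChartAt_symm (I := 𝓘(ℝ, E)) hu
    rw [ContinuousLinearMap.inverse_eq h1 h2]
    rfl
  let F' : E × E' → E := fun z => φ (F (φ.symm z.1) (ψ.symm z.2))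
  have hslice₁ : ∀ a, MDifferentiable 𝓘(ℝ, E) 𝓘(ℝ, E) (fun q => F q a) := fun a =>
    (hF.comp (contMDiff_id.prodMk contMDiff_const)).mdifferentiable (by simp)
  have hslice₂ : ∀ q, MDifferentiable 𝓘(ℝ, E') 𝓘(ℝ, E) (fun a => F q a) := fun q =>
    (hF.comp (contMDiff_const.prodMk contMDiff_id)).mdifferentiable (by simp)
  have hφp : φ.symm (φ p) = p := extChartAt_to_inv p
  have hψo : ψ.symm (ψ o) = o := extChartAt_to_inv o
  have hF' : ContDiffAt ℝ ∞ F' (φ p, ψ o) := by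
    rw [← contMDiffAt_iff_contDiffAt]
    have h1 : ContMDiffAt 𝓘(ℝ, E) 𝓘(ℝ, E) ∞ φ.symm (φ p) :=
      (contMDiffOn_extChartAt_symm p).contMDiffAt (extChartAt_target_mem_nhds p)
    have h2 : ContMDiffAt 𝓘(ℝ, E') 𝓘(ℝ, E') ∞ ψ.symm (ψ o) :=
      (contMDiffOn_extChartAt_symm o).contMDiffAt (extChartAt_target_mem_nhds o)
    have h3 : ContMDiffAt 𝓘(ℝ, E) 𝓘(ℝ, E) ∞ φ (F (φ.symm (φ p)) (ψ.symm (ψ o))) := by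
      rw [hφp, hψo, hid]
      exact contMDiffAt_extChartAt
    have h4 := h3.comp (φ p, ψ o) (f := fun z : E × E' => F (φ.symm z.1) (ψ.symm z.2))
      (hF.contMDiffAt.comp (φ p, ψ o) ((h1.comp (φ p, ψ o) contMDiffAt_fst).prodMk
        (h2.comp (φ p, ψ o) contMDiffAt_snd)))
    rw [← modelWithCornersSelf_prod, chartedSpaceSelf_prod] at h4
    exact h4
  have htarget : ∀ᶠ u in 𝓝 (φ p), u ∈ φ.target := extChartAt_target_mem_nhds p
  have hb : VectorField.mlieBracket 𝓘(ℝ, E) Y X p = VectorField.lieBracket ℝ (fun u => T Y (φ.symm u))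
      (fun u => T X (φ.symm u)) (φ p) := by
    rw [VectorField.mlieBracket, VectorField.mlieBracketWithin_apply, mfderiv_extChartAt_self]
    simp only [modelWithCornersSelf_coe, range_id, preimage_univ, inter_univ]
    refine (congrArg (fun L : E →L[ℝ] E => L _) (ContinuousLinearMap.inverse_id)).trans ?_
    refine (congrFun VectorField.lieBracketWithin_univ _).trans ?_
    refine Filter.EventuallyEq.lieBracket_vectorField_eq ?_ ?_
    · filter_upwards [htarget] with u hu
      exact key Y u hu
    · filter_upwards [htarget] with u hu
      exact key X u hu
  rw [hb]
  have := lieBracket_eq_of_related (F := F') (u₀ := φ p) (w₀ := ψ o) (y := y)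
    (X := fun u => T X (φ.symm u)) (Y := fun u => T Y (φ.symm u)) (ξ := ξ ∘ ψ.symm)
    (hF'.of_le (by norm_cast)) ?_ ?_ ?_ ?_ ?_
  · rw [this]
    rw [hξ.mfderiv, modelWithCornersSelf_coe, range_id, fderivWithin_univ]
    rfl
  · filter_upwards [htarget] with u hu
    simp only [F', hψo, hid, φ.right_inv hu]
  · have := MDifferentiableWithinAt.differentiableWithinAt_mpullbackWithin_vectorField (s := univ) (x := p) hX.mdifferentiableWithinAt
    simp only [modelWithCornersSelf_coe, range_id, preimage_univ, inter_univ] at this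
    refine (differentiableWithinAt_univ.mp this).congr_of_eventuallyEq ?_
    filter_upwards [htarget] with u hu
    exact (key X u hu).symm
  · have h := hξ.differentiableWithinAt_writtenInExtChartAt
    rw [modelWithCornersSelf_coe, range_id, differentiableWithinAt_univ] at h
    exact h
  · have hc : ContinuousAt (fun w => F p (ψ.symm w)) (ψ o) := by
      have h2 : ContinuousAt ψ.symm (ψ o) := continuousAt_extChartAt_symm o
      exact ContinuousAt.comp (g := fun a => F p a) (hslice₂ p _).continuousAt h2
    have hψt : Filter.Tendsto ψ.symm (𝓝 (ψ o)) (𝓝 o) := by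
      have h2 : ContinuousAt ψ.symm (ψ o) := continuousAt_extChartAt_symm o
      rwa [ContinuousAt, hψo] at h2
    have hs : ∀ᶠ w in 𝓝 (ψ o), F p (ψ.symm w) ∈ φ.source := by
      refine hc.eventually_mem ?_
      rw [hψo, hid]
      exact extChartAt_source_mem_nhds p
    have hdiff : ∀ᶠ z in 𝓝 (φ p, ψ o), DifferentiableAt ℝ F' z :=
      ((hF'.of_le (m := 1) (by norm_cast)).eventually (by simp)).mono fun z hz => hz.differentiableAt (by simp)
    have hdiff' : ∀ᶠ w in 𝓝 (ψ o), DifferentiableAt ℝ F' (φ p, w) :=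
      (Continuous.prodMk_right (φ p)).continuousAt.eventually hdiff
    filter_upwards [hs, hψt.eventually hrel, hdiff'] with w hw hrelw hd
    have h1 := hasFDerivAt_writtenInCharts (hslice₁ (ψ.symm w) p) hw
    have h2 : HasFDerivAt (fun u => F' (u, w))
        ((fderiv ℝ F' (φ p, w)).comp (ContinuousLinearMap.inl ℝ E E')) (φ p) :=
      HasFDerivAt.comp (g := F') (φ p) hd.hasFDerivAt (hasFDerivAt_prodMk_left (φ p) w)
    have h3 := h2.unique h1
    have h4 := congrArg (fun L : E →L[ℝ] E => L (ξ (ψ.symm w))) h3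
    simp only [ContinuousLinearMap.comp_apply, ContinuousLinearMap.inl_apply] at h4
    refine Eq.trans ?_ h4.symm
    simp only [T, F', hφp, φ.left_inv hw, hrelw]
    rfl
  · have hdiff : ∀ᶠ z in 𝓝 (φ p, ψ o), DifferentiableAt ℝ F' z :=
      ((hF'.of_le (m := 1) (by norm_cast)).eventually (by simp)).mono fun z hz => hz.differentiableAt (by simp)
    have hdiff' : ∀ᶠ u in 𝓝 (φ p), DifferentiableAt ℝ F' (u, ψ o) :=
      (Continuous.prodMk_left (ψ o)).continuousAt.eventually hdiff
    filter_upwards [htarget, hdiff'] with u hu hd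
    have hu' : F (φ.symm u) o ∈ φ.source := by rw [hid]; exact φ.map_target hu
    have h1 := hasFDerivAt_writtenInCharts (hslice₂ (φ.symm u) o) hu'
    have h2 : HasFDerivAt (fun w => F' (u, w))
        ((fderiv ℝ F' (u, ψ o)).comp (ContinuousLinearMap.inr ℝ E E')) (ψ o) :=
      HasFDerivAt.comp (g := F') (ψ o) hd.hasFDerivAt (hasFDerivAt_prodMk_right u (ψ o))
    have h3 := h2.unique h1
    have h4 := congrArg (fun L : E' →L[ℝ] E => L y) h3
    refine Eq.trans ?_ h4.symm
    simp only [T, hY]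
    -- The two base points are equal only propositionally, so their tangent spaces differ as types;
    -- viewing the derivative as a map between fixed model spaces allows the rewriting by `hid`.
    let D : N → E →L[ℝ] E := fun q => mfderiv 𝓘(ℝ, E) 𝓘(ℝ, E) φ q
    change D (φ.symm u) _ = D (F (φ.symm u) o) _
    rw [hid]
    rfl

end Bracket

end InvariantFlow

namespace InvariantFlow

/-! ### The chain rule in model spaces, the adjoint representation and fundamental fields -/

section Composition

variable {E E' E'' : Type*} [NormedAddCommGroup E] [NormedSpace ℝ E] [NormedAddCommGroup E']
  [NormedSpace ℝ E'] [NormedAddCommGroup E''] [NormedSpace ℝ E'']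
  {M M' M'' : Type*} [TopologicalSpace M] [ChartedSpace E M] [TopologicalSpace M']
  [ChartedSpace E' M'] [TopologicalSpace M''] [ChartedSpace E'' M'']

/-- The chain rule, where all tangent vectors are regarded as elements of the model spaces. -/
theorem mfderiv_comp_apply_of_eq {f : M → M'} {g : M' → M''} {x : M} {y : M'}
    (hg : MDifferentiableAt 𝓘(ℝ, E') 𝓘(ℝ, E'') g y) (hf : MDifferentiableAt 𝓘(ℝ, E) 𝓘(ℝ, E') f x)
    (h : f x = y) (v : E) :
    (mfderiv 𝓘(ℝ, E) 𝓘(ℝ, E'') (fun z => g (f z)) x : E →L[ℝ] E'') v =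
      (mfderiv 𝓘(ℝ, E') 𝓘(ℝ, E'') g y : E' →L[ℝ] E'')
        ((mfderiv 𝓘(ℝ, E) 𝓘(ℝ, E') f x : E →L[ℝ] E') v) := by
  subst h
  exact congrArg (fun L : E →L[ℝ] E'' => L v) (mfderiv_comp x hg hf)

theorem hasMFDerivAt_prodMk_space {f : M → E'} {g : M → E''} {x : M} {f' : E →L[ℝ] E'}
    {g' : E →L[ℝ] E''} (hf : HasMFDerivAt 𝓘(ℝ, E) 𝓘(ℝ, E') f x f')
    (hg : HasMFDerivAt 𝓘(ℝ, E) 𝓘(ℝ, E'') g x g') :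
    HasMFDerivAt 𝓘(ℝ, E) 𝓘(ℝ, E' × E'') (fun z => (f z, g z)) x (f'.prod g') :=
  ⟨hf.1.prodMk hg.1, HasFDerivWithinAt.prodMk hf.2 hg.2⟩

theorem mfderiv_apply_congr {f g : M → M'} (h : f = g) (x : M) (v : E) :
    (mfderiv 𝓘(ℝ, E) 𝓘(ℝ, E') f x : E →L[ℝ] E') v =
      (mfderiv 𝓘(ℝ, E) 𝓘(ℝ, E') g x : E →L[ℝ] E') v := by
  rw [h]

end Composition

section Adjoint

variable {𝒢 : Type*} [Group 𝒢] [TopologicalSpace 𝒢] [ChartedSpace (EuclideanSpace ℝ (Fin 3)) 𝒢]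
  [LieGroup (𝓡 3) ∞ 𝒢]

/-- The adjoint representation of a Lie group on its Lie algebra. -/
def adjointRep (a : 𝒢) : GroupLieAlgebra (𝓡 3) 𝒢 →L[ℝ] GroupLieAlgebra (𝓡 3) 𝒢 :=
  (mfderiv (𝓡 3) (𝓡 3) (fun b : 𝒢 => a * b * a⁻¹) 1 :
    EuclideanSpace ℝ (Fin 3) →L[ℝ] EuclideanSpace ℝ (Fin 3))

theorem contMDiff_conj (a : 𝒢) : ContMDiff (𝓡 3) (𝓡 3) ∞ (fun b : 𝒢 => a * b * a⁻¹) :=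
  (contMDiff_const.mul contMDiff_id).mul contMDiff_const

/-- Conjugation is jointly smooth, so its partial derivative at the identity depends differentiably
on `a` when read in tangent coordinates. Because conjugation fixes the identity, both coordinate
changes are the identity and this reading is `adjointRep a` itself. -/
theorem mdifferentiableAt_adjointRep (y : GroupLieAlgebra (𝓡 3) 𝒢) :
    MDifferentiableAt (M' := EuclideanSpace ℝ (Fin 3)) (𝓡 3) (𝓡 3) (fun a : 𝒢 => adjointRep a y) 1 := by
  have : IsManifold (𝓡 3) 1 𝒢 := .of_le (n := ∞) (by simp)
  have hf : ContMDiffAt ((𝓡 3).prod (𝓡 3)) (𝓡 3) ∞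
      (Function.uncurry fun a b : 𝒢 => a * b * a⁻¹) ((1 : 𝒢), (1 : 𝒢)) :=
    ((contMDiff_fst.mul contMDiff_snd).mul contMDiff_fst.inv).contMDiffAt
  have h := hf.mfderiv (m := 1) (fun a b : 𝒢 => a * b * a⁻¹) (fun _ : 𝒢 => (1 : 𝒢))
    contMDiffAt_const (by norm_cast)
  have h2 : ContMDiffAt (M' := EuclideanSpace ℝ (Fin 3) →L[ℝ] EuclideanSpace ℝ (Fin 3)) (𝓡 3) 𝓘(ℝ, EuclideanSpace ℝ (Fin 3) →L[ℝ] EuclideanSpace ℝ (Fin 3)) 1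
      (fun a : 𝒢 => adjointRep a) 1 := by
    refine h.congr_of_eventuallyEq (Filter.Eventually.of_forall fun a => ?_)
    have e : ∀ a : 𝒢, a * 1 * a⁻¹ = 1 := by simp
    rw [inTangentCoordinates_eq_mfderiv_comp (by simp) (by simp)]
    have h3 : ∀ c d : 𝒢, c = d → (mfderiv (𝓡 3) (𝓡 3) (extChartAt (𝓡 3) c) d :
        EuclideanSpace ℝ (Fin 3) →L[ℝ] EuclideanSpace ℝ (Fin 3)) = ContinuousLinearMap.id ℝ _ := by
      rintro c _ rfl
      exact mfderiv_extChartAt_self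
    have h4 : (mfderivWithin (𝓡 3) (𝓡 3) (extChartAt (𝓡 3) (1 : 𝒢)).symm (range (𝓡 3))
        (extChartAt (𝓡 3) (1 : 𝒢) 1) : EuclideanSpace ℝ (Fin 3) →L[ℝ] EuclideanSpace ℝ (Fin 3)) =
        ContinuousLinearMap.id ℝ _ := mfderivWithin_range_extChartAt_symm
    ext1 v
    change _ = (mfderiv (𝓡 3) (𝓡 3) (extChartAt (𝓡 3) ((1 : 𝒢) * 1 * 1⁻¹)) (a * 1 * a⁻¹) :
        EuclideanSpace ℝ (Fin 3) →L[ℝ] EuclideanSpace ℝ (Fin 3)) (adjointRep a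
        ((mfderivWithin (𝓡 3) (𝓡 3) (extChartAt (𝓡 3) (1 : 𝒢)).symm (range (𝓡 3))
        (extChartAt (𝓡 3) (1 : 𝒢) 1) : EuclideanSpace ℝ (Fin 3) →L[ℝ] EuclideanSpace ℝ (Fin 3)) v))
    rw [h3 _ _ (by simp), h4]
    rfl
  exact (h2.mdifferentiableAt (by simp)).clm_apply mdifferentiableAt_const

/-- The left-invariant field of `y` has at `a` the value `dR_a (Ad_a y)`. It is therefore related to
`a ↦ Ad_a y` under right multiplication, whose generators are the left-invariant fields. -/
theorem mfderiv_adjointRep (x y : GroupLieAlgebra (𝓡 3) 𝒢) :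
    mfderiv (M' := EuclideanSpace ℝ (Fin 3)) (𝓡 3) (𝓡 3) (fun a : 𝒢 => adjointRep a y) 1 x = ⁅x, y⁆ := by
  have : IsManifold (𝓡 3) 1 𝒢 := .of_le (n := ∞) (by simp)
  symm
  refine mlieBracket_eq_of_related (F := fun q a : 𝒢 => q * a) (contMDiff_mul (𝓡 3) ∞)
    (fun q => mul_one q) x (mdifferentiableAt_mulInvariantVectorField y)
    (mdifferentiableAt_adjointRep y) ?_ (fun q => rfl)
  refine Filter.Eventually.of_forall fun a => ?_
  have h1 : (fun b : 𝒢 => 1 * a * b) = fun b => (a * b * a⁻¹) * a := by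
    ext b; simp
  refine (mfderiv_apply_congr (E := EuclideanSpace ℝ (Fin 3)) h1 (1 : 𝒢) y).trans ?_
  exact mfderiv_comp_apply_of_eq (g := fun q : 𝒢 => q * a) (y := (1 : 𝒢))
    ((contMDiff_mul_right (n := ∞)).contMDiffAt.mdifferentiableAt (by simp))
    ((contMDiff_conj a).contMDiffAt.mdifferentiableAt (by simp)) (by simp) y

variable (𝒢) in
/-- The derivative of `a ↦ adjointRep a y` at the identity. -/
def adjointRepDeriv (y : GroupLieAlgebra (𝓡 3) 𝒢) :
    EuclideanSpace ℝ (Fin 3) →L[ℝ] EuclideanSpace ℝ (Fin 3) :=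
  mfderiv (M' := EuclideanSpace ℝ (Fin 3)) (𝓡 3) (𝓡 3) (fun a : 𝒢 => adjointRep a y) 1

theorem hasMFDerivAt_adjointRep (y : GroupLieAlgebra (𝓡 3) 𝒢) :
    HasMFDerivAt (M' := EuclideanSpace ℝ (Fin 3)) (𝓡 3) (𝓡 3) (fun a : 𝒢 => adjointRep a y) 1
      (adjointRepDeriv 𝒢 y) :=
  (mdifferentiableAt_adjointRep y).hasMFDerivAt

theorem adjointRepDeriv_apply (x y : GroupLieAlgebra (𝓡 3) 𝒢) : adjointRepDeriv 𝒢 y x = ⁅x, y⁆ :=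
  mfderiv_adjointRep x y

theorem hasMFDerivAt_clm_adjointRep {E : Type*} [NormedAddCommGroup E] [NormedSpace ℝ E]
    (L : EuclideanSpace ℝ (Fin 3) →L[ℝ] E) (z : GroupLieAlgebra (𝓡 3) 𝒢) :
    HasMFDerivAt (𝓡 3) 𝓘(ℝ, E) (fun a : 𝒢 => L (adjointRep a z)) 1
      (L.comp (adjointRepDeriv 𝒢 z)) :=
  HasMFDerivAt.comp (I' := 𝓡 3) (M' := EuclideanSpace ℝ (Fin 3)) (1 : 𝒢)
    L.hasFDerivAt.hasMFDerivAt (hasMFDerivAt_adjointRep z)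

theorem hasMFDerivAt_bilin_adjointRep {B : EuclideanSpace ℝ (Fin 3) × EuclideanSpace ℝ (Fin 3) → ℝ}
    (hB : IsBoundedBilinearMap ℝ B) (y z : GroupLieAlgebra (𝓡 3) 𝒢) :
    HasMFDerivAt (𝓡 3) 𝓘(ℝ, ℝ) (fun a : 𝒢 => B (adjointRep a y, adjointRep a z)) 1
      ((hB.deriv (adjointRep (1 : 𝒢) y, adjointRep (1 : 𝒢) z)).comp
        ((adjointRepDeriv 𝒢 y).prod (adjointRepDeriv 𝒢 z))) :=
  HasMFDerivAt.comp (I' := 𝓘(ℝ, EuclideanSpace ℝ (Fin 3) × EuclideanSpace ℝ (Fin 3)))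
    (M' := EuclideanSpace ℝ (Fin 3) × EuclideanSpace ℝ (Fin 3)) (1 : 𝒢)
    (hB.hasFDerivAt _).hasMFDerivAt
    (hasMFDerivAt_prodMk_space (hasMFDerivAt_adjointRep y) (hasMFDerivAt_adjointRep z))

theorem adjointRep_one (y : GroupLieAlgebra (𝓡 3) 𝒢) : adjointRep (1 : 𝒢) y = y := by
  have h1 : (fun b : 𝒢 => 1 * b * 1⁻¹) = id := by ext b; simp
  refine (mfderiv_apply_congr (E := EuclideanSpace ℝ (Fin 3)) h1 (1 : 𝒢) y).trans ?_
  exact congrArg (fun L : EuclideanSpace ℝ (Fin 3) →L[ℝ] EuclideanSpace ℝ (Fin 3) => L y) mfderiv_id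

end Adjoint

section Bundle

variable {𝒢 M P : Type*}
  [Group 𝒢] [TopologicalSpace 𝒢] [ChartedSpace (EuclideanSpace ℝ (Fin 3)) 𝒢] [LieGroup (𝓡 3) ∞ 𝒢]
  [TopologicalSpace M] [ChartedSpace (EuclideanSpace ℝ (Fin 1)) M]
  [TopologicalSpace P] [ChartedSpace (EuclideanSpace ℝ (Fin 4)) P] [IsManifold (𝓡 4) ∞ P]
  (𝔓 : PrincipalBundle 𝒢 M P)

namespace PrincipalBundle

theorem contMDiff_orbit (p : P) : ContMDiff (𝓡 3) (𝓡 4) ∞ (fun a => 𝔓.act p a) :=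
  𝔓.contMDiff_act.comp (contMDiff_const.prodMk contMDiff_id)

theorem contMDiff_translate (a : 𝒢) : ContMDiff (𝓡 4) (𝓡 4) ∞ (fun q => 𝔓.act q a) :=
  𝔓.contMDiff_act.comp (contMDiff_id.prodMk contMDiff_const)

/-- The derivative of right translation, with tangent vectors in the model space. -/
def push (a : 𝒢) (p : P) (v : TangentSpace (𝓡 4) p) : TangentSpace (𝓡 4) (𝔓.act p a) :=
  mfderiv (𝓡 4) (𝓡 4) (fun q => 𝔓.act q a) p v

theorem fund_add (p : P) (x y : GroupLieAlgebra (𝓡 3) 𝒢) :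
    𝔓.fund p (x + y) = 𝔓.fund p x + 𝔓.fund p y :=
  map_add (mfderiv (𝓡 3) (𝓡 4) (fun a : 𝒢 => 𝔓.act p a) 1) x y

theorem fund_smul (p : P) (c : ℝ) (x : GroupLieAlgebra (𝓡 3) 𝒢) :
    𝔓.fund p (c • x) = c • 𝔓.fund p x :=
  map_smul (mfderiv (𝓡 3) (𝓡 4) (fun a : 𝒢 => 𝔓.act p a) 1) c x

/-- Differentiate `(p · a) · b = (p · (a b a⁻¹)) · a` in `b` at the identity. -/
theorem fund_act (p : P) (a : 𝒢) (y : GroupLieAlgebra (𝓡 3) 𝒢) :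
    𝔓.fund (𝔓.act p a) y = 𝔓.push a p (𝔓.fund p (adjointRep a y)) := by
  have h1 : (fun b : 𝒢 => 𝔓.act (𝔓.act p a) b) = fun b => 𝔓.act (𝔓.act p (a * b * a⁻¹)) a := by
    ext b; simp [← 𝔓.act_mul]
  refine (mfderiv_apply_congr (E := EuclideanSpace ℝ (Fin 3)) h1 (1 : 𝒢) y).trans ?_
  refine (mfderiv_comp_apply_of_eq (g := fun q => 𝔓.act q a) (y := p)
    ((𝔓.contMDiff_translate a).contMDiffAt.mdifferentiableAt (by simp))
    (((𝔓.contMDiff_orbit p).comp (contMDiff_conj a)).contMDiffAt.mdifferentiableAt (by simp))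
    (by simp [𝔓.act_one]) y).trans ?_
  refine congrArg (mfderiv (𝓡 4) (𝓡 4) (fun q => 𝔓.act q a) p :
    EuclideanSpace ℝ (Fin 4) →L[ℝ] EuclideanSpace ℝ (Fin 4)) ?_
  exact mfderiv_comp_apply_of_eq (g := fun b => 𝔓.act p b) (y := (1 : 𝒢))
    ((𝔓.contMDiff_orbit p).contMDiffAt.mdifferentiableAt (by simp))
    ((contMDiff_conj a).contMDiffAt.mdifferentiableAt (by simp)) (by simp) y

/-- The field is the tangent map of the action applied to the smooth section `(0_p, y)` over `P ×
{1}`. -/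
theorem smoothField_fund (y : GroupLieAlgebra (𝓡 3) 𝒢) : SmoothField univ (fun p : P => 𝔓.fund p y) := by
  have S₁ : ContMDiff (𝓡 4) ((𝓡 4).tangent.prod (𝓡 3).tangent) ∞
      (fun p : P => ((⟨p, 0⟩ : TangentBundle (𝓡 4) P), (⟨1, y⟩ : TangentBundle (𝓡 3) 𝒢))) :=
    (Bundle.contMDiff_zeroSection _ _).prodMk contMDiff_const
  have S₂ := (contMDiff_equivTangentBundleProd_symm (I := 𝓡 4) (M := P) (I' := 𝓡 3) (M' := 𝒢)
    (n := ∞)).comp S₁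
  have S₃ := (ContMDiff.contMDiff_tangentMap 𝔓.contMDiff_act (m := ∞) (by simp)).comp S₂
  rw [SmoothField, contMDiffOn_univ]
  convert! S₃ with p
  · simp [𝔓.act_one]
  · simp only [Function.comp_apply, tangentMap]
    rw [mfderiv_prod_eq_add_apply (𝔓.contMDiff_act.mdifferentiable (by simp) _)]
    simp +instances [fund]
    erw [map_zero, zero_add]
    rfl

theorem mdifferentiableAt_fund (y : GroupLieAlgebra (𝓡 3) 𝒢) (p : P) :
    MDifferentiableAt (𝓡 4) (𝓡 4).tangent
      (fun q => (⟨q, 𝔓.fund q y⟩ : TangentBundle (𝓡 4) P)) p :=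
  ((𝔓.smoothField_fund y).contMDiffAt Filter.univ_mem).mdifferentiableAt (by simp)

/-- Differentiation along a fundamental field is differentiation along the orbit. -/
theorem dirDeriv_fund {p : P} (x : GroupLieAlgebra (𝓡 3) 𝒢) {f : P → ℝ}
    (hf : MDifferentiableAt (𝓡 4) 𝓘(ℝ, ℝ) f p) :
    dirDeriv p (𝔓.fund p x) f = mfderiv (𝓡 3) 𝓘(ℝ, ℝ) (fun a => f (𝔓.act p a)) 1 x :=
  (mfderiv_comp_apply_of_eq (g := f) (y := p) hf
    ((𝔓.contMDiff_orbit p).contMDiffAt.mdifferentiableAt (by simp)) (𝔓.act_one p) x).symm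

/-- By `fund_act` the field of `z` is related to `a ↦ fund p (Ad_a z)`, whose derivative along `y`
is `fund p ⁅y, z⁆`. There is no sign because the action is from the right. -/
theorem mlieBracket_fund_fund (p : P) (y z : GroupLieAlgebra (𝓡 3) 𝒢) :
    VectorField.mlieBracket (𝓡 4) (fun q => 𝔓.fund q y) (fun q => 𝔓.fund q z) p =
      𝔓.fund p ⁅y, z⁆ := by
  have : IsManifold (𝓡 3) 1 𝒢 := .of_le (n := ∞) (by simp)
  let L : EuclideanSpace ℝ (Fin 3) →L[ℝ] EuclideanSpace ℝ (Fin 4) :=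
    mfderiv (𝓡 3) (𝓡 4) (fun a : 𝒢 => 𝔓.act p a) 1
  have h1 := mlieBracket_eq_of_related (F := 𝔓.act) 𝔓.contMDiff_act 𝔓.act_one y (p := p)
    (ξ := fun a : 𝒢 => L (adjointRep a z))
    (𝔓.mdifferentiableAt_fund z p) (hasMFDerivAt_clm_adjointRep L z).mdifferentiableAt
    (Filter.Eventually.of_forall fun a => 𝔓.fund_act p a z) (fun q => rfl)
  refine h1.trans ?_
  rw [(hasMFDerivAt_clm_adjointRep L z).mfderiv]
  exact congrArg L (mfderiv_adjointRep y z)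

/-- Invariance says that the related function `ξ` is constant. It is needed only for `a` near the
identity, so `V` may be defined on an open set that is not a union of orbits. -/
theorem mlieBracket_fund_of_invariant {p : P} (y : GroupLieAlgebra (𝓡 3) 𝒢)
    {V : (q : P) → TangentSpace (𝓡 4) q}
    (hV : MDifferentiableAt (𝓡 4) (𝓡 4).tangent (fun q => (⟨q, V q⟩ : TangentBundle (𝓡 4) P)) p)
    (hinv : ∀ᶠ a in 𝓝 (1 : 𝒢), V (𝔓.act p a) = 𝔓.push a p (V p)) :
    VectorField.mlieBracket (𝓡 4) (fun q => 𝔓.fund q y) V p = 0 := by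
  have h1 := mlieBracket_eq_of_related (F := 𝔓.act) 𝔓.contMDiff_act 𝔓.act_one y (p := p)
    (ξ := fun _ : 𝒢 => V p) hV mdifferentiableAt_const hinv (fun q => rfl)
  refine h1.trans ?_
  exact congrArg (fun L : EuclideanSpace ℝ (Fin 3) →L[ℝ] EuclideanSpace ℝ (Fin 4) => L y)
    (mfderiv_const (I := 𝓡 3) (I' := 𝓡 4) (M := 𝒢) (M' := EuclideanSpace ℝ (Fin 4)))

/-- The Lie derivative of an equivariant bilinear form along a fundamental field. -/
theorem dirDeriv_fund_of_equivariant {p : P} {f : P → ℝ}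
    (B : GroupLieAlgebra (𝓡 3) 𝒢 →ₗ[ℝ] GroupLieAlgebra (𝓡 3) 𝒢 →ₗ[ℝ] ℝ)
    (x y z : GroupLieAlgebra (𝓡 3) 𝒢)
    (heq : ∀ᶠ a in 𝓝 (1 : 𝒢), f (𝔓.act p a) = B (adjointRep a y) (adjointRep a z))
    (hdiff : MDifferentiableAt (𝓡 4) 𝓘(ℝ, ℝ) f p) :
    dirDeriv p (𝔓.fund p x) f = B ⁅x, y⁆ z + B y ⁅x, z⁆ := by
  rw [𝔓.dirDeriv_fund x hdiff]
  let B' : EuclideanSpace ℝ (Fin 3) →ₗ[ℝ] EuclideanSpace ℝ (Fin 3) →ₗ[ℝ] ℝ := B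
  let B₂ : EuclideanSpace ℝ (Fin 3) →L[ℝ] EuclideanSpace ℝ (Fin 3) →L[ℝ] ℝ :=
    (LinearMap.toContinuousLinearMap.toLinearMap.comp B').toContinuousLinearMap
  have h := hasMFDerivAt_bilin_adjointRep B₂.isBoundedBilinearMap y z (𝒢 := 𝒢)
  have h2 : HasMFDerivAt (𝓡 3) 𝓘(ℝ, ℝ) (fun a => f (𝔓.act p a)) 1 _ :=
    h.congr_of_eventuallyEq heq
  rw [h2.mfderiv]
  have h3 : B₂.isBoundedBilinearMap.deriv (adjointRep (1 : 𝒢) y, adjointRep (1 : 𝒢) z)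
      (adjointRepDeriv 𝒢 y x, adjointRepDeriv 𝒢 z x) = B ⁅x, y⁆ z + B y ⁅x, z⁆ := by
    rw [adjointRepDeriv_apply, adjointRepDeriv_apply, adjointRep_one, adjointRep_one, add_comm]
    rfl
  exact h3

theorem dirDeriv_fund_of_equivariant_one {p : P} {f : P → ℝ}
    (B : GroupLieAlgebra (𝓡 3) 𝒢 →ₗ[ℝ] ℝ) (x y : GroupLieAlgebra (𝓡 3) 𝒢)
    (heq : ∀ᶠ a in 𝓝 (1 : 𝒢), f (𝔓.act p a) = B (adjointRep a y))
    (hdiff : MDifferentiableAt (𝓡 4) 𝓘(ℝ, ℝ) f p) :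
    dirDeriv p (𝔓.fund p x) f = B ⁅x, y⁆ := by
  rw [𝔓.dirDeriv_fund x hdiff]
  let B' : EuclideanSpace ℝ (Fin 3) →ₗ[ℝ] ℝ := B
  have h2 : HasMFDerivAt (𝓡 3) 𝓘(ℝ, ℝ) (fun a => f (𝔓.act p a)) 1 _ :=
    (hasMFDerivAt_clm_adjointRep B'.toContinuousLinearMap y).congr_of_eventuallyEq heq
  rw [h2.mfderiv]
  exact congrArg B' (mfderiv_adjointRep x y)

end PrincipalBundle

end Bundle

end InvariantFlow

namespace InvariantFlow

/-! ### Nilpotent Lie algebras of dimension three -/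

section Nilpotent

variable {L : Type*} [LieRing L] [LieAlgebra ℝ L]

/-- A basis `e` of a Lie algebra with `[e₀, e₁] = c e₂` and `e₂` central. -/
structure IsHeisenberg (e : Fin 3 → L) (c : ℝ) : Prop where
  lie_zero_one : ⁅e 0, e 1⁆ = c • e 2
  central : ∀ y : L, ⁅y, e 2⁆ = 0

/-- The centre of a nonzero nilpotent algebra is nonzero; complete a central vector to a basis and
let `y = ⁅e₀, e₁⁆ = α e₀ + β e₁ + γ e₂`. Then `⁅e₀, y⁆ = β y` and `⁅e₁, y⁆ = -α y`. Since `ad` is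
nilpotent, either `y = 0` or both eigenvalues vanish and `y = γ e₂`. The abelian case is `c = 0`. -/
theorem exists_basis_isHeisenberg [Module.Finite ℝ L] [LieRing.IsNilpotent L]
    (hL : Module.finrank ℝ L = 3) :
    ∃ (e : Module.Basis (Fin 3) ℝ L) (c : ℝ), IsHeisenberg e c := by
  have : Nontrivial L := Module.nontrivial_of_finrank_pos (R := ℝ) (by omega)
  have hZ := LieModule.nontrivial_max_triv_of_isNilpotent ℝ L L
  obtain ⟨⟨z, hzc⟩, hz⟩ := exists_ne (0 : LieModule.maxTrivSubmodule ℝ L L)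
  have hz0 : z ≠ 0 := fun h => hz (Subtype.ext h)
  rw [LieModule.mem_maxTrivSubmodule] at hzc
  have h1 : LinearIndependent ℝ ![z] := by
    rw [linearIndependent_subsingleton_index_iff]
    intro i; simpa using hz0
  obtain ⟨e₁, h2⟩ := exists_linearIndependent_cons_of_lt_finrank h1 (by omega)
  obtain ⟨e₀, h3⟩ := exists_linearIndependent_cons_of_lt_finrank h2 (by omega)
  let e := basisOfLinearIndependentOfCardEqFinrank h3 (by simp [hL])
  have he0 : e 0 = e₀ := by simp [e]
  have he1 : e 1 = e₁ := by simp [e]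
  have he2 : e 2 = z := by simp [e]
  have hc : ∀ y : L, ⁅y, e 2⁆ = 0 := by rw [he2]; exact hzc
  obtain ⟨y, hy⟩ : ∃ y, y = ⁅e 0, e 1⁆ := ⟨_, rfl⟩
  obtain ⟨α, β, γ, hexp⟩ : ∃ α β γ : ℝ, y = α • e 0 + β • e 1 + γ • e 2 :=
    ⟨_, _, _, by rw [← Fin.sum_univ_three (fun i => e.repr y i • e i)]; exact (e.sum_repr y).symm⟩
  have had0 : ⁅e 0, y⁆ = β • y := by
    conv_lhs => rw [hexp]
    simp [lie_add, lie_smul, hc, ← hy]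
  have had1 : ⁅e 1, y⁆ = (-α) • y := by
    conv_lhs => rw [hexp]
    have : ⁅e 1, e 0⁆ = -y := by rw [hy, lie_skew]
    simp [lie_add, lie_smul, hc, this]
  obtain ⟨k, hk⟩ := LieAlgebra.nilpotent_ad_of_nilpotent_algebra ℝ L
  have hpow : ∀ (x : L) (μ : ℝ), ⁅x, y⁆ = μ • y → μ = 0 ∨ y = 0 := by
    intro x μ hx
    have : ∀ n : ℕ, (LieAlgebra.ad ℝ L x ^ n) y = μ ^ n • y := by
      intro n
      induction n with
      | zero => simp
      | succ n ih =>
        rw [pow_succ', Module.End.mul_apply, ih, map_smul, LieAlgebra.ad_apply, hx, smul_smul, pow_succ]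
    have h := this k
    rw [hk, LinearMap.zero_apply, eq_comm, smul_eq_zero] at h
    exact h.imp eq_zero_of_pow_eq_zero id
  by_cases h : y = 0
  · exact ⟨e, 0, by rw [← hy, h, zero_smul], hc⟩
  · have hβ := (hpow _ _ had0).resolve_right h
    have hα := (hpow _ _ had1).resolve_right h
    rw [neg_eq_zero] at hα
    exact ⟨e, γ, by rw [← hy, hexp, hβ, hα]; simp, hc⟩

theorem IsHeisenberg.lie_one_zero {e : Fin 3 → L} {c : ℝ} (h : IsHeisenberg e c) :
    ⁅e 1, e 0⁆ = (-c) • e 2 := by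
  rw [← lie_skew, h.lie_zero_one, neg_smul]

theorem IsHeisenberg.central' {e : Fin 3 → L} {c : ℝ} (h : IsHeisenberg e c) (y : L) :
    ⁅e 2, y⁆ = 0 := by
  rw [← lie_skew, h.central, neg_zero]

/-- Gram–Schmidt in the order `e₂`, `e₁`, `e₀`. The new `x₂` stays central, and the corrections to
`e₁` and `e₀` do not affect `⁅x₀, x₁⁆`, being central or a multiple of `x₁`. Only the structure
constant changes, by the scale factors. -/
theorem exists_orthonormal_isHeisenberg {e : Module.Basis (Fin 3) ℝ L} {c : ℝ}
    (he : IsHeisenberg e c) (B : L →ₗ[ℝ] L →ₗ[ℝ] ℝ) (hsymm : ∀ y z, B y z = B z y)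
    (hpos : ∀ y, y ≠ 0 → 0 < B y y) :
    ∃ (x : Module.Basis (Fin 3) ℝ L) (l : ℝ), IsHeisenberg x l ∧
      ∀ i j, B (x i) (x j) = if i = j then 1 else 0 := by
  have hunit : ∀ y, y ≠ 0 → B ((Real.sqrt (B y y))⁻¹ • y) ((Real.sqrt (B y y))⁻¹ • y) = 1 := by
    intro y hy
    have := hpos y hy
    simp only [map_smul, LinearMap.smul_apply, smul_eq_mul]
    have h2 := Real.mul_self_sqrt this.le
    have h3 : Real.sqrt (B y y) ≠ 0 := (Real.sqrt_pos.mpr this).ne'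
    field_simp
    nlinarith
  have hli := Fintype.linearIndependent_iff.mp e.linearIndependent
  have hspan : ∀ a b d : ℝ, a • e 0 + b • e 1 + d • e 2 = 0 → a = 0 ∧ b = 0 ∧ d = 0 := by
    intro a b d h
    have := hli ![a, b, d] (by simpa [Fin.sum_univ_three] using h)
    exact ⟨this 0, this 1, this 2⟩
  have hsqrt : ∀ y, y ≠ 0 → (Real.sqrt (B y y))⁻¹ ≠ 0 := fun y hy =>
    inv_ne_zero (Real.sqrt_pos.mpr (hpos y hy)).ne'
  obtain ⟨s, hs0, hs⟩ : ∃ s : ℝ, s ≠ 0 ∧ B (s • e 2) (s • e 2) = 1 :=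
    ⟨_, hsqrt _ (e.ne_zero 2), hunit _ (e.ne_zero 2)⟩
  obtain ⟨x₂, hx₂⟩ : ∃ x₂, x₂ = s • e 2 := ⟨_, rfl⟩
  rw [← hx₂] at hs
  obtain ⟨u, hu⟩ : ∃ u, u = e 1 - B (e 1) x₂ • x₂ := ⟨_, rfl⟩
  have hu0 : u ≠ 0 := by
    intro h
    have := hspan 0 1 (-(B (e 1) x₂ * s)) (by rw [← h, hu, hx₂]; module)
    simp at this
  obtain ⟨r, hr0, hr⟩ : ∃ r : ℝ, r ≠ 0 ∧ B (r • u) (r • u) = 1 := ⟨_, hsqrt _ hu0, hunit _ hu0⟩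
  obtain ⟨x₁, hx₁⟩ : ∃ x₁, x₁ = r • u := ⟨_, rfl⟩
  rw [← hx₁] at hr
  obtain ⟨w, hw⟩ : ∃ w, w = e 0 - B (e 0) x₂ • x₂ - B (e 0) x₁ • x₁ := ⟨_, rfl⟩
  have hw0 : w ≠ 0 := by
    intro h
    have := hspan 1 (-(B (e 0) x₁ * r)) (-(B (e 0) x₂ * s) + B (e 0) x₁ * r * B (e 1) x₂ * s)
      (by rw [← h, hw, hx₁, hu, hx₂]; module)
    simp at this
  obtain ⟨q, hq0, hq⟩ : ∃ q : ℝ, q ≠ 0 ∧ B (q • w) (q • w) = 1 := ⟨_, hsqrt _ hw0, hunit _ hw0⟩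
  obtain ⟨x₀, hx₀⟩ : ∃ x₀, x₀ = q • w := ⟨_, rfl⟩
  rw [← hx₀] at hq
  have h12 : B x₁ x₂ = 0 := by rw [hx₁, hu]; simp [hs]
  have h02 : B x₀ x₂ = 0 := by rw [hx₀, hw]; simp [hs, h12]
  have h01 : B x₀ x₁ = 0 := by rw [hx₀, hw]; simp [hr, hsymm x₂ x₁, h12]
  have hon : ∀ i j, B (![x₀, x₁, x₂] i) (![x₀, x₁, x₂] j) = if i = j then 1 else 0 := by
    intro i j
    fin_cases i <;> fin_cases j <;>
      simp [hq, hr, hs, h12, h02, h01, hsymm x₁ x₀, hsymm x₂ x₀, hsymm x₂ x₁]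
  have hind : LinearIndependent ℝ ![x₀, x₁, x₂] := by
    rw [Fintype.linearIndependent_iff]
    intro g hg i
    have := congrArg (fun y => B y (![x₀, x₁, x₂] i)) hg
    simpa [map_sum, LinearMap.sum_apply, hon] using this
  have hfin : Module.finrank ℝ L = 3 := by rw [Module.finrank_eq_card_basis e]; simp
  -- `⁅x₀, x₁⁆ = q r ⁅e₀, e₁⁆ = q r c e₂`, and `e₂ = s⁻¹ x₂`.
  refine ⟨basisOfLinearIndependentOfCardEqFinrank hind (by simp [hfin]), q * r * c * s⁻¹, ⟨?_, ?_⟩, ?_⟩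
  · have hz : ∀ y : L, ⁅x₂, y⁆ = 0 := fun y => by rw [hx₂, smul_lie, he.central', smul_zero]
    have hz' : ∀ y : L, ⁅y, x₂⁆ = 0 := fun y => by rw [hx₂, lie_smul, he.central, smul_zero]
    have h : ⁅x₀, x₁⁆ = (q * r * c * s⁻¹) • x₂ := by
      rw [hx₀, hw]
      simp only [smul_lie, sub_lie, hz, lie_self, smul_zero, sub_zero]
      rw [hx₁, hu]
      simp only [lie_smul, lie_sub, hz', smul_zero, sub_zero, he.lie_zero_one]
      rw [hx₂]
      simp only [smul_smul]
      congr 1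
      field_simp
    simpa using h
  · intro y
    have h : ⁅y, x₂⁆ = 0 := by rw [hx₂, lie_smul, he.central, smul_zero]
    simpa using h
  · simpa using hon

end Nilpotent

/-! ### Traces over orthonormal bases, written in an arbitrary basis -/

section Contraction

variable {L : Type*} [AddCommGroup L] [Module ℝ L]

/-- A function of two variables is bilinear. -/
structure IsBilin (F : L → L → ℝ) : Prop where
  add_left : ∀ x y z, F (x + y) z = F x z + F y z
  smul_left : ∀ (c : ℝ) x z, F (c • x) z = c * F x z
  add_right : ∀ x y z, F x (y + z) = F x y + F x z
  smul_right : ∀ (c : ℝ) x z, F x (c • z) = c * F x z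

/-- The bilinear map underlying a bilinear function. -/
def IsBilin.toLin {F : L → L → ℝ} (h : IsBilin F) : L →ₗ[ℝ] L →ₗ[ℝ] ℝ :=
  LinearMap.mk₂ ℝ F h.add_left h.smul_left h.add_right h.smul_right

@[simp] theorem IsBilin.toLin_apply {F : L → L → ℝ} (h : IsBilin F) (x y : L) :
    h.toLin x y = F x y := rfl

/-- The matrix of a function of two variables. -/
def gramMatrix (F : L → L → ℝ) (e : Fin 3 → L) : Matrix (Fin 3) (Fin 3) ℝ :=
  Matrix.of fun i j => F (e i) (e j)

@[simp] theorem gramMatrix_apply (F : L → L → ℝ) (e : Fin 3 → L) (i j : Fin 3) :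
    gramMatrix F e i j = F (e i) (e j) := rfl

theorem IsBilin.sum_sum {F : L → L → ℝ} (h : IsBilin F) (a b : Fin 3 → ℝ) (e : Fin 3 → L) :
    F (∑ i, a i • e i) (∑ j, b j • e j) = ∑ i, ∑ j, a i * b j * F (e i) (e j) := by
  rw [← h.toLin_apply]
  simp only [map_sum, LinearMap.sum_apply, map_smul, LinearMap.smul_apply, smul_eq_mul,
    h.toLin_apply, Finset.mul_sum]
  rw [Finset.sum_comm]
  refine Finset.sum_congr rfl fun i _ => Finset.sum_congr rfl fun j _ => by ring

/-- Orthonormality of the columns of `X` reads `Xᵀ Γ X = 1`, and for square matrices this gives `Γ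
(X Xᵀ) = 1`. Every trace formula below follows, so traces over frames that vary arbitrarily from
point to point become smooth expressions in `Γ⁻¹`. -/
theorem exists_inv_gramMatrix {F : L → L → ℝ} (hF : IsBilin F) (e : Module.Basis (Fin 3) ℝ L)
    {x : Fin 3 → L} (hx : ∀ i j, F (x i) (x j) = if i = j then 1 else 0) :
    ∃ X : Matrix (Fin 3) (Fin 3) ℝ, (∀ i, x i = ∑ a, X a i • e a) ∧
      IsUnit (gramMatrix F e) ∧ (gramMatrix F e)⁻¹ = X * X.transpose := by
  let X : Matrix (Fin 3) (Fin 3) ℝ := Matrix.of fun a i => e.repr (x i) a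
  have hX : ∀ i, x i = ∑ a, X a i • e a := fun i => (e.sum_repr (x i)).symm
  have h1 : X.transpose * (gramMatrix F e * X) = 1 := by
    ext i j
    rw [Matrix.one_apply, ← hx i j, hX i, hX j, hF.sum_sum]
    simp only [Matrix.mul_apply, Matrix.transpose_apply, gramMatrix_apply, Finset.mul_sum]
    refine Finset.sum_congr rfl fun a _ => Finset.sum_congr rfl fun b _ => by ring
  have h2 : gramMatrix F e * (X * X.transpose) = 1 := by
    rw [← Matrix.mul_assoc]; exact mul_eq_one_comm.mp h1
  exact ⟨X, hX, IsUnit.of_mul_eq_one _ h2, Matrix.inv_eq_right_inv h2⟩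

/-- The trace of a bilinear function over an orthonormal basis. -/
theorem sum_orthonormal_eq {F : L → L → ℝ} (hF : IsBilin F) (e : Module.Basis (Fin 3) ℝ L)
    {x : Fin 3 → L} (hx : ∀ i j, F (x i) (x j) = if i = j then 1 else 0)
    {A : L → L → ℝ} (hA : IsBilin A) :
    ∑ i, A (x i) (x i) = ∑ a, ∑ b, (gramMatrix F e)⁻¹ a b * A (e a) (e b) := by
  obtain ⟨X, hX, -, hinv⟩ := exists_inv_gramMatrix hF e hx
  rw [hinv]
  simp only [Matrix.mul_apply, Matrix.transpose_apply, Finset.sum_mul]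
  have h : ∀ i, A (x i) (x i) = ∑ a, ∑ b, X a i * X b i * A (e a) (e b) := by
    intro i; conv_lhs => rw [hX i]
    exact hA.sum_sum _ _ _
  simp only [h]
  rw [Finset.sum_comm]
  refine Finset.sum_congr rfl fun a _ => ?_
  rw [Finset.sum_comm]

/-- The full contraction of two bilinear functions over an orthonormal basis. -/
theorem sum_orthonormal_mul_eq {F : L → L → ℝ} (hF : IsBilin F) (e : Module.Basis (Fin 3) ℝ L)
    {x : Fin 3 → L} (hx : ∀ i j, F (x i) (x j) = if i = j then 1 else 0)
    {A C : L → L → ℝ} (hA : IsBilin A) (hC : IsBilin C) :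
    ∑ i, ∑ j, A (x i) (x j) * C (x i) (x j) =
      ∑ a, ∑ b, ∑ c, ∑ d, (gramMatrix F e)⁻¹ a b * (gramMatrix F e)⁻¹ c d *
        (A (e a) (e c) * C (e b) (e d)) := by
  have h1 : ∀ y z, ∑ j, A y (x j) * C z (x j) =
      ∑ c, ∑ d, (gramMatrix F e)⁻¹ c d * (A y (e c) * C z (e d)) := fun y z =>
    sum_orthonormal_eq hF e hx (A := fun u v => A y u * C z v)
      ⟨fun _ _ _ => by rw [hA.add_right, add_mul], fun _ _ _ => by rw [hA.smul_right, mul_assoc],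
        fun _ _ _ => by rw [hC.add_right, mul_add], fun _ _ _ => by rw [hC.smul_right]; ring⟩
  have h2 := sum_orthonormal_eq hF e hx (A := fun u v => ∑ j, A u (x j) * C v (x j))
    ⟨fun _ _ _ => by simp only [hA.add_left, add_mul, Finset.sum_add_distrib],
      fun _ _ _ => by simp only [hA.smul_left, mul_assoc, Finset.mul_sum],
      fun _ _ _ => by simp only [hC.add_left, mul_add, Finset.sum_add_distrib],
      fun c _ _ => by
        simp only [hC.smul_left, Finset.mul_sum]
        exact Finset.sum_congr rfl fun _ _ => by ring⟩
  rw [h2]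
  simp only [h1, Finset.mul_sum]
  refine Finset.sum_congr rfl fun a _ => Finset.sum_congr rfl fun b _ =>
    Finset.sum_congr rfl fun c _ => Finset.sum_congr rfl fun d _ => by ring

end Contraction

end InvariantFlow

namespace InvariantFlow

/-! ### Calculus of curves of matrices and the second derivative test -/

open Matrix

/-- Three by three real matrices. -/
abbrev Mat3 := Matrix (Fin 3) (Fin 3) ℝ

/-- A curve of matrices has a derivative entrywise. -/
def HasMatrixDerivAt (X : ℝ → Mat3) (X' : Mat3) (r : ℝ) : Prop :=
  ∀ i j, HasDerivAt (fun s => X s i j) (X' i j) r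

namespace HasMatrixDerivAt

variable {X Y : ℝ → Mat3} {X' Y' : Mat3} {r : ℝ}

theorem mul (hX : HasMatrixDerivAt X X' r) (hY : HasMatrixDerivAt Y Y' r) :
    HasMatrixDerivAt (fun s => X s * Y s) (X' * Y r + X r * Y') r := by
  intro i j
  simp only [Matrix.mul_apply, Matrix.add_apply, ← Finset.sum_add_distrib]
  exact HasDerivAt.fun_sum fun k _ => (hX i k).mul (hY k j)

theorem add (hX : HasMatrixDerivAt X X' r) (hY : HasMatrixDerivAt Y Y' r) :
    HasMatrixDerivAt (fun s => X s + Y s) (X' + Y') r := fun i j => (hX i j).add (hY i j)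

theorem sub (hX : HasMatrixDerivAt X X' r) (hY : HasMatrixDerivAt Y Y' r) :
    HasMatrixDerivAt (fun s => X s - Y s) (X' - Y') r := fun i j => (hX i j).sub (hY i j)

theorem smul {c : ℝ → ℝ} {c' : ℝ} (hc : HasDerivAt c c' r) (hX : HasMatrixDerivAt X X' r) :
    HasMatrixDerivAt (fun s => c s • X s) (c' • X r + c r • X') r :=
  fun i j => hc.mul (hX i j)

theorem trace (hX : HasMatrixDerivAt X X' r) :
    HasDerivAt (fun s => (X s).trace) X'.trace r := by
  simp only [Matrix.trace]
  exact HasDerivAt.fun_sum fun i _ => hX i i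

theorem trace_mul_self (hX : HasMatrixDerivAt X X' r) :
    HasDerivAt (fun s => (X s * X s).trace) (2 * (X r * X').trace) r := by
  convert (hX.mul hX).trace using 1
  rw [Matrix.trace_add, Matrix.trace_mul_comm X' (X r)]; ring

theorem congr (hX : HasMatrixDerivAt X X' r) (h : Y =ᶠ[𝓝 r] X) : HasMatrixDerivAt Y X' r :=
  fun i j => (hX i j).congr_of_eventuallyEq (h.mono fun _ hs => congrFun₂ hs i j)

theorem eventually_isUnit (hX : HasMatrixDerivAt X X' r) (hu : IsUnit (X r)) :
    ∀ᶠ s in 𝓝 r, IsUnit (X s) := by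
  have hc : ContinuousAt (fun s => (X s).det) r := by
    simp only [Matrix.det_fin_three]
    have h := fun i j => (hX i j).continuousAt
    fun_prop
  rw [Matrix.isUnit_iff_isUnit_det, isUnit_iff_ne_zero] at hu
  filter_upwards [hc.eventually_ne hu] with s hs
  rwa [Matrix.isUnit_iff_isUnit_det, isUnit_iff_ne_zero]

theorem inv (hX : HasMatrixDerivAt X X' r) (hu : IsUnit (X r)) :
    HasMatrixDerivAt (fun s => (X s)⁻¹) (-((X r)⁻¹ * X' * (X r)⁻¹)) r := by
  have hdet : (X r).det ≠ 0 := by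
    rw [Matrix.isUnit_iff_isUnit_det] at hu; exact hu.ne_zero
  have hd : DifferentiableAt ℝ (fun s => (X s).det) r := by
    simp only [Matrix.det_fin_three]
    have h := fun i j => (hX i j).differentiableAt
    fun_prop
  have hadj : ∀ i j, DifferentiableAt ℝ (fun s => (X s).adjugate i j) r := by
    have h := fun i j => (hX i j).differentiableAt
    intro i j
    simp only [Matrix.adjugate_fin_three]
    fin_cases i <;> fin_cases j <;> simp <;> fun_prop
  -- Cramer's rule shows only that the inverse is differentiable; the value of the derivative is
  -- then forced by differentiating `X X⁻¹ = 1`.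
  have hJ : ∃ J' : Mat3, HasMatrixDerivAt (fun s => (X s)⁻¹) J' r := by
    refine ⟨Matrix.of fun i j => deriv (fun s => (X s)⁻¹ i j) r, fun i j => ?_⟩
    refine DifferentiableAt.hasDerivAt ?_
    simp only [Matrix.inv_def, Matrix.smul_apply, smul_eq_mul, Ring.inverse_eq_inv']
    exact (hd.inv hdet).mul (hadj i j)
  obtain ⟨J', hJ⟩ := hJ
  have h1 : HasMatrixDerivAt (fun s => X s * (X s)⁻¹) 0 r := by
    have : HasMatrixDerivAt (fun _ => (1 : Mat3)) 0 r := fun i j => hasDerivAt_const _ _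
    refine this.congr ?_
    filter_upwards [hX.eventually_isUnit hu] with s hs
    rw [Matrix.isUnit_iff_isUnit_det] at hs
    exact Matrix.mul_nonsing_inv _ hs
  have h2 : X' * (X r)⁻¹ + X r * J' = 0 := by
    ext i j
    exact ((hX.mul hJ) i j).unique (h1 i j)
  have h3 : J' = -((X r)⁻¹ * X' * (X r)⁻¹) := by
    rw [Matrix.isUnit_iff_isUnit_det] at hu
    have := congrArg (fun Z => (X r)⁻¹ * Z) h2
    simp only [Matrix.mul_add, ← Matrix.mul_assoc, Matrix.nonsing_inv_mul _ hu, Matrix.one_mul,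
      Matrix.mul_zero] at this
    exact eq_neg_of_add_eq_zero_right this
  rwa [h3] at hJ

end HasMatrixDerivAt

/-- The second derivative is nonpositive at a local maximum. -/
theorem secondDeriv_nonpos_of_isLocalMax {f f' : ℝ → ℝ} {f'' a : ℝ}
    (h : ∀ᶠ r in 𝓝 a, HasDerivAt f (f' r) r) (h2 : HasDerivAt f' f'' a) (hmax : IsLocalMax f a) :
    f'' ≤ 0 := by
  by_contra! hpos
  have hd : deriv f =ᶠ[𝓝 a] f' := h.mono fun r hr => hr.deriv
  have h0 : deriv f a = 0 := hmax.deriv_eq_zero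
  have hdd : deriv (deriv f) a = f'' := by rw [hd.deriv_eq, h2.deriv]
  have hmin := isLocalMin_of_deriv_deriv_pos (by rw [hdd]; exact hpos) h0
    h.self_of_nhds.continuousAt
  -- A positive second derivative at the critical point would make it a local minimum as well. Then
  -- `f` is locally constant and its second derivative is zero.
  have hconst : f =ᶠ[𝓝 a] fun _ => f a := by
    filter_upwards [hmax, hmin] with r h1 h2
    exact le_antisymm h1 h2
  have h3 : deriv f =ᶠ[𝓝 a] fun _ => 0 := by
    filter_upwards [hconst.eventuallyEq_nhds] with r hr
    rw [hr.deriv_eq, deriv_const]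
  have h4 : deriv (deriv f) a = 0 := by rw [h3.deriv_eq, deriv_const]
  linarith

/-- `tr (J N J N) - tr (J K J K)`. -/
def energyDensity (J N K : Mat3) : ℝ := (J * N * (J * N)).trace - (J * K * (J * K)).trace

theorem hasDerivAt_energyDensity {Γ N K : ℝ → Mat3} {Γ' N' K' : Mat3} {r : ℝ}
    (hΓ : HasMatrixDerivAt Γ Γ' r) (hN : HasMatrixDerivAt N N' r) (hK : HasMatrixDerivAt K K' r)
    (hu : IsUnit (Γ r)) :
    HasDerivAt (fun s => energyDensity (Γ s)⁻¹ (N s) (K s))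
      (2 * ((Γ r)⁻¹ * N r * ((Γ r)⁻¹ * N' - (Γ r)⁻¹ * Γ' * (Γ r)⁻¹ * N r)).trace
        - 2 * ((Γ r)⁻¹ * K r * ((Γ r)⁻¹ * K' - (Γ r)⁻¹ * Γ' * (Γ r)⁻¹ * K r)).trace) r := by
  have e : ∀ A B : Mat3, A - B = -B + A := fun A B => by abel
  have h1 := ((hΓ.inv hu).mul hN).trace_mul_self
  have h2 := ((hΓ.inv hu).mul hK).trace_mul_self
  simp only [e, neg_mul] at h1 h2 ⊢
  exact h1.sub h2

/-- With `X = Γ⁻¹ Γ'` and `Y = Γ⁻¹ K` the function is `tr X² - tr Y²`, and `X' = Γ⁻¹ Γ'' - X X`, `Y'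
= Γ⁻¹ K' - X Y`. The left-hand side is the second derivative in this form, evaluated where `Γ = 1`;
`energy_identity` is arranged to contain the same expression. -/
theorem secondDeriv_energyDensity_nonpos {Γ Γ1 Γ2 K K1 : ℝ → Mat3} {Γ3 K2 : Mat3}
    (hΓ : ∀ᶠ r in 𝓝 0, HasMatrixDerivAt Γ (Γ1 r) r)
    (hΓ1 : ∀ᶠ r in 𝓝 0, HasMatrixDerivAt Γ1 (Γ2 r) r) (hΓ2 : HasMatrixDerivAt Γ2 Γ3 0)
    (hK : ∀ᶠ r in 𝓝 0, HasMatrixDerivAt K (K1 r) r) (hK1 : HasMatrixDerivAt K1 K2 0)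
    (h0 : Γ 0 = 1)
    (hmax : IsLocalMax (fun r => energyDensity (Γ r)⁻¹ (Γ1 r) (K r)) 0) :
    2 * ((Γ2 0 - Γ1 0 * Γ1 0) * (Γ2 0 - Γ1 0 * Γ1 0)
        + Γ1 0 * (Γ3 - Γ1 0 * Γ2 0 - (Γ2 0 - Γ1 0 * Γ1 0) * Γ1 0
          - Γ1 0 * (Γ2 0 - Γ1 0 * Γ1 0))).trace
      - 2 * ((K1 0 - Γ1 0 * K 0) * (K1 0 - Γ1 0 * K 0)
        + K 0 * (K2 - Γ1 0 * K1 0 - (Γ2 0 - Γ1 0 * Γ1 0) * K 0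
          - Γ1 0 * (K1 0 - Γ1 0 * K 0))).trace ≤ 0 := by
  have hu0 : IsUnit (Γ 0) := by rw [h0]; exact isUnit_one
  have hinv : (Γ 0)⁻¹ = 1 := by rw [h0, inv_one]
  have hJ0 := hΓ.self_of_nhds.inv hu0
  have hX0 := hJ0.mul hΓ1.self_of_nhds
  have hY0 := hJ0.mul hK.self_of_nhds
  have hX1 := (hJ0.mul hΓ2).sub (hX0.mul hX0)
  have hY1 := (hJ0.mul hK1).sub (hX0.mul hY0)
  refine secondDeriv_nonpos_of_isLocalMax
    (f' := fun r => 2 * ((Γ r)⁻¹ * Γ1 r * ((Γ r)⁻¹ * Γ2 r - (Γ r)⁻¹ * Γ1 r * ((Γ r)⁻¹ * Γ1 r))).trace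
        - 2 * ((Γ r)⁻¹ * K r * ((Γ r)⁻¹ * K1 r - (Γ r)⁻¹ * Γ1 r * ((Γ r)⁻¹ * K r))).trace)
    ?_ ?_ hmax
  · filter_upwards [hΓ, hΓ1, hK, hΓ.self_of_nhds.eventually_isUnit hu0] with r a1 a2 a3 a4
    have := hasDerivAt_energyDensity a1 a2 a3 a4
    simpa only [Matrix.mul_assoc] using this
  · have := (((hX0.mul hX1).trace).const_mul 2).sub (((hY0.mul hY1).trace).const_mul 2)
    refine this.congr_deriv ?_
    have e1 : ∀ A B : Mat3, -A + B = B - A := fun A B => by abel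
    simp only [hinv, Matrix.one_mul, Matrix.mul_one, neg_mul, e1]
    congr 3
    · noncomm_ring
    · noncomm_ring

end InvariantFlow

namespace InvariantFlow

/-! ### The flow as a system of matrix equations, and the energy identity -/

open Matrix

/-- The matrix of `H(a, ·, ·)` on a three-dimensional fibre, for `H` of unit volume. -/
def skewMatrix (a : Fin 3 → ℝ) : Mat3 := !![0, a 2, -a 1; -a 2, 0, a 0; a 1, -a 0, 0]

/-- The Lie derivative of the fibre metric `Γ` along the fundamental field of `a`, for the bracket
`[e₀, e₁] = l e₂`. -/
def lieDerivMatrix (l : ℝ) (a : Fin 3 → ℝ) (Γ : Mat3) : Mat3 :=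
  of fun i j => ![-(l * a 1), l * a 0, 0] i * Γ 2 j + ![-(l * a 1), l * a 0, 0] j * Γ i 2

/-- The bracket terms in the evolution of the fibre metric `Γ` with inverse `J`. -/
def bracketMatrix (l : ℝ) (Γ J : Mat3) : Mat3 :=
  (l ^ 2 * Γ 2 2) • !![J 1 1, -J 0 1, 0; -J 1 0, J 0 0, 0; 0, 0, 0]
    - (l ^ 2 * (J 0 0 * J 1 1 - J 0 1 * J 1 0)) • of fun i j => Γ 2 i * Γ 2 j

/-- The right-hand side of the evolution of the fibre metric. -/
def metricFlow (l h : ℝ) (Γ Γ1 Γ2 K : Mat3) : Mat3 :=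
  Γ2 - Γ1 * Γ⁻¹ * Γ1 + bracketMatrix l Γ Γ⁻¹ + h ^ 2 • Γ⁻¹.adjugateᵀ - K * Γ⁻¹ * K

/-- The value of `metricFlow` at the identity. -/
def metricFlowOne (l h : ℝ) (N A k : Mat3) : Mat3 :=
  A - N * N + diagonal ![l ^ 2, l ^ 2, -l ^ 2] + h ^ 2 • (1 : Mat3) - k * k

/-- The derivative of `metricFlow` along a curve through the identity. -/
def metricFlowDeriv (l h : ℝ) (N A C k k1 : Mat3) : Mat3 :=
  C - (A * N - N * N * N + N * A)
    + l ^ 2 • !![N 2 2 - N 1 1, N 0 1, 0; N 1 0, N 2 2 - N 0 0, 0; 0, 0, 0]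
    - l ^ 2 • !![0, 0, N 2 0; 0, 0, N 2 1; N 2 0, N 2 1, 2 * N 2 2 - (N 0 0 + N 1 1)]
    + h ^ 2 • (Nᵀ - N.trace • (1 : Mat3)) - (k1 * k - k * N * k + k * k1)

theorem metricFlow_one (l h : ℝ) (N A k : Mat3) :
    metricFlow l h 1 N A k = metricFlowOne l h N A k := by
  have h1 : bracketMatrix l 1 1 = diagonal ![l ^ 2, l ^ 2, -l ^ 2] := by
    ext i j
    fin_cases i <;> fin_cases j <;> simp [bracketMatrix]
  simp [metricFlow, metricFlowOne, h1]

/-- Used for the spatial derivative of the right-hand side of the metric equation along an integral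
curve of `V`. The fibre component `h` has zero derivative there because `H` is closed, so only the
other arguments are differentiated. -/
theorem HasMatrixDerivAt.metricFlow {Γ Γ1 Γ2 K : ℝ → Mat3} {h : ℝ → ℝ} {Γ3 K1 : Mat3} {l : ℝ}
    (hΓ : HasMatrixDerivAt Γ (Γ1 0) 0) (hΓ1 : HasMatrixDerivAt Γ1 (Γ2 0) 0)
    (hΓ2 : HasMatrixDerivAt Γ2 Γ3 0) (hK : HasMatrixDerivAt K K1 0) (hh : HasDerivAt h 0 0)
    (h0 : Γ 0 = 1) :
    HasMatrixDerivAt (fun r => metricFlow l (h r) (Γ r) (Γ1 r) (Γ2 r) (K r))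
      (metricFlowDeriv l (h 0) (Γ1 0) (Γ2 0) Γ3 (K 0) K1) 0 := by
  have hJ := hΓ.inv (by rw [h0]; exact isUnit_one)
  have hinv : (Γ 0)⁻¹ = 1 := by rw [h0, inv_one]
  simp only [hinv, Matrix.one_mul, Matrix.mul_one] at hJ
  have hP : HasMatrixDerivAt (fun r => bracketMatrix l (Γ r) (Γ r)⁻¹)
      (l ^ 2 • !![Γ1 0 2 2 - Γ1 0 1 1, Γ1 0 0 1, 0; Γ1 0 1 0, Γ1 0 2 2 - Γ1 0 0 0, 0; 0, 0, 0]
    - l ^ 2 • !![0, 0, Γ1 0 2 0; 0, 0, Γ1 0 2 1;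
        Γ1 0 2 0, Γ1 0 2 1, 2 * Γ1 0 2 2 - (Γ1 0 0 0 + Γ1 0 1 1)]) 0 := by
    have h1 : HasMatrixDerivAt (fun r => !![(Γ r)⁻¹ 1 1, -(Γ r)⁻¹ 0 1, 0; -(Γ r)⁻¹ 1 0, (Γ r)⁻¹ 0 0, 0; 0, 0, 0])
        !![-Γ1 0 1 1, Γ1 0 0 1, 0; Γ1 0 1 0, -Γ1 0 0 0, 0; 0, 0, 0] 0 := by
      intro i j
      fin_cases i <;> fin_cases j <;> simp [hasDerivAt_const]
      · exact hJ 1 1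
      · exact (hJ 0 1).neg.congr_deriv (by simp)
      · exact (hJ 1 0).neg.congr_deriv (by simp)
      · exact hJ 0 0
    have h2 : HasMatrixDerivAt (fun r => (of fun i j => Γ r 2 i * Γ r 2 j : Mat3))
        (of fun i j => Γ1 0 2 i * Γ 0 2 j + Γ 0 2 i * Γ1 0 2 j) 0 :=
      fun i j => (hΓ 2 i).mul (hΓ 2 j)
    have h3 : HasDerivAt
        (fun r => l ^ 2 * ((Γ r)⁻¹ 0 0 * (Γ r)⁻¹ 1 1 - (Γ r)⁻¹ 0 1 * (Γ r)⁻¹ 1 0))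
        (-(l ^ 2 * (Γ1 0 0 0 + Γ1 0 1 1))) 0 :=
      ((((hJ 0 0).mul (hJ 1 1)).sub ((hJ 0 1).mul (hJ 1 0))).const_mul (l ^ 2)).congr_deriv
        (by simp only [hinv]; simp; ring)
    have h4 := (HasMatrixDerivAt.smul ((hΓ 2 2).const_mul (l ^ 2)) h1).sub
      (HasMatrixDerivAt.smul h3 h2)
    intro i j
    refine (h4 i j).congr_deriv ?_
    simp only [h0]
    fin_cases i <;> fin_cases j <;> simp <;> ring
  -- The derivative of the adjugate at the identity in the direction `B` is `(tr B) 1 - B`; here `B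
  -- = -Γ'`, the derivative of `Γ⁻¹`.
  have hadj : HasMatrixDerivAt (fun r => (Γ r)⁻¹.adjugateᵀ)
      ((Γ1 0)ᵀ - (Γ1 0).trace • (1 : Mat3)) 0 := by
    have key : ∀ a b c d : Fin 3, HasDerivAt (fun r => (Γ r)⁻¹ a b * (Γ r)⁻¹ c d)
        (-(Γ1 0) a b * (1 : Mat3) c d + (1 : Mat3) a b * (-(Γ1 0) c d)) 0 := by
      intro a b c d
      exact ((hJ a b).mul (hJ c d)).congr_deriv (by simp only [hinv]; rfl)
    intro i j
    simp only [Matrix.transpose_apply, Matrix.adjugate_fin_three, Matrix.trace_fin_three]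
    fin_cases i <;> fin_cases j <;> simp
    · exact ((key 1 1 2 2).sub (key 1 2 2 1)).congr_deriv (by simp; ring)
    · exact ((key 1 0 2 2).neg.add (key 1 2 2 0)).congr_deriv (by simp)
    · exact ((key 1 0 2 1).sub (key 1 1 2 0)).congr_deriv (by simp)
    · exact ((key 0 1 2 2).neg.add (key 0 2 2 1)).congr_deriv (by simp)
    · exact ((key 0 0 2 2).sub (key 0 2 2 0)).congr_deriv (by simp; ring)
    · exact ((key 0 0 2 1).neg.add (key 0 1 2 0)).congr_deriv (by simp)
    · exact ((key 0 1 1 2).sub (key 0 2 1 1)).congr_deriv (by simp)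
    · exact ((key 0 0 1 2).neg.add (key 0 2 1 0)).congr_deriv (by simp)
    · exact ((key 0 0 1 1).sub (key 0 1 1 0)).congr_deriv (by simp; ring)
  have h1 := (((hΓ2.sub ((hΓ1.mul hJ).mul hΓ1)).add hP).add
    (HasMatrixDerivAt.smul (hh.pow 2) hadj)).sub ((hK.mul hJ).mul hK)
  intro i j
  refine (h1 i j).congr_deriv ?_
  refine congrArg (fun X : Mat3 => X i j) ?_
  simp only [hinv, metricFlowDeriv, Matrix.mul_one, mul_zero, zero_smul, zero_add, Matrix.mul_neg,
    Matrix.add_mul, Matrix.neg_mul, Pi.pow_apply]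
  abel

/-- `|DG|² + |i_v H|²` in terms of the components, with respect to a fixed field, of the derivative
of the metric, of the metric and of the form, where `a` is the vertical part of the field and `c`
normalises the horizontal part. -/
def flowEnergy (l c h : ℝ) (a : Fin 3 → ℝ) (Γ D κ : Mat3) : ℝ :=
  energyDensity Γ⁻¹ (c • (D - lieDerivMatrix l a Γ)) (c • (κ - h • skewMatrix a))

/-- At time `t` the frozen field is unit and horizontal and the basis is orthonormal, so `c = 1`, `a
= 0` and `Γ = 1`. The changes of normalisation, connection and metric therefore enter separately,
through `c'`, `α` and `Γ'`. -/
theorem hasDerivAt_flowEnergy {l : ℝ} {c h : ℝ → ℝ} {a : ℝ → Fin 3 → ℝ} {Γ D κ : ℝ → Mat3}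
    {c' : ℝ} {α : Fin 3 → ℝ} {Γ' D' κ' : Mat3} {t : ℝ} (hc : HasDerivAt c c' t)
    (hh : HasDerivAt h 0 t) (ha : ∀ i, HasDerivAt (fun s => a s i) (α i) t)
    (hΓ : HasMatrixDerivAt Γ Γ' t) (hD : HasMatrixDerivAt D D' t) (hκ : HasMatrixDerivAt κ κ' t)
    (hc0 : c t = 1) (ha0 : a t = 0) (hΓ0 : Γ t = 1) :
    HasDerivAt (fun s => flowEnergy l (c s) (h s) (a s) (Γ s) (D s) (κ s))
      (2 * (D t * ((c' • D t + (D' - lieDerivMatrix l α 1)) - Γ' * D t)).trace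
        - 2 * (κ t * ((c' • κ t + (κ' - h t • skewMatrix α)) - Γ' * κ t)).trace) t := by
  have hinv : (Γ t)⁻¹ = 1 := by rw [hΓ0, inv_one]
  have hw : ∀ i, HasDerivAt (fun s => ![-(l * a s 1), l * a s 0, 0] i)
      (![-(l * α 1), l * α 0, 0] i) t := by
    intro i
    fin_cases i <;> simp [hasDerivAt_const]
    · exact ((ha 1).const_mul l).neg
    · exact (ha 0).const_mul l
  have hL : HasMatrixDerivAt (fun s => lieDerivMatrix l (a s) (Γ s)) (lieDerivMatrix l α 1) t := by
    intro i j
    refine (((hw i).mul (hΓ 2 j)).add ((hw j).mul (hΓ i 2))).congr_deriv ?_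
    have h0 : ∀ i, ![-(l * a t 1), l * a t 0, 0] i = 0 := by
      intro i; fin_cases i <;> simp [ha0]
    simp only [h0, hΓ0, lieDerivMatrix, of_apply]
    ring
  have hS : HasMatrixDerivAt (fun s => skewMatrix (a s)) (skewMatrix α) t := by
    intro i j
    fin_cases i <;> fin_cases j <;> simp [skewMatrix, hasDerivAt_const, ha]
    · exact (ha 1).neg
    · exact (ha 2).neg
    · exact (ha 0).neg
  have hL0 : lieDerivMatrix l (a t) (Γ t) = 0 := by
    ext i j; fin_cases i <;> fin_cases j <;> simp [lieDerivMatrix, ha0]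
  have hS0 : skewMatrix (a t) = 0 := by
    ext i j; fin_cases i <;> fin_cases j <;> simp [skewMatrix, ha0]
  have hN := HasMatrixDerivAt.smul hc (hD.sub hL)
  have hK := HasMatrixDerivAt.smul hc (hκ.sub (HasMatrixDerivAt.smul hh hS))
  have h := hasDerivAt_energyDensity hΓ hN hK (by rw [hΓ0]; exact isUnit_one)
  simpa [flowEnergy, hinv, hc0, hL0, hS0] using h

theorem trace_mul_self_nonneg {S : Mat3} (h : Sᵀ = S) : 0 ≤ (S * S).trace := by
  have : (S * S).trace = ∑ i, ∑ j, S i j ^ 2 := by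
    simp only [Matrix.trace, Matrix.diag_apply, Matrix.mul_apply]
    refine Finset.sum_congr rfl fun i _ => Finset.sum_congr rfl fun j _ => ?_
    rw [← congrFun₂ h j i, Matrix.transpose_apply, sq, ← congrFun₂ h i j, Matrix.transpose_apply]
  rw [this]; positivity

theorem trace_mul_self_nonpos {S : Mat3} (h : Sᵀ = -S) : (S * S).trace ≤ 0 := by
  have : (S * S).trace = -∑ i, ∑ j, S i j ^ 2 := by
    simp only [Matrix.trace, Matrix.diag_apply, Matrix.mul_apply, ← Finset.sum_neg_distrib]
    refine Finset.sum_congr rfl fun i _ => Finset.sum_congr rfl fun j _ => ?_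
    have : S j i = -S i j := congrFun₂ h i j
    rw [this]; ring
  rw [this, Left.neg_nonpos_iff]; positivity

theorem eq_of_symmetric {N : Mat3} (h : Nᵀ = N) :
    N = !![N 0 0, N 0 1, N 0 2; N 0 1, N 1 1, N 1 2; N 0 2, N 1 2, N 2 2] := by
  have e := fun i j => congrFun₂ h i j
  simp only [Matrix.transpose_apply] at e
  ext i j
  fin_cases i <;> fin_cases j <;> simp [e 0 1, e 0 2, e 1 2]

theorem eq_of_skew {k : Mat3} (h : kᵀ = -k) :
    k = !![0, k 0 1, k 0 2; -k 0 1, 0, k 1 2; -k 0 2, -k 1 2, 0] := by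
  have e := fun i j => congrFun₂ h i j
  simp only [Matrix.transpose_apply, Matrix.neg_apply] at e
  have d : ∀ i, k i i = 0 := fun i => by linarith [e i i]
  ext i j
  fin_cases i <;> fin_cases j <;> simp [d, e 0 1, e 0 2, e 1 2]

/-- The time derivative of the form part, in a fixed frame. -/
def formFlow (l : ℝ) (N A k k1 k2 : Mat3) : Mat3 :=
  k2 - (A * k - N * N * k + N * k1) - (k1 * N - k * N * N + k * A)
    - l ^ 2 • !![0, k 0 1, 0; -k 0 1, 0, 0; 0, 0, 0]

/-- A polynomial identity in the matrix entries. On the left is the time derivative of the energy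
under the flow, where `-φ/4` is the rate of the normalising factor and `α` the velocity of the
connection. On the right is the second spatial derivative of the energy density, then terms that are
all nonpositive: the trace with the plus sign is that of the square of a skew matrix. -/
theorem energy_identity {N A C k k1 k2 : Mat3} (hN : Nᵀ = N) (hA : Aᵀ = A) (hC : Cᵀ = C)
    (hk : kᵀ = -k) (hk1 : k1ᵀ = -k1) (hk2 : k2ᵀ = -k2) (l h φ : ℝ)
    (hφ : φ = (N * N).trace - (k * k).trace) (α : Fin 3 → ℝ) (hα0 : α 0 = l * N 1 2 + h * k 1 2)
    (hα1 : α 1 = -(l * N 0 2) - h * k 0 2) (hα2 : α 2 = h * k 0 1) :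
    2 * (N * (((-(φ / 4)) • N + (metricFlowDeriv l h N A C k k1 - lieDerivMatrix l α 1))
          - metricFlowOne l h N A k * N)).trace
      - 2 * (k * (((-(φ / 4)) • k + (formFlow l N A k k1 k2 - h • skewMatrix α))
          - metricFlowOne l h N A k * k)).trace =
    (2 * ((A - N * N) * (A - N * N) + N * (C - N * A - (A - N * N) * N - N * (A - N * N))).trace
      - 2 * ((k1 - N * k) * (k1 - N * k)
        + k * (k2 - N * k1 - (A - N * N) * k - N * (k1 - N * k))).trace)
    - φ ^ 2 / 2 - 2 * ((A - N * N - k * k) * (A - N * N - k * k)).trace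
    + 2 * ((k1 - N * k - k * N) * (k1 - N * k - k * N)).trace
    - 2 * h ^ 2 * N.trace ^ 2 - 4 * h ^ 2 * (k 0 1 ^ 2 + k 0 2 ^ 2 + k 1 2 ^ 2)
    - 2 * l ^ 2 * (N.trace - 2 * N 2 2) ^ 2 - 4 * l ^ 2 * (N 0 2 ^ 2 + N 1 2 ^ 2)
    - 4 * l ^ 2 * k 0 1 ^ 2 - 4 * (l * N 0 2 + h * k 0 2) ^ 2 - 4 * (l * N 1 2 + h * k 1 2) ^ 2
    - 4 * (l ^ 2 + h ^ 2) * k 0 1 ^ 2 := by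
  -- The independent entries are named so that the matrices can be replaced by explicit ones; this
  -- leaves an identity between real polynomials.
  obtain ⟨a0, h1⟩ : ∃ a, a = N 0 0 := ⟨_, rfl⟩
  obtain ⟨a1, h2⟩ : ∃ a, a = N 0 1 := ⟨_, rfl⟩
  obtain ⟨a2, h3⟩ : ∃ a, a = N 0 2 := ⟨_, rfl⟩
  obtain ⟨a3, h4⟩ : ∃ a, a = N 1 1 := ⟨_, rfl⟩
  obtain ⟨a4, h5⟩ : ∃ a, a = N 1 2 := ⟨_, rfl⟩
  obtain ⟨a5, h6⟩ : ∃ a, a = N 2 2 := ⟨_, rfl⟩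
  obtain ⟨b0, i1⟩ : ∃ a, a = A 0 0 := ⟨_, rfl⟩
  obtain ⟨b1, i2⟩ : ∃ a, a = A 0 1 := ⟨_, rfl⟩
  obtain ⟨b2, i3⟩ : ∃ a, a = A 0 2 := ⟨_, rfl⟩
  obtain ⟨b3, i4⟩ : ∃ a, a = A 1 1 := ⟨_, rfl⟩
  obtain ⟨b4, i5⟩ : ∃ a, a = A 1 2 := ⟨_, rfl⟩
  obtain ⟨b5, i6⟩ : ∃ a, a = A 2 2 := ⟨_, rfl⟩
  obtain ⟨u0, j1⟩ : ∃ a, a = k 0 1 := ⟨_, rfl⟩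
  obtain ⟨u1, j2⟩ : ∃ a, a = k 0 2 := ⟨_, rfl⟩
  obtain ⟨u2, j3⟩ : ∃ a, a = k 1 2 := ⟨_, rfl⟩
  obtain ⟨v0, m1⟩ : ∃ a, a = k1 0 1 := ⟨_, rfl⟩
  obtain ⟨v1, m2⟩ : ∃ a, a = k1 0 2 := ⟨_, rfl⟩
  obtain ⟨v2, m3⟩ : ∃ a, a = k1 1 2 := ⟨_, rfl⟩
  have eN := eq_of_symmetric hN
  have eA := eq_of_symmetric hA
  have ek := eq_of_skew hk
  have ek1 := eq_of_skew hk1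
  rw [eq_of_symmetric hC, eq_of_skew hk2]
  rw [← h1, ← h2, ← h3, ← h4, ← h5, ← h6] at eN
  rw [← i1, ← i2, ← i3, ← i4, ← i5, ← i6] at eA
  rw [← j1, ← j2, ← j3] at ek
  rw [← m1, ← m2, ← m3] at ek1
  rw [← h3, ← h5, ← j1, ← j2, ← j3] at *
  clear h1 h2 h3 h4 h5 h6 i1 i2 i3 i4 i5 i6 j1 j2 j3 m1 m2 m3 hN hA hC hk hk1 hk2
  subst eN eA ek ek1
  have t1 : ∀ M : Mat3, trace M = M 0 0 + M 1 1 + M 2 2 := fun M => trace_fin_three M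
  simp only [t1] at *
  simp [Matrix.mul_apply, Fin.sum_univ_three] at hφ
  subst hφ
  simp [Matrix.mul_apply, Fin.sum_univ_three, metricFlowDeriv, metricFlowOne, formFlow,
    lieDerivMatrix, skewMatrix, hα0, hα1, hα2]
  ring

end InvariantFlow

namespace InvariantFlow

/-! ### Smoothness and mixed derivatives in space and time -/

section Smooth

variable {E H N : Type*} [NormedAddCommGroup E] [NormedSpace ℝ E] [TopologicalSpace H]
  {I : ModelWithCorners ℝ E H} [TopologicalSpace N] [ChartedSpace H N] [IsManifold I ∞ N]

/-- The derivative of a smooth function along a smooth vector field is smooth. -/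
theorem contMDiffOn_mfderiv_apply {O : Set N} (hO : IsOpen O) {W : (x : N) → TangentSpace I x}
    (hW : ContMDiffOn I I.tangent ∞ (fun x => (⟨x, W x⟩ : TangentBundle I N)) O) {f : N → ℝ}
    (hf : ContMDiffOn I 𝓘(ℝ, ℝ) ∞ f O) :
    ContMDiffOn I 𝓘(ℝ, ℝ) ∞ (fun x => (mfderiv I 𝓘(ℝ, ℝ) f x (W x) : ℝ)) O := by
  have h1 := hf.contMDiffOn_tangentMapWithin (m := ∞) (by simp) hO.uniqueMDiffOn
  have h2 : ContMDiffOn I 𝓘(ℝ, ℝ).tangent ∞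
      (fun x => tangentMapWithin I 𝓘(ℝ, ℝ) f O (⟨x, W x⟩ : TangentBundle I N)) O :=
    h1.comp hW fun x hx => hx
  have h3 := (contMDiff_snd_tangentBundle_modelSpace (n := ∞) ℝ 𝓘(ℝ, ℝ)).comp_contMDiffOn h2
  refine h3.congr fun x hx => ?_
  change _ = mfderivWithin I 𝓘(ℝ, ℝ) f O x (W x)
  rw [mfderivWithin_of_isOpen hO hx]

end Smooth

section VectorSpace

variable {E : Type*} [NormedAddCommGroup E] [NormedSpace ℝ E] {F : ℝ × E → ℝ} {t : ℝ} {z₀ : E}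

theorem deriv_slice_eventuallyEq (hF : ContDiffAt ℝ ∞ F (t, z₀)) :
    (fun z => deriv (fun s => F (s, z)) t) =ᶠ[𝓝 z₀] fun z => fderiv ℝ F (t, z) (1, 0) := by
  filter_upwards [(Continuous.prodMk_right t).continuousAt.eventually
    ((hF.of_le (m := 1) (by norm_cast)).eventually (by simp))] with z hz
  have h : HasDerivAt (fun s => F (s, z)) (fderiv ℝ F (t, z) (1, 0)) t :=
    HasFDerivAt.comp_hasDerivAt (f := fun s => (s, z)) t (hz.differentiableAt (by simp)).hasFDerivAt
      ((hasDerivAt_id t).prodMk (hasDerivAt_const t z))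
  exact h.deriv

theorem hasFDerivAt_fderiv_slice (hF : ContDiffAt ℝ ∞ F (t, z₀)) :
    HasFDerivAt (fun z => fderiv ℝ F (t, z) (1, 0))
      ((ContinuousLinearMap.apply ℝ ℝ ((1 : ℝ), (0 : E))).comp
        ((fderiv ℝ (fderiv ℝ F) (t, z₀)).comp (ContinuousLinearMap.inr ℝ ℝ E))) z₀ :=
  (ContinuousLinearMap.apply ℝ ℝ ((1 : ℝ), (0 : E))).hasFDerivAt.comp z₀
    (HasFDerivAt.comp (f := fun z => (t, z)) z₀ ((hF.fderiv_right (m := 1)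
      (by norm_cast)).differentiableAt (by simp)).hasFDerivAt (hasFDerivAt_prodMk_right t z₀))

theorem differentiableAt_deriv_slice (hF : ContDiffAt ℝ ∞ F (t, z₀)) :
    DifferentiableAt ℝ (fun z => deriv (fun s => F (s, z)) t) z₀ :=
  ((hasFDerivAt_fderiv_slice hF).differentiableAt).congr_of_eventuallyEq
    (deriv_slice_eventuallyEq hF)

/-- Symmetry of mixed partial derivatives. -/
theorem hasDerivAt_fderiv_slice (hF : ContDiffAt ℝ ∞ F (t, z₀)) (v : E) :
    HasDerivAt (fun s => fderiv ℝ (fun z => F (s, z)) z₀ v)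
      (fderiv ℝ (fun z => deriv (fun s => F (s, z)) t) z₀ v) t := by
  rw [(deriv_slice_eventuallyEq hF).fderiv_eq, (hasFDerivAt_fderiv_slice hF).fderiv]
  have h7 : HasDerivAt (fun s => fderiv ℝ F (s, z₀)) (fderiv ℝ (fderiv ℝ F) (t, z₀) (1, 0)) t :=
    HasFDerivAt.comp_hasDerivAt (f := fun s => (s, z₀)) t ((hF.fderiv_right (m := 1)
      (by norm_cast)).differentiableAt (by simp)).hasFDerivAt
      ((hasDerivAt_id t).prodMk (hasDerivAt_const t z₀))
  have h8 : HasDerivAt (fun s => fderiv ℝ F (s, z₀) (0, v))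
      (fderiv ℝ (fderiv ℝ F) (t, z₀) (1, 0) (0, v)) t := by
    simpa using h7.clm_apply (hasDerivAt_const t ((0 : ℝ), v))
  rw [(hF.isSymmSndFDerivAt (by simp; norm_cast)).eq] at h8
  refine h8.congr_of_eventuallyEq ?_
  filter_upwards [(Continuous.prodMk_left z₀).continuousAt.eventually
    ((hF.of_le (m := 1) (by norm_cast)).eventually (by simp))] with s hs
  have h5 : HasFDerivAt (fun z => F (s, z)) _ z₀ :=
    HasFDerivAt.comp (f := fun z => (s, z)) z₀ (hs.differentiableAt (by simp)).hasFDerivAt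
      (hasFDerivAt_prodMk_right s z₀)
  rw [h5.fderiv]
  simp

end VectorSpace

section Product

variable {P : Type*} [TopologicalSpace P] [ChartedSpace (EuclideanSpace ℝ (Fin 4)) P]
  [IsManifold (𝓡 4) ∞ P]

/-- In the chart centred at `p`, the derivative at `p` is by definition the Fréchet derivative of
the chart expression. Statements about mixed derivatives at `p` thus reduce to a vector space. -/
theorem hasMFDerivAt_of_chart {p : P} {k : P → ℝ}
    (hk : DifferentiableAt ℝ (fun z => k ((extChartAt (𝓡 4) p).symm z)) (extChartAt (𝓡 4) p p)) :
    HasMFDerivAt (𝓡 4) 𝓘(ℝ, ℝ) k p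
      (fderiv ℝ (fun z => k ((extChartAt (𝓡 4) p).symm z)) (extChartAt (𝓡 4) p p)) := by
  refine ⟨?_, hk.hasFDerivAt.hasFDerivWithinAt⟩
  have h := ContinuousAt.comp (g := fun z => k ((extChartAt (𝓡 4) p).symm z)) hk.continuousAt
    (continuousAt_extChartAt p)
  refine h.congr ?_
  filter_upwards [extChartAt_source_mem_nhds (I := 𝓡 4) p] with q hq
  exact congrArg k ((extChartAt (𝓡 4) p).left_inv hq)

theorem dirDeriv_eq_fderiv (p : P) (v : EuclideanSpace ℝ (Fin 4)) {k : P → ℝ}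
    (hk : DifferentiableAt ℝ (fun z => k ((extChartAt (𝓡 4) p).symm z)) (extChartAt (𝓡 4) p p)) :
    dirDeriv p v k =
      fderiv ℝ (fun z => k ((extChartAt (𝓡 4) p).symm z)) (extChartAt (𝓡 4) p p) v :=
  congrArg (fun L : EuclideanSpace ℝ (Fin 4) →L[ℝ] ℝ => L v) (hasMFDerivAt_of_chart hk).mfderiv

theorem SmoothField.mono {U U' : Set P} {X : (p : P) → TangentSpace (𝓡 4) p}
    (h : SmoothField U X) (hU : U' ⊆ U) : SmoothField U' X := ContMDiffOn.mono h hU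

theorem contMDiffOn_dirDeriv_of_smooth {U : Set P} (hU : IsOpen U)
    {X : (p : P) → TangentSpace (𝓡 4) p} (hX : SmoothField U X) {f : P → ℝ}
    (hf : ContMDiffOn (𝓡 4) 𝓘(ℝ, ℝ) ∞ f U) :
    ContMDiffOn (𝓡 4) 𝓘(ℝ, ℝ) ∞ (fun p => dirDeriv p (X p) f) U :=
  contMDiffOn_mfderiv_apply hU hX hf

theorem contMDiffOn_slice {J : Set ℝ} {U : Set P} {f : ℝ × P → ℝ}
    (hf : ContMDiffOn (𝓘(ℝ, ℝ).prod (𝓡 4)) 𝓘(ℝ, ℝ) ∞ f (J ×ˢ U)) {t : ℝ} (ht : t ∈ J) :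
    ContMDiffOn (𝓡 4) 𝓘(ℝ, ℝ) ∞ (fun p => f (t, p)) U :=
  hf.comp (contMDiff_const.prodMk contMDiff_id).contMDiffOn fun _ hp => ⟨ht, hp⟩

/-- Slicewise directional derivatives of a smooth function are jointly smooth. -/
theorem contMDiffOn_dirDeriv_slice {J : Set ℝ} (hJ : IsOpen J) {U : Set P} (hU : IsOpen U)
    {X : (p : P) → TangentSpace (𝓡 4) p} (hX : SmoothField U X) {f : ℝ × P → ℝ}
    (hf : ContMDiffOn (𝓘(ℝ, ℝ).prod (𝓡 4)) 𝓘(ℝ, ℝ) ∞ f (J ×ˢ U)) :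
    ContMDiffOn (𝓘(ℝ, ℝ).prod (𝓡 4)) 𝓘(ℝ, ℝ) ∞
      (fun q : ℝ × P => dirDeriv q.2 (X q.2) (fun p => f (q.1, p))) (J ×ˢ U) := by
  -- The slicewise derivative along `X` is the full derivative along the smooth field `(0, X)` on
  -- the product.
  have S₁ : ContMDiffOn (𝓘(ℝ, ℝ).prod (𝓡 4)) (𝓘(ℝ, ℝ).tangent.prod (𝓡 4).tangent) ∞
      (fun q : ℝ × P => ((⟨q.1, 0⟩ : TangentBundle 𝓘(ℝ, ℝ) ℝ),
        (⟨q.2, X q.2⟩ : TangentBundle (𝓡 4) P))) (J ×ˢ U) :=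
    ((Bundle.contMDiff_zeroSection ℝ (TangentSpace 𝓘(ℝ, ℝ))).comp
      contMDiff_fst).contMDiffOn.prodMk (ContMDiffOn.comp hX contMDiffOn_snd fun q hq => hq.2)
  have S₂ := (contMDiff_equivTangentBundleProd_symm (I := 𝓘(ℝ, ℝ)) (M := ℝ) (I' := 𝓡 4) (M' := P)
    (n := ∞)).comp_contMDiffOn S₁
  refine (contMDiffOn_mfderiv_apply (hJ.prod hU) (W := fun q => ((0 : ℝ), X q.2)) S₂ hf).congr ?_
  rintro ⟨t, p⟩ hq
  have hd : MDifferentiableAt (𝓘(ℝ, ℝ).prod (𝓡 4)) 𝓘(ℝ, ℝ) f (t, p) :=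
    (hf.contMDiffAt ((hJ.prod hU).mem_nhds hq)).mdifferentiableAt (by simp)
  let w : TangentSpace (𝓘(ℝ, ℝ).prod (𝓡 4)) (t, p) :=
    show ℝ × EuclideanSpace ℝ (Fin 4) from (0, X p)
  have h := mfderiv_prod_eq_add_apply (v := w) hd
  refine (h.trans ?_).symm
  refine Eq.trans ?_ (zero_add _)
  refine congrArg (fun r : ℝ => r + _) ?_
  exact map_zero (mfderiv 𝓘(ℝ, ℝ) 𝓘(ℝ, ℝ) (fun s => f (s, p)) t : ℝ →L[ℝ] ℝ)

theorem contDiffAt_writtenInChart {J : Set ℝ} (hJ : IsOpen J) {U : Set P} (hU : IsOpen U)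
    {f : ℝ × P → ℝ} (hf : ContMDiffOn (𝓘(ℝ, ℝ).prod (𝓡 4)) 𝓘(ℝ, ℝ) ∞ f (J ×ˢ U)) {t : ℝ}
    (ht : t ∈ J) {p : P} (hp : p ∈ U) :
    ContDiffAt ℝ ∞ (fun w : ℝ × EuclideanSpace ℝ (Fin 4) => f (w.1, (extChartAt (𝓡 4) p).symm w.2))
      (t, extChartAt (𝓡 4) p p) := by
  let φ := extChartAt (𝓡 4) p
  have hsymm : φ.symm (φ p) = p := extChartAt_to_inv p
  have h1 : ContMDiffAt (𝓡 4) (𝓡 4) ∞ φ.symm (φ p) :=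
    (contMDiffOn_extChartAt_symm p).contMDiffAt
      ((isOpen_extChartAt_target p).mem_nhds (mem_extChartAt_target p))
  have h2 : ContMDiffAt 𝓘(ℝ, ℝ × EuclideanSpace ℝ (Fin 4)) (𝓘(ℝ, ℝ).prod (𝓡 4)) ∞
      (fun w : ℝ × EuclideanSpace ℝ (Fin 4) => (w.1, φ.symm w.2)) (t, φ p) :=
    contDiff_fst.contMDiff.contMDiffAt.prodMk
      (ContMDiffAt.comp (t, φ p) h1 contDiff_snd.contMDiff.contMDiffAt)
  have h3 : ContMDiffAt (𝓘(ℝ, ℝ).prod (𝓡 4)) 𝓘(ℝ, ℝ) ∞ f (t, φ.symm (φ p)) := by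
    rw [hsymm]
    exact hf.contMDiffAt ((hJ.prod hU).mem_nhds ⟨ht, hp⟩)
  exact (ContMDiffAt.comp (t, φ p) h3 h2).contDiffAt

theorem mdifferentiableAt_deriv_slice {J : Set ℝ} (hJ : IsOpen J) {U : Set P} (hU : IsOpen U)
    {f : ℝ × P → ℝ} (hf : ContMDiffOn (𝓘(ℝ, ℝ).prod (𝓡 4)) 𝓘(ℝ, ℝ) ∞ f (J ×ˢ U)) {t : ℝ}
    (ht : t ∈ J) {p : P} (hp : p ∈ U) :
    MDifferentiableAt (𝓡 4) 𝓘(ℝ, ℝ) (fun q => deriv (fun s => f (s, q)) t) p :=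
  (hasMFDerivAt_of_chart (k := fun q => deriv (fun s => f (s, q)) t)
    (differentiableAt_deriv_slice (contDiffAt_writtenInChart hJ hU hf ht hp))).mdifferentiableAt

/-- Time derivatives commute with directional derivatives. -/
theorem hasDerivAt_dirDeriv {J : Set ℝ} (hJ : IsOpen J) {U : Set P} (hU : IsOpen U) {f : ℝ × P → ℝ}
    (hf : ContMDiffOn (𝓘(ℝ, ℝ).prod (𝓡 4)) 𝓘(ℝ, ℝ) ∞ f (J ×ˢ U)) {t : ℝ} (ht : t ∈ J) {p : P}
    (hp : p ∈ U) (v : TangentSpace (𝓡 4) p) :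
    HasDerivAt (fun s => dirDeriv p v (fun q => f (s, q)))
      (dirDeriv p v (fun q => deriv (fun s => f (s, q)) t)) t := by
  have hF := contDiffAt_writtenInChart hJ hU hf ht hp
  have h1 := hasDerivAt_fderiv_slice hF v
  rw [dirDeriv_eq_fderiv p v (k := fun q => deriv (fun s => f (s, q)) t)
    (differentiableAt_deriv_slice hF)]
  refine h1.congr_of_eventuallyEq ?_
  have hs : ∀ᶠ s in 𝓝 t, ContDiffAt ℝ 1
      (fun w : ℝ × EuclideanSpace ℝ (Fin 4) => f (w.1, (extChartAt (𝓡 4) p).symm w.2))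
      (s, extChartAt (𝓡 4) p p) :=
    (Continuous.prodMk_left (extChartAt (𝓡 4) p p)).continuousAt.eventually
      ((hF.of_le (m := 1) (by norm_cast)).eventually (by simp))
  filter_upwards [hs] with s hs
  have h2 := hs.comp (extChartAt (𝓡 4) p p) (contDiffAt_const.prodMk contDiffAt_id)
  exact dirDeriv_eq_fderiv p v (h2.differentiableAt (by simp))

end Product

/-! ### The maximum principle on the base -/

section MaximumPrinciple

variable {𝒢 M P : Type*}
  [Group 𝒢] [TopologicalSpace 𝒢] [ChartedSpace (EuclideanSpace ℝ (Fin 3)) 𝒢]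
  [TopologicalSpace M] [ChartedSpace (EuclideanSpace ℝ (Fin 1)) M]
  [TopologicalSpace P] [ChartedSpace (EuclideanSpace ℝ (Fin 4)) P]
  (𝔓 : PrincipalBundle 𝒢 M P)

/-- A function on `P` that is invariant under the group and satisfies `∂f/∂t ≤ -c f²` at its
positive spatial maxima is bounded by `1 / (c t)`. -/
theorem PrincipalBundle.le_of_maximum_principle [CompactSpace M] {f : ℝ → P → ℝ} {T c : ℝ}
    (hc : 0 < c) (hcont : ContinuousOn (fun q : ℝ × P => f q.1 q.2) (Ioo 0 T ×ˢ univ))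
    (hinv : ∀ t ∈ Ioo 0 T, ∀ p a, f t (𝔓.act p a) = f t p)
    (hmax : ∀ t ∈ Ioo 0 T, ∀ p, (∀ q, f t q ≤ f t p) → 0 < f t p →
      ∃ d, HasDerivAt (fun s => f s p) d t ∧ d ≤ -c * f t p ^ 2)
    {t : ℝ} (ht : t ∈ Ioo 0 T) (p : P) : f t p ≤ 1 / (c * t) := by
  have hsec : ∀ m : M, ∃ q : P, 𝔓.proj q = m := by
    intro m
    obtain ⟨U, -, hm, s, κ, -, -, h1, -, -⟩ := 𝔓.locally_trivial m
    exact ⟨s m, h1 m hm⟩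
  choose sec hsec using hsec
  have hproj : ∀ t ∈ Ioo 0 T, ∀ q q', 𝔓.proj q = 𝔓.proj q' → f t q = f t q' := by
    intro t ht q q' h
    obtain ⟨U, -, hm, s, κ, -, -, h1, h2, -⟩ := 𝔓.locally_trivial (𝔓.proj q)
    rw [← h2 q hm, ← h2 q' (by rwa [← h]), hinv t ht, hinv t ht, h]
  have hcontM : ContinuousOn (fun q : ℝ × M => f q.1 (sec q.2)) (Ioo 0 T ×ˢ univ) := by
    rintro ⟨t, m⟩ ⟨ht, -⟩
    obtain ⟨U, hU, hm, s, κ, hs, -, h1, -, -⟩ := 𝔓.locally_trivial m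
    have hs' : ContinuousAt s m := hs.continuousOn.continuousAt (hU.mem_nhds hm)
    have hO : Ioo 0 T ×ˢ (univ : Set P) ∈ 𝓝 (t, s m) :=
      (isOpen_Ioo.prod isOpen_univ).mem_nhds ⟨ht, mem_univ _⟩
    have h3 : ContinuousAt (fun q : ℝ × P => f q.1 q.2) (t, s m) := hcont.continuousAt hO
    have h4 : ContinuousAt (fun q : ℝ × M => (q.1, s q.2)) (t, m) :=
      continuousAt_fst.prodMk (ContinuousAt.comp (f := Prod.snd) hs' continuousAt_snd)
    have h5 : ContinuousAt (fun q : ℝ × M => f q.1 (s q.2)) (t, m) :=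
      ContinuousAt.comp (f := fun q : ℝ × M => (q.1, s q.2)) (g := fun q : ℝ × P => f q.1 q.2) h3 h4
    refine (h5.congr ?_).continuousWithinAt
    filter_upwards [(isOpen_Ioo.prod hU).mem_nhds (show (t, m) ∈ Ioo 0 T ×ˢ U from ⟨ht, hm⟩)]
      with q hq
    exact hproj _ hq.1 _ _ (by rw [h1 _ hq.2, hsec])
  -- Nothing is known as time tends to zero. The weight `s - ε` vanishes at `s = ε`, so a positive
  -- maximum over `[ε, t]` cannot lie at the initial time.
  have key : ∀ ε ∈ Ioo 0 t, (t - ε) * f t p ≤ 1 / c := by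
    intro ε hε
    have hsub : Icc ε t ×ˢ (univ : Set M) ⊆ Ioo 0 T ×ˢ univ := fun q hq =>
      ⟨⟨hε.1.trans_le hq.1.1, hq.1.2.trans_lt ht.2⟩, mem_univ _⟩
    obtain ⟨⟨t₀, m₀⟩, ⟨ht₀, -⟩, hmx⟩ := (isCompact_Icc.prod isCompact_univ).exists_isMaxOn
      (⟨(t, 𝔓.proj p), ⟨hε.2.le, le_rfl⟩, mem_univ _⟩ : (Icc ε t ×ˢ (univ : Set M)).Nonempty)
      (f := fun q : ℝ × M => (q.1 - ε) * f q.1 (sec q.2))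
      ((continuous_fst.sub continuous_const).continuousOn.mul (hcontM.mono hsub))
    have htT : t₀ ∈ Ioo 0 T := ⟨hε.1.trans_le ht₀.1, ht₀.2.trans_lt ht.2⟩
    have h1 : ∀ s ∈ Icc ε t, ∀ q, (s - ε) * f s q ≤ (t₀ - ε) * f t₀ (sec m₀) := by
      intro s hs q
      have h2 : s ∈ Ioo 0 T := ⟨hε.1.trans_le hs.1, hs.2.trans_lt ht.2⟩
      have := hmx (show (s, 𝔓.proj q) ∈ Icc ε t ×ˢ univ from ⟨hs, mem_univ _⟩)
      have h3 : (s - ε) * f s (sec (𝔓.proj q)) ≤ (t₀ - ε) * f t₀ (sec m₀) := this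
      rwa [hproj s h2 (sec (𝔓.proj q)) q (hsec _)] at h3
    refine (h1 t ⟨hε.2.le, le_rfl⟩ p).trans ?_
    rcases le_or_gt ((t₀ - ε) * f t₀ (sec m₀)) 0 with hle | hgt
    · exact hle.trans (by positivity)
    have htε : 0 < t₀ - ε := by
      rcases (sub_nonneg.mpr ht₀.1).eq_or_lt with h | h
      · rw [← h, zero_mul] at hgt; exact absurd hgt (lt_irrefl _)
      · exact h
    have hpos : 0 < f t₀ (sec m₀) := (pos_iff_pos_of_mul_pos hgt).mp htε
    obtain ⟨d, hd, hdle⟩ := hmax t₀ htT (sec m₀)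
      (fun q => le_of_mul_le_mul_left (h1 t₀ ht₀ q) htε) hpos
    have hder : HasDerivAt (fun s => (s - ε) * f s (sec m₀))
        (1 * f t₀ (sec m₀) + (t₀ - ε) * d) t₀ := ((hasDerivAt_id t₀).sub_const ε).mul hd
    -- The maximum may occur at the right end of the interval, so only difference quotients from the
    -- left are available; they are nonnegative.
    have hge : 0 ≤ 1 * f t₀ (sec m₀) + (t₀ - ε) * d := by
      have hw := hder.hasDerivWithinAt (s := Iio t₀)
      rw [hasDerivWithinAt_iff_tendsto_slope' (by simp)] at hw
      have : (𝓝[<] t₀).NeBot := inferInstance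
      refine ge_of_tendsto hw ?_
      filter_upwards [Ioo_mem_nhdsLT (sub_pos.mp htε)] with s hs
      rw [slope_def_field]
      refine div_nonneg_of_nonpos (sub_nonpos.mpr ?_) (sub_nonpos.mpr hs.2.le)
      exact h1 s ⟨hs.1.le, hs.2.le.trans ht₀.2⟩ _
    have h2 : (t₀ - ε) * d ≤ (t₀ - ε) * (-c * f t₀ (sec m₀) ^ 2) :=
      mul_le_mul_of_nonneg_left hdle htε.le
    rw [le_div_iff₀ hc]
    by_contra! hcon
    -- `0 ≤ f + (t₀ - ε) d` and `d ≤ -c f²` give `c (t₀ - ε) f² ≤ f`; dividing by `f > 0`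
    -- contradicts `hcon`.
    nlinarith [mul_lt_mul_of_pos_right hcon hpos]
  have hlim : Filter.Tendsto (fun ε => (t - ε) * f t p) (𝓝[>] 0) (𝓝 (t * f t p)) := by
    have : Continuous fun ε => (t - ε) * f t p := by fun_prop
    have h := (this.tendsto 0).mono_left (nhdsWithin_le_nhds (s := Ioi 0))
    simpa using h
  have h := le_of_tendsto hlim (by filter_upwards [Ioo_mem_nhdsGT ht.1] with ε hε using key ε hε)
  have ht0 := ht.1
  rw [le_div_iff₀ (by positivity)]
  rw [le_div_iff₀ hc] at h
  linarith

end MaximumPrinciple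

end InvariantFlow

namespace InvariantFlow

/-! ### Algebra of 3-forms, and the adjoint representation as automorphisms -/

section Alternating

variable {E : Type*} [AddCommGroup E] [Module ℝ E] [TopologicalSpace E] (f : E [⋀^Fin 3]→L[ℝ] ℝ)

theorem alternating_swap_left (x y z : E) : f ![y, x, z] = -f ![x, y, z] := by
  have h := f.toAlternatingMap.map_swap ![x, y, z] (i := 0) (j := 1) (by decide)
  rw [← f.coe_toAlternatingMap, ← h]
  congr 1; ext i; fin_cases i <;> rfl

theorem alternating_swap_right (x y z : E) : f ![x, z, y] = -f ![x, y, z] := by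
  have h := f.toAlternatingMap.map_swap ![x, y, z] (i := 1) (j := 2) (by decide)
  rw [← f.coe_toAlternatingMap, ← h]
  congr 1; ext i; fin_cases i <;> rfl

theorem alternating_self_left (x y : E) : f ![x, x, y] = 0 :=
  f.map_eq_zero_of_eq _ (i := 0) (j := 1) rfl (by decide)

theorem alternating_self_right (x y : E) : f ![x, y, y] = 0 :=
  f.map_eq_zero_of_eq _ (i := 1) (j := 2) rfl (by decide)

theorem alternating_self_outer (x y : E) : f ![x, y, x] = 0 :=
  f.map_eq_zero_of_eq _ (i := 0) (j := 2) rfl (by decide)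

theorem alternating_add (x x' y z : E) : f ![x + x', y, z] = f ![x, y, z] + f ![x', y, z] :=
  f.vecCons_add ![y, z] x x'

theorem alternating_smul (c : ℝ) (x y z : E) : f ![c • x, y, z] = c * f ![x, y, z] :=
  f.vecCons_smul ![y, z] c x

theorem isBilin_alternating {L : Type*} [AddCommGroup L] [Module ℝ L] (T : L →ₗ[ℝ] E) (v : E) :
    IsBilin fun y z => f ![v, T y, T z] where
  add_left x y z := by
    rw [map_add]
    linarith [alternating_swap_left f (T x + T y) v (T z), alternating_swap_left f (T x) v (T z),
      alternating_swap_left f (T y) v (T z), alternating_add f (T x) (T y) v (T z)]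
  smul_left c x z := by
    rw [map_smul, alternating_swap_left f (c • T x) v (T z), alternating_smul,
      alternating_swap_left f v (T x)]
    ring
  add_right x y z := by
    rw [map_add]
    linarith [alternating_swap_right f v (T y + T z) (T x), alternating_swap_right f v (T y) (T x),
      alternating_swap_right f v (T z) (T x), alternating_swap_left f (T y + T z) v (T x),
      alternating_swap_left f (T y) v (T x), alternating_swap_left f (T z) v (T x),
      alternating_add f (T y) (T z) v (T x)]
  smul_right c x z := by
    rw [map_smul, alternating_swap_right f v (c • T z) (T x),
      alternating_swap_left f (c • T z) v (T x), alternating_smul,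
      alternating_swap_left f v (T z) (T x), alternating_swap_right f v (T x) (T z)]
    ring

/-- The components of a 3-form on a three-dimensional space. -/
theorem alternating_basis {L : Type*} (T : L → E) (e : Fin 3 → L) (i j k : Fin 3) :
    f ![T (e i), T (e j), T (e k)] =
      (f ![T (e 0), T (e 1), T (e 2)] • skewMatrix (Pi.single i 1)) j k := by
  obtain ⟨a, ha⟩ : ∃ a, a = T (e 0) := ⟨_, rfl⟩
  obtain ⟨b, hb⟩ : ∃ a, a = T (e 1) := ⟨_, rfl⟩
  obtain ⟨c, hc⟩ : ∃ a, a = T (e 2) := ⟨_, rfl⟩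
  have h1 := alternating_swap_left f a b c
  have h2 := alternating_swap_right f a b c
  have h3 := alternating_swap_right f b a c
  have h4 := alternating_swap_left f a c b
  have h5 := alternating_swap_left f b c a
  rw [← ha, ← hb, ← hc]
  fin_cases i <;> fin_cases j <;> fin_cases k <;>
    simp [skewMatrix, ← ha, ← hb, ← hc, alternating_self_left, alternating_self_right,
      alternating_self_outer] <;> linarith

end Alternating

section Adjoint

variable {𝒢 : Type*} [Group 𝒢] [TopologicalSpace 𝒢] [ChartedSpace (EuclideanSpace ℝ (Fin 3)) 𝒢]
  [LieGroup (𝓡 3) ∞ 𝒢]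

theorem adjointRep_mul (a b : 𝒢) (y : GroupLieAlgebra (𝓡 3) 𝒢) :
    adjointRep (a * b) y = adjointRep a (adjointRep b y) := by
  have h1 : (fun c : 𝒢 => a * b * c * (a * b)⁻¹) = fun c => a * (b * c * b⁻¹) * a⁻¹ := by
    ext c; group
  refine (mfderiv_apply_congr (E := EuclideanSpace ℝ (Fin 3)) h1 (1 : 𝒢) y).trans ?_
  exact mfderiv_comp_apply_of_eq (g := fun c : 𝒢 => a * c * a⁻¹) (y := (1 : 𝒢))
    ((contMDiff_conj a).contMDiffAt.mdifferentiableAt (by simp))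
    ((contMDiff_conj b).contMDiffAt.mdifferentiableAt (by simp)) (by simp) y

theorem adjointRep_inv_apply (a : 𝒢) (y : GroupLieAlgebra (𝓡 3) 𝒢) :
    adjointRep a (adjointRep a⁻¹ y) = y := by
  rw [← adjointRep_mul, mul_inv_cancel, adjointRep_one]

/-- Differentiate `Ad_a (Ad_b y) = Ad_{a b a⁻¹} (Ad_a y)` in `b` at the identity along `x`. -/
theorem adjointRep_lie (a : 𝒢) (x y : GroupLieAlgebra (𝓡 3) 𝒢) :
    adjointRep a ⁅x, y⁆ = ⁅adjointRep a x, adjointRep a y⁆ := by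
  let L : EuclideanSpace ℝ (Fin 3) →L[ℝ] EuclideanSpace ℝ (Fin 3) := adjointRep a
  have h1 := (hasMFDerivAt_clm_adjointRep L y).mfderiv
  have h2 : (fun b : 𝒢 => L (adjointRep b y)) =
      fun b => adjointRep (a * b * a⁻¹) (adjointRep a y) := by
    ext1 b
    refine (adjointRep_mul a b y).symm.trans ?_
    rw [← adjointRep_mul]
    congr 2
    group
  have h3 : (mfderiv (M' := EuclideanSpace ℝ (Fin 3)) (𝓡 3) (𝓡 3) (fun b : 𝒢 => L (adjointRep b y)) 1 :
      EuclideanSpace ℝ (Fin 3) →L[ℝ] EuclideanSpace ℝ (Fin 3)) x = adjointRep a ⁅x, y⁆ := by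
    rw [h1]
    exact congrArg L (adjointRepDeriv_apply x y)
  have h5 := mfderiv_apply_congr (E := EuclideanSpace ℝ (Fin 3)) (E' := EuclideanSpace ℝ (Fin 3))
    (M' := EuclideanSpace ℝ (Fin 3)) h2 (1 : 𝒢) x
  have h6 := mfderiv_comp_apply_of_eq (E := EuclideanSpace ℝ (Fin 3))
    (E' := EuclideanSpace ℝ (Fin 3)) (E'' := EuclideanSpace ℝ (Fin 3))
    (M'' := EuclideanSpace ℝ (Fin 3)) (f := fun b : 𝒢 => a * b * a⁻¹)
    (g := fun c : 𝒢 => adjointRep c (adjointRep a y)) (x := (1 : 𝒢)) (y := (1 : 𝒢))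
    (mdifferentiableAt_adjointRep _)
    ((contMDiff_conj a).contMDiffAt.mdifferentiableAt (by simp)) (by simp) x
  exact (h3.symm.trans h5).trans (h6.trans (mfderiv_adjointRep (adjointRep a x) (adjointRep a y)))

end Adjoint

/-! ### The fibre metric and the connection form at a point -/

section Pointwise

variable {𝒢 M P : Type*}
  [Group 𝒢] [TopologicalSpace 𝒢] [ChartedSpace (EuclideanSpace ℝ (Fin 3)) 𝒢] [LieGroup (𝓡 3) ∞ 𝒢]
  [TopologicalSpace M] [ChartedSpace (EuclideanSpace ℝ (Fin 1)) M]
  [TopologicalSpace P] [ChartedSpace (EuclideanSpace ℝ (Fin 4)) P] [IsManifold (𝓡 4) ∞ P]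
  (𝔓 : PrincipalBundle 𝒢 M P)

namespace PrincipalBundle

/-- The fundamental vectors at `p`, as a linear map. -/
def fundLin (p : P) : GroupLieAlgebra (𝓡 3) 𝒢 →ₗ[ℝ] TangentSpace (𝓡 4) p where
  toFun := 𝔓.fund p
  map_add' := 𝔓.fund_add p
  map_smul' := 𝔓.fund_smul p

@[simp] theorem fundLin_apply (p : P) (x : GroupLieAlgebra (𝓡 3) 𝒢) :
    𝔓.fundLin p x = 𝔓.fund p x := rfl

theorem fund_zero (p : P) : 𝔓.fund p 0 = 0 := map_zero (𝔓.fundLin p)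

theorem fund_sum (p : P) {ι : Type*} (s : Finset ι) (x : ι → GroupLieAlgebra (𝓡 3) 𝒢) :
    𝔓.fund p (∑ i ∈ s, x i) = ∑ i ∈ s, 𝔓.fund p (x i) := map_sum (𝔓.fundLin p) x s

/-- In a local trivialisation `q ↦ (κ p)⁻¹ κ q` is a left inverse of the orbit map `a ↦ p · a`, so
the derivative of the orbit map at the identity has a left inverse too. -/
theorem fund_injective (p : P) : Function.Injective (𝔓.fund p) := by
  suffices h : ∀ x, 𝔓.fund p x = 0 → x = 0 from
    (injective_iff_map_eq_zero (𝔓.fundLin p)).mpr h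
  intro x hx
  obtain ⟨U, hU, hm, s, κ, -, hκ, -, h2, h3⟩ := 𝔓.locally_trivial (𝔓.proj p)
  have hpU : 𝔓.proj ⁻¹' U ∈ 𝓝 p := (hU.preimage 𝔓.contMDiff_proj.continuous).mem_nhds hm
  have hd : MDifferentiableAt (𝓡 4) (𝓡 3) κ p :=
    (hκ.contMDiffAt hpU).mdifferentiableAt (by simp)
  have hl : ContMDiff (𝓡 3) (𝓡 3) ∞ (fun b : 𝒢 => (κ p)⁻¹ * b) := contMDiff_mul_left
  have hd2 : MDifferentiableAt (𝓡 4) (𝓡 3) (fun q => (κ p)⁻¹ * κ q) p :=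
    MDifferentiableAt.comp (I' := 𝓡 3) (g := fun b : 𝒢 => (κ p)⁻¹ * b) p
      (hl.contMDiffAt.mdifferentiableAt (by simp)) hd
  have hid : (fun a : 𝒢 => (κ p)⁻¹ * κ (𝔓.act p a)) = id := by
    ext a
    have : 𝔓.act p a = 𝔓.act (s (𝔓.proj p)) (κ p * a) := by rw [𝔓.act_mul, h2 p hm]
    rw [this, h3 _ hm]
    simp
  have h4 := mfderiv_comp_apply_of_eq (g := fun q => (κ p)⁻¹ * κ q) (y := p) hd2
    ((𝔓.contMDiff_orbit p).contMDiffAt.mdifferentiableAt (by simp)) (𝔓.act_one p) x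
  have h5 : (mfderiv (𝓡 3) (𝓡 3) (fun a : 𝒢 => (κ p)⁻¹ * κ (𝔓.act p a)) 1 :
      EuclideanSpace ℝ (Fin 3) →L[ℝ] EuclideanSpace ℝ (Fin 3)) x = x := by
    refine (mfderiv_apply_congr (E := EuclideanSpace ℝ (Fin 3)) hid (1 : 𝒢) x).trans ?_
    exact congrArg (fun L : EuclideanSpace ℝ (Fin 3) →L[ℝ] EuclideanSpace ℝ (Fin 3) => L x) mfderiv_id
  refine h5.symm.trans (h4.trans ?_)
  refine (congrArg (mfderiv (𝓡 4) (𝓡 3) (fun q => (κ p)⁻¹ * κ q) p :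
    EuclideanSpace ℝ (Fin 4) →L[ℝ] EuclideanSpace ℝ (Fin 3)) hx).trans ?_
  exact map_zero (mfderiv (𝓡 4) (𝓡 3) (fun q => (κ p)⁻¹ * κ q) p :
    EuclideanSpace ℝ (Fin 4) →L[ℝ] EuclideanSpace ℝ (Fin 3))

variable (g : Metric P) (p : P)

theorem isBilin_fibreMetric : IsBilin (𝔓.fibreMetric g p) where
  add_left x y z := by simp [fibreMetric, fund_add]
  smul_left c x z := by simp [fibreMetric, fund_smul]
  add_right x y z := by simp [fibreMetric, fund_add]
  smul_right c x z := by simp [fibreMetric, fund_smul]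

theorem fibreMetric_symm (x y : GroupLieAlgebra (𝓡 3) 𝒢) :
    𝔓.fibreMetric g p x y = 𝔓.fibreMetric g p y x := g.symm _ _ _

theorem fibreMetric_pos {x : GroupLieAlgebra (𝓡 3) 𝒢} (hx : x ≠ 0) :
    0 < 𝔓.fibreMetric g p x x :=
  g.pos _ _ fun h => hx (𝔓.fund_injective p (h.trans (𝔓.fund_zero p).symm))

theorem exists_orthonormal {e : Module.Basis (Fin 3) ℝ (GroupLieAlgebra (𝓡 3) 𝒢)} {c : ℝ}
    (he : IsHeisenberg e c) :
    ∃ (x : Module.Basis (Fin 3) ℝ (GroupLieAlgebra (𝓡 3) 𝒢)) (l : ℝ), IsHeisenberg x l ∧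
      ∀ i j, 𝔓.fibreMetric g p (x i) (x j) = if i = j then 1 else 0 :=
  exists_orthonormal_isHeisenberg he (𝔓.isBilin_fibreMetric g p).toLin
    (𝔓.fibreMetric_symm g p) fun _ hy => 𝔓.fibreMetric_pos g p hy

theorem isUnit_gramMatrix (e : Module.Basis (Fin 3) ℝ (GroupLieAlgebra (𝓡 3) 𝒢)) :
    IsUnit (gramMatrix (𝔓.fibreMetric g p) e) := by
  rw [← Matrix.mulVec_injective_iff_isUnit]
  refine (injective_iff_map_eq_zero (Matrix.mulVecLin _)).mpr fun a ha => ?_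
  by_contra hne
  have h1 : ∑ i, a i • e i ≠ 0 := by
    intro h
    exact hne (funext (Fintype.linearIndependent_iff.mp e.linearIndependent a h))
  have h2 := 𝔓.fibreMetric_pos g p h1
  rw [(𝔓.isBilin_fibreMetric g p).sum_sum] at h2
  have h3 : ∀ i, ∑ j, 𝔓.fibreMetric g p (e i) (e j) * a j = 0 := fun i => congrFun ha i
  have h4 : ∑ i, ∑ j, a i * a j * 𝔓.fibreMetric g p (e i) (e j) = 0 := by
    refine Finset.sum_eq_zero fun i _ => ?_
    rw [← mul_zero (a i), ← h3 i, Finset.mul_sum]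
    exact Finset.sum_congr rfl fun j _ => by ring
  linarith

theorem gramMatrix_symm (e : Fin 3 → GroupLieAlgebra (𝓡 3) 𝒢) :
    (gramMatrix (𝔓.fibreMetric g p) e).transpose = gramMatrix (𝔓.fibreMetric g p) e := by
  ext i j; exact 𝔓.fibreMetric_symm g p _ _

/-- The components of the connection form. -/
def connCoeff (e : Fin 3 → GroupLieAlgebra (𝓡 3) 𝒢) (Z : TangentSpace (𝓡 4) p) : Fin 3 → ℝ :=
  (gramMatrix (𝔓.fibreMetric g p) e)⁻¹.mulVec fun i => g.inner p Z (𝔓.fund p (e i))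

theorem connCoeff_spec (e : Module.Basis (Fin 3) ℝ (GroupLieAlgebra (𝓡 3) 𝒢))
    (Z : TangentSpace (𝓡 4) p) (y : GroupLieAlgebra (𝓡 3) 𝒢) :
    g.inner p (Z - 𝔓.fund p (∑ i, 𝔓.connCoeff g p e Z i • e i)) (𝔓.fund p y) = 0 := by
  have hu := 𝔓.isUnit_gramMatrix g p e
  rw [Matrix.isUnit_iff_isUnit_det] at hu
  have h1 : ∀ j, ∑ i, 𝔓.connCoeff g p e Z i * 𝔓.fibreMetric g p (e i) (e j) =
      g.inner p Z (𝔓.fund p (e j)) := by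
    intro j
    have h2 : (gramMatrix (𝔓.fibreMetric g p) e).mulVec (𝔓.connCoeff g p e Z) =
        fun i => g.inner p Z (𝔓.fund p (e i)) := by
      rw [connCoeff, Matrix.mulVec_mulVec, Matrix.mul_nonsing_inv _ hu, Matrix.one_mulVec]
    rw [← congrFun h2 j]
    simp only [Matrix.mulVec, dotProduct, gramMatrix_apply]
    exact Finset.sum_congr rfl fun i _ => by rw [𝔓.fibreMetric_symm g p (e i), mul_comm]
  have h3 : ∀ j, g.inner p (Z - 𝔓.fund p (∑ i, 𝔓.connCoeff g p e Z i • e i)) (𝔓.fund p (e j)) = 0 := by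
    intro j
    simp only [fund_sum, fund_smul, map_sub, map_sum, map_smul, sub_apply,
      sum_apply, smul_apply, smul_eq_mul]
    rw [sub_eq_zero, ← h1 j]
    rfl
  rw [← e.sum_repr y, 𝔓.fund_sum p Finset.univ fun i => e.repr y i • e i, map_sum]
  refine Finset.sum_eq_zero fun j _ => ?_
  rw [fund_smul, map_smul, h3, smul_zero]

theorem conn_eq {Z : TangentSpace (𝓡 4) p} {x : GroupLieAlgebra (𝓡 3) 𝒢}
    (h : ∀ y, g.inner p (Z - 𝔓.fund p x) (𝔓.fund p y) = 0) : 𝔓.conn g p Z = x := by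
  have hs : ∀ y, g.inner p (Z - 𝔓.fund p (𝔓.conn g p Z)) (𝔓.fund p y) = 0 :=
    Classical.epsilon_spec (p := fun x => ∀ y, g.inner p (Z - 𝔓.fund p x) (𝔓.fund p y) = 0) ⟨x, h⟩
  by_contra hne
  have h1 := 𝔓.fibreMetric_pos g p (sub_ne_zero.mpr hne)
  have h2 := h (𝔓.conn g p Z - x)
  have h3 := hs (𝔓.conn g p Z - x)
  have h4 : 𝔓.fund p (𝔓.conn g p Z - x) =
      (Z - 𝔓.fund p x) - (Z - 𝔓.fund p (𝔓.conn g p Z)) := by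
    rw [show 𝔓.fund p (𝔓.conn g p Z - x) = 𝔓.fund p (𝔓.conn g p Z) - 𝔓.fund p x from
      map_sub (𝔓.fundLin p) _ _]
    abel
  have h5 : 𝔓.fibreMetric g p (𝔓.conn g p Z - x) (𝔓.conn g p Z - x) = 0 := by
    have h6 : ∀ w, g.inner p ((Z - 𝔓.fund p x) - (Z - 𝔓.fund p (𝔓.conn g p Z))) w =
        g.inner p (Z - 𝔓.fund p x) w - g.inner p (Z - 𝔓.fund p (𝔓.conn g p Z)) w := fun w => by
      rw [map_sub, sub_apply]
    rw [← h4] at h6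
    rw [fibreMetric, h6, h2, h3, sub_zero]
  linarith

/-- Replaces the connection form, given by a choice, by the solution of the normal equations, whose
coefficients visibly depend smoothly on the point and on time. -/
theorem conn_eq_sum (e : Module.Basis (Fin 3) ℝ (GroupLieAlgebra (𝓡 3) 𝒢))
    (Z : TangentSpace (𝓡 4) p) : 𝔓.conn g p Z = ∑ i, 𝔓.connCoeff g p e Z i • e i :=
  𝔓.conn_eq g p (𝔓.connCoeff_spec g p e Z)

theorem conn_fund (x : GroupLieAlgebra (𝓡 3) 𝒢) : 𝔓.conn g p (𝔓.fund p x) = x :=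
  𝔓.conn_eq g p fun y => by rw [sub_self, map_zero, zero_apply]

theorem conn_of_horizontal {Z : TangentSpace (𝓡 4) p}
    (h : ∀ y, g.inner p Z (𝔓.fund p y) = 0) : 𝔓.conn g p Z = 0 :=
  𝔓.conn_eq g p fun y => by rw [fund_zero, sub_zero, h]

end PrincipalBundle

end Pointwise

end InvariantFlow

namespace InvariantFlow

variable {𝒢 M P : Type*}
  [Group 𝒢] [TopologicalSpace 𝒢] [ChartedSpace (EuclideanSpace ℝ (Fin 3)) 𝒢] [LieGroup (𝓡 3) ∞ 𝒢]
  [TopologicalSpace M] [ChartedSpace (EuclideanSpace ℝ (Fin 1)) M]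
  [TopologicalSpace P] [ChartedSpace (EuclideanSpace ℝ (Fin 4)) P] [IsManifold (𝓡 4) ∞ P]

/-! ### Directional derivatives and equivariance under right translation -/

section DirDeriv

theorem dirDeriv_sub_vec (p : P) (v w : TangentSpace (𝓡 4) p) (f : P → ℝ) :
    dirDeriv p (v - w) f = dirDeriv p v f - dirDeriv p w f :=
  map_sub (mfderiv (𝓡 4) 𝓘(ℝ, ℝ) f p) v w

theorem dirDeriv_smul_vec (p : P) (c : ℝ) (v : TangentSpace (𝓡 4) p) (f : P → ℝ) :
    dirDeriv p (c • v) f = c * dirDeriv p v f :=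
  map_smul (mfderiv (𝓡 4) 𝓘(ℝ, ℝ) f p) c v

theorem dirDeriv_neg_vec (p : P) (v : TangentSpace (𝓡 4) p) (f : P → ℝ) :
    dirDeriv p (-v) f = -dirDeriv p v f :=
  map_neg (mfderiv (𝓡 4) 𝓘(ℝ, ℝ) f p) v

theorem dirDeriv_add {p : P} (v : TangentSpace (𝓡 4) p) {f k : P → ℝ}
    (hf : MDifferentiableAt (𝓡 4) 𝓘(ℝ, ℝ) f p) (hk : MDifferentiableAt (𝓡 4) 𝓘(ℝ, ℝ) k p) :
    dirDeriv p v (fun q => f q + k q) = dirDeriv p v f + dirDeriv p v k :=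
  congrArg (fun L : EuclideanSpace ℝ (Fin 4) →L[ℝ] ℝ => L v)
    (hf.hasMFDerivAt.add hk.hasMFDerivAt).mfderiv

theorem dirDeriv_const_mul {p : P} (v : TangentSpace (𝓡 4) p) {f : P → ℝ} (c : ℝ)
    (hf : MDifferentiableAt (𝓡 4) 𝓘(ℝ, ℝ) f p) :
    dirDeriv p v (fun q => c * f q) = c * dirDeriv p v f :=
  congrArg (fun L : EuclideanSpace ℝ (Fin 4) →L[ℝ] ℝ => L v)
    (hf.hasMFDerivAt.const_smul c).mfderiv

theorem dirDeriv_congr {p : P} (v : TangentSpace (𝓡 4) p) {f k : P → ℝ} (h : f =ᶠ[𝓝 p] k) :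
    dirDeriv p v f = dirDeriv p v k :=
  congrArg (fun L : EuclideanSpace ℝ (Fin 4) →L[ℝ] ℝ => L v) h.mfderiv_eq

theorem dirDeriv_const {p : P} (v : TangentSpace (𝓡 4) p) (c : ℝ) :
    dirDeriv p v (fun _ => c) = 0 :=
  congrArg (fun L : EuclideanSpace ℝ (Fin 4) →L[ℝ] ℝ => L v)
    (mfderiv_const (I := 𝓡 4) (I' := 𝓘(ℝ, ℝ)) (M := P) (M' := ℝ))

end DirDeriv

namespace PrincipalBundle

variable (𝔓 : PrincipalBundle 𝒢 M P)

section Push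

theorem dirDeriv_push {a : 𝒢} {p : P} (v : TangentSpace (𝓡 4) p) {f : P → ℝ}
    (hf : MDifferentiableAt (𝓡 4) 𝓘(ℝ, ℝ) f (𝔓.act p a)) :
    dirDeriv (𝔓.act p a) (𝔓.push a p v) f = dirDeriv p v (fun q => f (𝔓.act q a)) :=
  (mfderiv_comp_apply_of_eq (f := fun q => 𝔓.act q a) hf
    ((𝔓.contMDiff_translate a).contMDiffAt.mdifferentiableAt (by simp)) rfl v).symm

variable {g : Metric P} (hg : 𝔓.InvariantMetric g)
include hg

theorem inner_push (p : P) (a : 𝒢) (v w : TangentSpace (𝓡 4) p) :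
    g.inner (𝔓.act p a) (𝔓.push a p v) (𝔓.push a p w) = g.inner p v w := hg p a v w

theorem fibreMetric_act (p : P) (a : 𝒢) (y z : GroupLieAlgebra (𝓡 3) 𝒢) :
    𝔓.fibreMetric g (𝔓.act p a) y z = 𝔓.fibreMetric g p (adjointRep a y) (adjointRep a z) := by
  rw [fibreMetric, fund_act, fund_act, 𝔓.inner_push hg]
  rfl

theorem inner_push_fund (p : P) (a : 𝒢) (v : TangentSpace (𝓡 4) p) (y : GroupLieAlgebra (𝓡 3) 𝒢) :
    g.inner (𝔓.act p a) (𝔓.push a p v) (𝔓.fund (𝔓.act p a) y) =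
      g.inner p v (𝔓.fund p (adjointRep a y)) := by
  rw [fund_act, 𝔓.inner_push hg]

theorem isFrameAt_push {p : P} {v : TangentSpace (𝓡 4) p}
    {x : Fin 3 → GroupLieAlgebra (𝓡 3) 𝒢} (h : 𝔓.IsFrameAt g p v x) (a : 𝒢) :
    𝔓.IsFrameAt g (𝔓.act p a) (𝔓.push a p v) (fun i => adjointRep a⁻¹ (x i)) where
  unit := by rw [𝔓.inner_push hg, h.unit]
  horizontal y := by rw [𝔓.inner_push_fund hg, h.horizontal]
  orthonormal i j := by
    rw [𝔓.fibreMetric_act hg, adjointRep_inv_apply, adjointRep_inv_apply, h.orthonormal]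

end Push

theorem form_push {H : (p : P) → TangentSpace (𝓡 4) p [⋀^Fin 3]→L[ℝ] ℝ} (hH : 𝔓.InvariantForm H)
    (p : P) (a : 𝒢) (u v w : TangentSpace (𝓡 4) p) :
    H (𝔓.act p a) ![𝔓.push a p u, 𝔓.push a p v, 𝔓.push a p w] = H p ![u, v, w] := hH p a u v w

theorem form_act {H : (p : P) → TangentSpace (𝓡 4) p [⋀^Fin 3]→L[ℝ] ℝ} (hH : 𝔓.InvariantForm H)
    (p : P) (a : 𝒢) (v : TangentSpace (𝓡 4) p) (y z : GroupLieAlgebra (𝓡 3) 𝒢) :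
    H (𝔓.act p a) ![𝔓.push a p v, 𝔓.fund (𝔓.act p a) y, 𝔓.fund (𝔓.act p a) z] =
      H p ![v, 𝔓.fund p (adjointRep a y), 𝔓.fund p (adjointRep a z)] := by
  rw [fund_act, fund_act, 𝔓.form_push hH]

/-! ### Frames, and the three norms in an arbitrary basis -/

section Frame

variable {g : Metric P} {p : P} {v : TangentSpace (𝓡 4) p} {x : Fin 3 → GroupLieAlgebra (𝓡 3) 𝒢}

/-- The horizontal space is spanned by a unit horizontal vector. -/
theorem IsFrameAt.horizontal_eq_smul (h : 𝔓.IsFrameAt g p v x) {w : TangentSpace (𝓡 4) p}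
    (hw : ∀ y, g.inner p w (𝔓.fund p y) = 0) : w = g.inner p w v • v := by
  by_contra hne
  rw [← sub_eq_zero] at hne
  obtain ⟨w', hw'⟩ : ∃ w', w' = w - g.inner p w v • v := ⟨_, rfl⟩
  rw [← hw'] at hne
  have h1 : g.inner p w' v = 0 := by
    rw [hw', map_sub, map_smul, sub_apply, smul_apply, h.unit, smul_eq_mul, mul_one, sub_self]
  have h2 : ∀ y, g.inner p w' (𝔓.fund p y) = 0 := fun y => by
    rw [hw', map_sub, map_smul, sub_apply, smul_apply, hw, h.horizontal, smul_zero, sub_zero]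
  let B : LinearMap.BilinForm ℝ (TangentSpace (𝓡 4) p) :=
    LinearMap.mk₂ ℝ (fun a b => g.inner p a b) (by simp) (by simp) (by simp) (by simp)
  -- If the part `w'` of `w` orthogonal to `v` were nonzero, these would be five orthogonal nonzero
  -- vectors in a space of dimension four.
  let u : Fin 5 → TangentSpace (𝓡 4) p := Fin.cons w' (Fin.cons v fun i => 𝔓.fund p (x i))
  have hB : ∀ a b, B a b = g.inner p a b := fun a b => rfl
  have hsymm : ∀ a b, B a b = B b a := fun a b => g.symm p a b
  have hpos : ∀ i, B (u i) (u i) ≠ 0 := by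
    intro i
    refine Fin.cases ?_ (fun i => Fin.cases ?_ (fun i => ?_) i) i
    · exact (g.pos p w' hne).ne'
    · exact (h.unit.trans_ne one_ne_zero)
    · have := h.orthonormal i i
      rw [if_pos rfl] at this
      exact this.trans_ne one_ne_zero
  have hortho : B.iIsOrtho u := by
    intro i j hij
    change B (u i) (u j) = 0
    have h01 : B (u 0) (u 1) = 0 := h1
    have h0 : ∀ i : Fin 3, B (u 0) (u i.succ.succ) = 0 := fun i => h2 (x i)
    have h10 : ∀ i : Fin 3, B (u 1) (u i.succ.succ) = 0 := fun i => h.horizontal (x i)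
    induction i using Fin.cases with
    | zero =>
      induction j using Fin.cases with
      | zero => exact absurd rfl hij
      | succ j =>
        induction j using Fin.cases with
        | zero => exact h01
        | succ j => exact h0 j
    | succ i =>
      induction j using Fin.cases with
      | zero =>
        rw [hsymm]
        induction i using Fin.cases with
        | zero => exact h01
        | succ i => exact h0 i
      | succ j =>
        induction i using Fin.cases with
        | zero =>
          induction j using Fin.cases with
          | zero => exact absurd rfl hij
          | succ j => exact h10 j
        | succ i =>
          induction j using Fin.cases with
          | zero => rw [hsymm]; exact h10 i
          | succ j =>
            refine (h.orthonormal i j).trans (if_neg fun hh => hij ?_)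
            rw [hh]
  have hli := LinearMap.BilinForm.linearIndependent_of_iIsOrtho hortho fun i hi => hpos i hi
  have hcard := LinearIndependent.fintype_card_le_finrank (R := ℝ)
    (M := EuclideanSpace ℝ (Fin 4)) hli
  simp at hcard

theorem IsFrameAt.eq_or_eq_neg (h : 𝔓.IsFrameAt g p v x) {w : TangentSpace (𝓡 4) p}
    {x' : Fin 3 → GroupLieAlgebra (𝓡 3) 𝒢} (h' : 𝔓.IsFrameAt g p w x') : w = v ∨ w = -v := by
  have h1 := h.horizontal_eq_smul 𝔓 h'.horizontal
  obtain ⟨c, hc⟩ : ∃ c, c = g.inner p w v := ⟨_, rfl⟩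
  rw [← hc] at h1
  have h2 := h'.unit
  rw [h1, map_smul, map_smul, smul_apply, h.unit, smul_eq_mul, smul_eq_mul, mul_one] at h2
  rcases mul_self_eq_one_iff.mp h2 with hc | hc
  · left; rw [h1, hc, one_smul]
  · right; rw [h1, hc, neg_one_smul]

theorem isBilin_form (H : (p : P) → TangentSpace (𝓡 4) p [⋀^Fin 3]→L[ℝ] ℝ)
    (p : P) (v : TangentSpace (𝓡 4) p) :
    IsBilin fun y z => H p ![v, 𝔓.fund p y, 𝔓.fund p z] :=
  isBilin_alternating (H p) (𝔓.fundLin p) v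

/-- The matrix of the form `H(v, ·, ·)` on the fibre. -/
def formMatrix (H : (p : P) → TangentSpace (𝓡 4) p [⋀^Fin 3]→L[ℝ] ℝ)
    (e : Fin 3 → GroupLieAlgebra (𝓡 3) 𝒢) (p : P) (v : TangentSpace (𝓡 4) p) : Mat3 :=
  gramMatrix (fun y z => H p ![v, 𝔓.fund p y, 𝔓.fund p z]) e

theorem formMatrix_skew (H : (p : P) → TangentSpace (𝓡 4) p [⋀^Fin 3]→L[ℝ] ℝ)
    (e : Fin 3 → GroupLieAlgebra (𝓡 3) 𝒢) (p : P) (v : TangentSpace (𝓡 4) p) :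
    (𝔓.formMatrix H e p v).transpose = -𝔓.formMatrix H e p v := by
  ext i j
  exact alternating_swap_right _ _ _ _

theorem isBilin_covG (hd : ∀ y z, MDifferentiable (𝓡 4) 𝓘(ℝ, ℝ) (fun q => 𝔓.fibreMetric g q y z))
    (p : P) (v : TangentSpace (𝓡 4) p) : IsBilin (𝔓.covG g p v) where
  add_left x y z := by
    simp only [covG, (𝔓.isBilin_fibreMetric g _).add_left]
    exact dirDeriv_add v (hd _ _ _) (hd _ _ _)
  smul_left c x z := by
    simp only [covG, (𝔓.isBilin_fibreMetric g _).smul_left]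
    exact dirDeriv_const_mul v c (hd _ _ _)
  add_right x y z := by
    simp only [covG, (𝔓.isBilin_fibreMetric g _).add_right]
    exact dirDeriv_add v (hd _ _ _) (hd _ _ _)
  smul_right c x z := by
    simp only [covG, (𝔓.isBilin_fibreMetric g _).smul_right]
    exact dirDeriv_const_mul v c (hd _ _ _)

theorem covG_symm (g : Metric P) (p : P) (v : TangentSpace (𝓡 4) p)
    (y z : GroupLieAlgebra (𝓡 3) 𝒢) : 𝔓.covG g p v y z = 𝔓.covG g p v z y := by
  simp only [covG, 𝔓.fibreMetric_symm g _ y z]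

theorem gramMatrix_inv_symm (g : Metric P) (p : P) (e : Fin 3 → GroupLieAlgebra (𝓡 3) 𝒢) :
    (gramMatrix (𝔓.fibreMetric g p) e)⁻¹.transpose = (gramMatrix (𝔓.fibreMetric g p) e)⁻¹ := by
  rw [Matrix.transpose_nonsing_inv, gramMatrix_symm]

/-- The square norm of a bilinear form as a trace of matrices. -/
theorem IsFrameAt.sum_sq (h : 𝔓.IsFrameAt g p v x)
    (e : Module.Basis (Fin 3) ℝ (GroupLieAlgebra (𝓡 3) 𝒢))
    {A : GroupLieAlgebra (𝓡 3) 𝒢 → GroupLieAlgebra (𝓡 3) 𝒢 → ℝ} (hA : IsBilin A) :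
    ∑ i, ∑ j, A (x i) (x j) ^ 2 =
      ((gramMatrix (𝔓.fibreMetric g p) e)⁻¹ * gramMatrix A e *
        ((gramMatrix (𝔓.fibreMetric g p) e)⁻¹ * (gramMatrix A e).transpose)).trace := by
  simp only [sq]
  rw [sum_orthonormal_mul_eq (𝔓.isBilin_fibreMetric g p) e h.orthonormal hA hA]
  have hJ := 𝔓.gramMatrix_inv_symm g p e
  obtain ⟨J, hJ'⟩ : ∃ J, J = (gramMatrix (𝔓.fibreMetric g p) e)⁻¹ := ⟨_, rfl⟩
  rw [← hJ'] at hJ ⊢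
  simp only [Matrix.trace, Matrix.diag_apply, Matrix.mul_apply, Finset.sum_mul, Finset.mul_sum,
    Matrix.transpose_apply, gramMatrix_apply]
  refine Finset.sum_congr rfl fun a _ => ?_
  have h3 : ∀ c d, J c d = J d c := fun c d => congrFun₂ hJ d c
  simp only [Fin.sum_univ_three, h3 1 0, h3 2 0, h3 2 1]
  ring

theorem fullFrame_zero (p : P) (v : TangentSpace (𝓡 4) p)
    (x : Fin 3 → GroupLieAlgebra (𝓡 3) 𝒢) : 𝔓.fullFrame p v x 0 = v := rfl

theorem fullFrame_succ (p : P) (v : TangentSpace (𝓡 4) p)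
    (x : Fin 3 → GroupLieAlgebra (𝓡 3) 𝒢) (i : Fin 3) :
    𝔓.fullFrame p v x i.succ = 𝔓.fund p (x i) := rfl

/-- Index pairs are sorted by whether `v` occurs. It can stand in either place, whence the factor 2;
the pair `(v, v)` gives nothing. -/
theorem formSq_eq_sum (H : (p : P) → TangentSpace (𝓡 4) p [⋀^Fin 3]→L[ℝ] ℝ) (p : P)
    (v : TangentSpace (𝓡 4) p) (x : Fin 3 → GroupLieAlgebra (𝓡 3) 𝒢)
    (X Y : TangentSpace (𝓡 4) p) :
    𝔓.formSq H p v x X Y =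
      2 * ∑ i, H p ![v, X, 𝔓.fund p (x i)] * H p ![v, Y, 𝔓.fund p (x i)]
      + ∑ i, ∑ j, H p ![X, 𝔓.fund p (x i), 𝔓.fund p (x j)] *
          H p ![Y, 𝔓.fund p (x i), 𝔓.fund p (x j)] := by
  have h1 : ∀ Z W : TangentSpace (𝓡 4) p, H p ![Z, v, W] = -H p ![v, Z, W] :=
    fun Z W => alternating_swap_left _ _ _ _
  have h2 : ∀ Z W : TangentSpace (𝓡 4) p, H p ![Z, W, v] = H p ![v, Z, W] := fun Z W => by
    rw [alternating_swap_right, alternating_swap_left, neg_neg]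
  have h3 : ∀ Z : TangentSpace (𝓡 4) p, H p ![v, Z, v] = 0 := fun Z => alternating_self_outer _ _ _
  rw [formSq, Fin.sum_univ_succ]
  simp only [Fin.sum_univ_succ (n := 3), fullFrame_zero, fullFrame_succ, h1 X, h1 Y, h2 X, h2 Y,
    Finset.sum_add_distrib]
  rw [h3, h3]
  simp only [mul_neg, neg_mul, neg_neg, mul_zero]
  ring

theorem formSq_frame (H : (p : P) → TangentSpace (𝓡 4) p [⋀^Fin 3]→L[ℝ] ℝ) (p : P)
    (v : TangentSpace (𝓡 4) p) (x : Fin 3 → GroupLieAlgebra (𝓡 3) 𝒢) :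
    𝔓.formSq H p v x v v = ∑ i, ∑ j, H p ![v, 𝔓.fund p (x i), 𝔓.fund p (x j)] ^ 2 := by
  rw [formSq_eq_sum]
  simp [alternating_self_left, sq]

/-- `|DG|² + |i_v H|²` in an arbitrary basis. -/
theorem IsFrameAt.covGNormSq_add_formSq (h : 𝔓.IsFrameAt g p v x)
    (hd : ∀ y z, MDifferentiable (𝓡 4) 𝓘(ℝ, ℝ) (fun q => 𝔓.fibreMetric g q y z))
    (H : (p : P) → TangentSpace (𝓡 4) p [⋀^Fin 3]→L[ℝ] ℝ)
    (e : Module.Basis (Fin 3) ℝ (GroupLieAlgebra (𝓡 3) 𝒢)) :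
    𝔓.covGNormSq g p v x + 𝔓.formSq H p v x v v =
      energyDensity (gramMatrix (𝔓.fibreMetric g p) e)⁻¹ (gramMatrix (𝔓.covG g p v) e)
        (𝔓.formMatrix H e p v) := by
  have hN : (gramMatrix (𝔓.covG g p v) e).transpose = gramMatrix (𝔓.covG g p v) e := by
    ext i j; exact 𝔓.covG_symm g p v _ _
  rw [covGNormSq, h.sum_sq 𝔓 e (𝔓.isBilin_covG hd p v), formSq_frame,
    h.sum_sq 𝔓 e (𝔓.isBilin_form H p v), hN]
  change _ + (_ * 𝔓.formMatrix H e p v * (_ * (𝔓.formMatrix H e p v).transpose)).trace = _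
  rw [formMatrix_skew, energyDensity]
  simp only [Matrix.mul_neg, Matrix.trace_neg]
  ring

/-- `|[,]|²` in a Heisenberg basis. -/
theorem IsFrameAt.bracketNormSq_eq (h : 𝔓.IsFrameAt g p v x)
    {e : Module.Basis (Fin 3) ℝ (GroupLieAlgebra (𝓡 3) 𝒢)} {l : ℝ} (he : IsHeisenberg e l) :
    𝔓.bracketNormSq g p x = 2 * l ^ 2 * gramMatrix (𝔓.fibreMetric g p) e 2 2 ^ 2 /
      (gramMatrix (𝔓.fibreMetric g p) e).det := by
  obtain ⟨X, hX, hu, hJ⟩ := exists_inv_gramMatrix (𝔓.isBilin_fibreMetric g p) e h.orthonormal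
  have hlie : ∀ i j, fibreBracket (x i) (x j) = (-(l * (X 0 i * X 1 j - X 1 i * X 0 j))) • e 2 := by
    intro i j
    rw [fibreBracket, hX i, hX j]
    simp only [Fin.sum_univ_three, add_lie, lie_add, smul_lie, lie_smul, lie_self, he.central,
      he.central', he.lie_zero_one, he.lie_one_zero]
    module
  have hF := 𝔓.isBilin_fibreMetric g p
  rw [Matrix.isUnit_iff_isUnit_det, isUnit_iff_ne_zero] at hu
  have h1 : 𝔓.bracketNormSq g p x = 2 * l ^ 2 * gramMatrix (𝔓.fibreMetric g p) e 2 2 *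
      ((gramMatrix (𝔓.fibreMetric g p) e)⁻¹ 0 0 * (gramMatrix (𝔓.fibreMetric g p) e)⁻¹ 1 1 -
        (gramMatrix (𝔓.fibreMetric g p) e)⁻¹ 0 1 ^ 2) := by
    rw [hJ, bracketNormSq]
    simp only [hlie, hF.smul_left, hF.smul_right, gramMatrix_apply, Matrix.mul_apply,
      Matrix.transpose_apply, Fin.sum_univ_three]
    ring
  rw [h1]
  have hs := fun i j => congrFun₂ (𝔓.gramMatrix_symm g p e) i j
  obtain ⟨Γ, hΓ⟩ : ∃ Γ, Γ = gramMatrix (𝔓.fibreMetric g p) e := ⟨_, rfl⟩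
  rw [← hΓ] at hs hu ⊢
  simp only [Matrix.transpose_apply] at hs
  rw [eq_div_iff hu]
  simp only [Matrix.inv_def, Ring.inverse_eq_inv', Matrix.smul_apply, smul_eq_mul]
  have h2 : ∀ a b c : ℝ, 2 * l ^ 2 * Γ 2 2 * (Γ.det⁻¹ * a * (Γ.det⁻¹ * b) - (Γ.det⁻¹ * c) ^ 2) * Γ.det =
      2 * l ^ 2 * Γ 2 2 * ((a * b - c ^ 2) * Γ.det⁻¹) := by
    intro a b c; field_simp
  -- Jacobi's identity for complementary minors: the upper left 2×2 minor of `Γ⁻¹` equals `Γ₂₂ / det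
  -- Γ`. This produces the second factor `Γ₂₂`.
  have h3 : Γ.adjugate 0 0 * Γ.adjugate 1 1 - Γ.adjugate 0 1 ^ 2 = Γ 2 2 * Γ.det := by
    rw [Matrix.adjugate_fin_three, Matrix.det_fin_three]
    simp [hs 0 1, hs 0 2, hs 1 2]
    ring
  rw [h2, h3, mul_assoc (Γ 2 2), mul_inv_cancel₀ hu]
  ring

/-- `|H^𝔊|²` in an arbitrary basis. -/
theorem IsFrameAt.verticalNormSq_eq (h : 𝔓.IsFrameAt g p v x)
    (H : (p : P) → TangentSpace (𝓡 4) p [⋀^Fin 3]→L[ℝ] ℝ)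
    (e : Module.Basis (Fin 3) ℝ (GroupLieAlgebra (𝓡 3) 𝒢)) :
    𝔓.verticalNormSq H p x =
      6 * H p ![𝔓.fund p (e 0), 𝔓.fund p (e 1), 𝔓.fund p (e 2)] ^ 2 /
        (gramMatrix (𝔓.fibreMetric g p) e).det := by
  obtain ⟨X, hX, hu, hJ⟩ := exists_inv_gramMatrix (𝔓.isBilin_fibreMetric g p) e h.orthonormal
  rw [Matrix.isUnit_iff_isUnit_det, isUnit_iff_ne_zero] at hu
  let f := (H p).toAlternatingMap.compLinearMap (𝔓.fundLin p)
  have h1 : ∀ y z w, H p ![𝔓.fund p y, 𝔓.fund p z, 𝔓.fund p w] = f ![y, z, w] := by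
    intro y z w
    change _ = H p _
    congr 1; ext i; fin_cases i <;> rfl
  have h2 : H p ![𝔓.fund p (x 0), 𝔓.fund p (x 1), 𝔓.fund p (x 2)] =
      H p ![𝔓.fund p (e 0), 𝔓.fund p (e 1), 𝔓.fund p (e 2)] * X.det := by
    rw [h1, h1]
    have h3 := congrArg (fun k => k ![x 0, x 1, x 2]) (f.eq_smul_basis_det e)
    have h4 : (⇑e : Fin 3 → _) = ![e 0, e 1, e 2] := by ext i; fin_cases i <;> rfl
    have h5 : e.det ![x 0, x 1, x 2] = X.det := by
      rw [Module.Basis.det_apply]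
      congr 1
      ext a i
      rw [Module.Basis.toMatrix_apply]
      have h6 : ∀ i, e.repr (x i) a = X a i := by
        intro i
        rw [hX i]
        simp [Finsupp.single_apply]
      fin_cases i
      · exact h6 0
      · exact h6 1
      · exact h6 2
    rw [← h4, ← h5]
    exact h3
  have h3 : 𝔓.verticalNormSq H p x =
      6 * H p ![𝔓.fund p (x 0), 𝔓.fund p (x 1), 𝔓.fund p (x 2)] ^ 2 := by
    have hb := alternating_basis (H p) (𝔓.fund p) x
    obtain ⟨η, hη⟩ : ∃ η, η = H p ![𝔓.fund p (x 0), 𝔓.fund p (x 1), 𝔓.fund p (x 2)] := ⟨_, rfl⟩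
    rw [← hη] at hb ⊢
    rw [verticalNormSq]
    simp only [hb, Fin.sum_univ_three]
    simp [skewMatrix]
    ring
  -- Determinants in `Γ⁻¹ = X Xᵀ`.
  have h4 : X.det ^ 2 = (gramMatrix (𝔓.fibreMetric g p) e).det⁻¹ := by
    rw [← Ring.inverse_eq_inv', ← Matrix.det_nonsing_inv, hJ, Matrix.det_mul, Matrix.det_transpose, sq]
  rw [h3, h2, mul_pow, h4]
  ring

end Frame

end PrincipalBundle

end InvariantFlow

namespace InvariantFlow

/-! ### Local invariant unit horizontal fields -/

section MatrixInverse

variable {E H N : Type*} [NormedAddCommGroup E] [NormedSpace ℝ E] [TopologicalSpace H]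
  {I : ModelWithCorners ℝ E H} [TopologicalSpace N] [ChartedSpace H N]

theorem contMDiffOn_matrix_inv {Γ : N → Mat3} {S : Set N}
    (hΓ : ∀ i j, ContMDiffOn I 𝓘(ℝ, ℝ) ∞ (fun x => Γ x i j) S) (hu : ∀ x ∈ S, IsUnit (Γ x))
    (i j : Fin 3) : ContMDiffOn I 𝓘(ℝ, ℝ) ∞ (fun x => (Γ x)⁻¹ i j) S := by
  have h2 : ∀ a b c d, ContMDiffOn I 𝓘(ℝ, ℝ) ∞ (fun x => Γ x a b * Γ x c d) S :=
    fun a b c d => (hΓ a b).mul (hΓ c d)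
  have hdet : ContMDiffOn I 𝓘(ℝ, ℝ) ∞ (fun x => (Γ x).det) S := by
    simp only [Matrix.det_fin_three]
    exact ((((((h2 0 0 1 1).mul (hΓ 2 2)).sub ((h2 0 0 1 2).mul (hΓ 2 1))).sub
      ((h2 0 1 1 0).mul (hΓ 2 2))).add ((h2 0 1 1 2).mul (hΓ 2 0))).add
      ((h2 0 2 1 0).mul (hΓ 2 1))).sub ((h2 0 2 1 1).mul (hΓ 2 0))
  have hadj : ContMDiffOn I 𝓘(ℝ, ℝ) ∞ (fun x => (Γ x).adjugate i j) S := by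
    have h3 : ∀ a b c d a' b' c' d', ContMDiffOn I 𝓘(ℝ, ℝ) ∞
        (fun x => Γ x a b * Γ x c d - Γ x a' b' * Γ x c' d') S :=
      fun a b c d a' b' c' d' => (h2 a b c d).sub (h2 a' b' c' d')
    have h4 : ∀ a b c d a' b' c' d', ContMDiffOn I 𝓘(ℝ, ℝ) ∞
        (fun x => -(Γ x a b * Γ x c d) + Γ x a' b' * Γ x c' d') S :=
      fun a b c d a' b' c' d' => (h2 a b c d).neg.add (h2 a' b' c' d')
    simp only [Matrix.adjugate_fin_three]
    fin_cases i <;> fin_cases j <;> first | exact h3 _ _ _ _ _ _ _ _ | exact h4 _ _ _ _ _ _ _ _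
  simp only [Matrix.inv_def, Matrix.smul_apply, smul_eq_mul, Ring.inverse_eq_inv']
  refine (hdet.inv₀ fun x hx => ?_).mul hadj
  have := hu x hx
  rw [Matrix.isUnit_iff_isUnit_det, isUnit_iff_ne_zero] at this
  exact this

end MatrixInverse

variable {𝒢 M P : Type*}
  [Group 𝒢] [TopologicalSpace 𝒢] [ChartedSpace (EuclideanSpace ℝ (Fin 3)) 𝒢] [LieGroup (𝓡 3) ∞ 𝒢]
  [TopologicalSpace M] [ChartedSpace (EuclideanSpace ℝ (Fin 1)) M] [IsManifold (𝓡 1) ∞ M]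
  [TopologicalSpace P] [ChartedSpace (EuclideanSpace ℝ (Fin 4)) P] [IsManifold (𝓡 4) ∞ P]

theorem dirDeriv_zero_vec (p : P) (f : P → ℝ) : dirDeriv p 0 f = 0 :=
  map_zero (mfderiv (𝓡 4) 𝓘(ℝ, ℝ) f p)

/-- The inner product of smooth fields is smooth. -/
def SmoothMetric (g : Metric P) : Prop :=
  ∀ U : Set P, IsOpen U → ∀ X Y, SmoothField U X → SmoothField U Y →
    ContMDiffOn (𝓡 4) 𝓘(ℝ, ℝ) ∞ (fun q => g.inner q (X q) (Y q)) U

namespace PrincipalBundle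

variable (𝔓 : PrincipalBundle 𝒢 M P)

/-- A coordinate of the base, as an invariant function on `P` with nonzero derivative. -/
theorem exists_coordinate (p : P) :
    ∃ (U : Set P) (ρ : P → ℝ) (W : TangentSpace (𝓡 4) p), IsOpen U ∧ p ∈ U ∧
      ContMDiffOn (𝓡 4) 𝓘(ℝ, ℝ) ∞ ρ U ∧ (∀ q a, ρ (𝔓.act q a) = ρ q) ∧ dirDeriv p W ρ = 1 := by
  obtain ⟨U, hU, hm, s, κ, hs, hκ, h1, h2, h3⟩ := 𝔓.locally_trivial (𝔓.proj p)
  let x : M → ℝ := fun m => (extChartAt (𝓡 1) (𝔓.proj p) m) 0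
  have hx : ContMDiffOn (𝓡 1) 𝓘(ℝ, ℝ) ∞ x (chartAt (EuclideanSpace ℝ (Fin 1)) (𝔓.proj p)).source :=
    (EuclideanSpace.proj (𝕜 := ℝ) (0 : Fin 1)).contDiff.contMDiff.comp_contMDiffOn
      contMDiffOn_extChartAt
  have hxd : MDifferentiableAt (𝓡 1) 𝓘(ℝ, ℝ) x (𝔓.proj p) :=
    (hx.contMDiffAt (chart_source_mem_nhds _ _)).mdifferentiableAt (by simp)
  -- A local section translated so as to pass through `p`. The coordinate composed with it is the
  -- coordinate of the base, so the derivative along its velocity is 1.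
  let s' : M → P := fun m => 𝔓.act (s m) (κ p)
  have hs'p : s' (𝔓.proj p) = p := h2 p hm
  have hs' : MDifferentiableAt (𝓡 1) (𝓡 4) s' (𝔓.proj p) :=
    (((𝔓.contMDiff_translate (κ p)).comp_contMDiffOn hs).contMDiffAt
      (hU.mem_nhds hm)).mdifferentiableAt (by simp)
  let u : EuclideanSpace ℝ (Fin 1) := EuclideanSpace.single 0 1
  let W : EuclideanSpace ℝ (Fin 4) :=
    (mfderiv (𝓡 1) (𝓡 4) s' (𝔓.proj p) : EuclideanSpace ℝ (Fin 1) →L[ℝ] EuclideanSpace ℝ (Fin 4)) u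
  have hρ : ContMDiffOn (𝓡 4) 𝓘(ℝ, ℝ) ∞ (fun q => x (𝔓.proj q))
      (𝔓.proj ⁻¹' (chartAt (EuclideanSpace ℝ (Fin 1)) (𝔓.proj p)).source) :=
    hx.comp 𝔓.contMDiff_proj.contMDiffOn fun q hq => hq
  have hopen : IsOpen (𝔓.proj ⁻¹' (chartAt (EuclideanSpace ℝ (Fin 1)) (𝔓.proj p)).source) :=
    (chartAt (EuclideanSpace ℝ (Fin 1)) (𝔓.proj p)).open_source.preimage
      𝔓.contMDiff_proj.continuous
  refine ⟨_, fun q => x (𝔓.proj q), W, hopen, mem_chart_source _ (𝔓.proj p), hρ,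
    fun q a => congrArg x (𝔓.proj_act q a), ?_⟩
  have hρd : MDifferentiableAt (𝓡 4) 𝓘(ℝ, ℝ) (fun q => x (𝔓.proj q)) p :=
    (hρ.contMDiffAt (hopen.mem_nhds (mem_chart_source _ (𝔓.proj p)))).mdifferentiableAt (by simp)
  have e1 := mfderiv_comp_apply_of_eq (g := fun q => x (𝔓.proj q)) hρd hs' hs'p u
  have e2 : (fun m => x (𝔓.proj (s' m))) =ᶠ[𝓝 (𝔓.proj p)] x := by
    filter_upwards [hU.mem_nhds hm] with m hm
    simp only [s', 𝔓.proj_act, h1 m hm]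
  have e3 : (mfderiv (𝓡 1) 𝓘(ℝ, ℝ) (fun m => x (𝔓.proj (s' m))) (𝔓.proj p) :
      EuclideanSpace ℝ (Fin 1) →L[ℝ] ℝ) u =
      (mfderiv (𝓡 1) 𝓘(ℝ, ℝ) x (𝔓.proj p) : EuclideanSpace ℝ (Fin 1) →L[ℝ] ℝ) u :=
    congrArg (fun L : EuclideanSpace ℝ (Fin 1) →L[ℝ] ℝ => L u) e2.mfderiv_eq
  have e4 : (mfderiv (𝓡 1) 𝓘(ℝ, ℝ) x (𝔓.proj p) : EuclideanSpace ℝ (Fin 1) →L[ℝ] ℝ) u = 1 := by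
    have h5 := mfderiv_comp_apply_of_eq (E' := EuclideanSpace ℝ (Fin 1))
      (M' := EuclideanSpace ℝ (Fin 1)) (f := extChartAt (𝓡 1) (𝔓.proj p)) (x := 𝔓.proj p)
      (g := fun w : EuclideanSpace ℝ (Fin 1) => w 0) (M'' := ℝ) (E'' := ℝ)
      (EuclideanSpace.proj (𝕜 := ℝ) (0 : Fin 1)).differentiableAt.mdifferentiableAt
      (mdifferentiableAt_extChartAt (mem_chart_source _ _)) rfl u
    refine h5.trans ?_
    have h6 : (mfderiv (𝓡 1) 𝓘(ℝ, EuclideanSpace ℝ (Fin 1)) (extChartAt (𝓡 1) (𝔓.proj p)) (𝔓.proj p) :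
        EuclideanSpace ℝ (Fin 1) →L[ℝ] EuclideanSpace ℝ (Fin 1)) = ContinuousLinearMap.id ℝ _ :=
      mfderiv_extChartAt_self
    rw [h6, mfderiv_eq_fderiv]
    have h7 := (EuclideanSpace.proj (𝕜 := ℝ) (0 : Fin 1)).fderiv
      (x := extChartAt (𝓡 1) (𝔓.proj p) (𝔓.proj p))
    refine (congrArg (fun L : EuclideanSpace ℝ (Fin 1) →L[ℝ] ℝ => L u) h7).trans ?_
    simp [u]
    rfl
  exact e1.symm.trans (e3.trans e4)

variable {g : Metric P}

theorem contMDiffOn_fibreMetric (hsm : SmoothMetric g) (y z : GroupLieAlgebra (𝓡 3) 𝒢) :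
    ContMDiffOn (𝓡 4) 𝓘(ℝ, ℝ) ∞ (fun q => 𝔓.fibreMetric g q y z) univ :=
  hsm univ isOpen_univ _ _ (𝔓.smoothField_fund y) (𝔓.smoothField_fund z)

theorem mdifferentiable_fibreMetric (hsm : SmoothMetric g) (y z : GroupLieAlgebra (𝓡 3) 𝒢) :
    MDifferentiable (𝓡 4) 𝓘(ℝ, ℝ) (fun q => 𝔓.fibreMetric g q y z) := fun q =>
  ((𝔓.contMDiffOn_fibreMetric hsm y z).contMDiffAt Filter.univ_mem).mdifferentiableAt (by simp)

theorem contMDiffOn_connCoeff (hsm : SmoothMetric g)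
    (e : Module.Basis (Fin 3) ℝ (GroupLieAlgebra (𝓡 3) 𝒢)) {U : Set P} (hU : IsOpen U)
    {Z : (q : P) → TangentSpace (𝓡 4) q} (hZ : SmoothField U Z) (i : Fin 3) :
    ContMDiffOn (𝓡 4) 𝓘(ℝ, ℝ) ∞ (fun q => 𝔓.connCoeff g q e (Z q) i) U := by
  have hJ := contMDiffOn_matrix_inv (S := U) (Γ := fun q => gramMatrix (𝔓.fibreMetric g q) e)
    (fun i j => (𝔓.contMDiffOn_fibreMetric hsm (e i) (e j)).mono (subset_univ _))
    fun q _ => 𝔓.isUnit_gramMatrix g q e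
  have hm : ∀ j, ContMDiffOn (𝓡 4) 𝓘(ℝ, ℝ) ∞ (fun q => g.inner q (Z q) (𝔓.fund q (e j))) U :=
    fun j => hsm U hU _ _ hZ ((𝔓.smoothField_fund (e j)).mono (subset_univ _))
  simp only [connCoeff, Matrix.mulVec, dotProduct, Fin.sum_univ_three]
  exact (((hJ i 0).mul (hm 0)).add ((hJ i 1).mul (hm 1))).add ((hJ i 2).mul (hm 2))

/-- Around every point there is an invariant smooth unit horizontal vector field. -/
theorem exists_unit_horizontal (hg : 𝔓.InvariantMetric g) (hsm : SmoothMetric g)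
    {e : Module.Basis (Fin 3) ℝ (GroupLieAlgebra (𝓡 3) 𝒢)} {c : ℝ} (he : IsHeisenberg e c) (p : P) :
    ∃ (U : Set P) (V : (q : P) → TangentSpace (𝓡 4) q), IsOpen U ∧ p ∈ U ∧ SmoothField U V ∧
      (∀ q ∈ U, g.inner q (V q) (V q) = 1) ∧
      (∀ q ∈ U, ∀ y, g.inner q (V q) (𝔓.fund q y) = 0) ∧
      ∀ q ∈ U, ∀ a, 𝔓.act q a ∈ U → V (𝔓.act q a) = 𝔓.push a q (V q) := by
  obtain ⟨U₁, ρ, W, hU₁, hp₁, hρ, hρinv, hρW⟩ := 𝔓.exists_coordinate p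
  obtain ⟨S, hS, hZS⟩ := FiberBundle.exists_contMDiffOn_extend (I := 𝓡 4) (k := ∞)
    (F := EuclideanSpace ℝ (Fin 4)) (V := fun q : P => TangentSpace (𝓡 4) q) W
  obtain ⟨U₂, hU₂S, hU₂, hp₂⟩ := mem_nhds_iff.mp hS
  obtain ⟨Z, hZ'⟩ : ∃ Z : (q : P) → TangentSpace (𝓡 4) q,
      Z = FiberBundle.extend (EuclideanSpace ℝ (Fin 4)) W := ⟨_, rfl⟩
  have hZp : Z p = W := by rw [hZ']; simp
  have hZ : SmoothField (U₁ ∩ U₂) Z := by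
    rw [hZ']; exact hZS.mono fun q hq => hU₂S hq.2
  have hU₁₂ := hU₁.inter hU₂
  have hdρ : ContMDiffOn (𝓡 4) 𝓘(ℝ, ℝ) ∞ (fun q => dirDeriv q (Z q) ρ) (U₁ ∩ U₂) :=
    contMDiffOn_dirDeriv_of_smooth hU₁₂ hZ (hρ.mono inter_subset_left)
  have hopen := hdρ.continuousOn.isOpen_inter_preimage hU₁₂ (isOpen_Ioi (a := (0 : ℝ)))
  -- Positivity of the derivative of `ρ` makes the extension `Z` transverse to the fibres and fixes
  -- an orientation of the horizontal line. `Z` is an arbitrary extension, so `U` need not be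
  -- invariant under the group.
  obtain ⟨U, hUdef⟩ : ∃ U, U = U₁ ∩ U₂ ∩ (fun q => dirDeriv q (Z q) ρ) ⁻¹' Ioi 0 := ⟨_, rfl⟩
  rw [← hUdef] at hopen
  have hU1 : U ⊆ U₁ := by rw [hUdef]; exact fun q hq => hq.1.1
  have hU12 : U ⊆ U₁ ∩ U₂ := by rw [hUdef]; exact fun q hq => hq.1
  have hpos : ∀ q ∈ U, 0 < dirDeriv q (Z q) ρ := by rw [hUdef]; exact fun q hq => hq.2
  have hpU : p ∈ U := by
    rw [hUdef]
    refine ⟨⟨hp₁, hp₂⟩, ?_⟩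
    change 0 < dirDeriv p (Z p) ρ
    rw [hZp, hρW]; exact one_pos
  have hρd : ∀ q ∈ U, MDifferentiableAt (𝓡 4) 𝓘(ℝ, ℝ) ρ q := fun q hq =>
    (hρ.contMDiffAt (hU₁.mem_nhds (hU1 hq))).mdifferentiableAt (by simp)
  have hρfund : ∀ q ∈ U, ∀ y, dirDeriv q (𝔓.fund q y) ρ = 0 := by
    intro q hq y
    rw [𝔓.dirDeriv_fund y (hρd q hq)]
    refine (mfderiv_apply_congr (E := EuclideanSpace ℝ (Fin 3)) (E' := ℝ) (M' := ℝ)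
      (funext fun a => hρinv q a) (1 : 𝒢) y).trans ?_
    exact congrArg (fun L : EuclideanSpace ℝ (Fin 3) →L[ℝ] ℝ => L y)
      (mfderiv_const (I := 𝓡 3) (I' := 𝓘(ℝ, ℝ)) (M := 𝒢) (M' := ℝ))
  obtain ⟨Y, hY⟩ : ∃ Y : (q : P) → TangentSpace (𝓡 4) q, Y = fun q =>
      Z q - 𝔓.fund q (∑ i, 𝔓.connCoeff g q e (Z q) i • e i) := ⟨_, rfl⟩
  have hYs : SmoothField U Y := by
    have h0 : ∀ i, SmoothField U (fun q => 𝔓.connCoeff g q e (Z q) i • 𝔓.fund q (e i)) := fun i =>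
      ((𝔓.contMDiffOn_connCoeff hsm e hU₁₂ hZ i).mono hU12).smul_section
        ((𝔓.smoothField_fund (e i)).mono (subset_univ _))
    have h1 : Y = fun q => Z q - (𝔓.connCoeff g q e (Z q) 0 • 𝔓.fund q (e 0) +
        𝔓.connCoeff g q e (Z q) 1 • 𝔓.fund q (e 1) +
        𝔓.connCoeff g q e (Z q) 2 • 𝔓.fund q (e 2)) := by
      rw [hY]
      ext1 q
      rw [Fin.sum_univ_three, 𝔓.fund_add, 𝔓.fund_add, 𝔓.fund_smul, 𝔓.fund_smul, 𝔓.fund_smul]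
    rw [h1]
    exact ContMDiffOn.sub_section (hZ.mono hU12)
      (ContMDiffOn.add_section (ContMDiffOn.add_section (h0 0) (h0 1)) (h0 2))
  have hYh : ∀ q, ∀ y, g.inner q (Y q) (𝔓.fund q y) = 0 := by
    rw [hY]; exact fun q y => 𝔓.connCoeff_spec g q e (Z q) y
  have hYρ : ∀ q ∈ U, 0 < dirDeriv q (Y q) ρ := by
    intro q hq
    rw [hY, dirDeriv_sub_vec, hρfund q hq, sub_zero]
    exact hpos q hq
  have hY0 : ∀ q ∈ U, 0 < g.inner q (Y q) (Y q) := by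
    intro q hq
    refine g.pos q _ fun h0 => ?_
    have := hYρ q hq
    rw [h0, dirDeriv_zero_vec] at this
    exact lt_irrefl _ this
  obtain ⟨r, hr⟩ : ∃ r : P → ℝ, r = fun q => (Real.sqrt (g.inner q (Y q) (Y q)))⁻¹ := ⟨_, rfl⟩
  have hrs : ContMDiffOn (𝓡 4) 𝓘(ℝ, ℝ) ∞ r U := by
    intro q hq
    have h1 := hsm U hopen Y Y hYs hYs q hq
    have h2 : ContDiffAt ℝ ∞ (fun t : ℝ => (Real.sqrt t)⁻¹) (g.inner q (Y q) (Y q)) :=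
      (Real.contDiffAt_sqrt (hY0 q hq).ne').inv (Real.sqrt_pos.mpr (hY0 q hq)).ne'
    rw [hr]
    exact ContMDiffAt.comp_contMDiffWithinAt (f := fun q => g.inner q (Y q) (Y q))
      (g := fun t : ℝ => (Real.sqrt t)⁻¹) q h2.contMDiffAt h1
  have hrpos : ∀ q ∈ U, 0 < r q := fun q hq => by
    rw [hr]; exact inv_pos.mpr (Real.sqrt_pos.mpr (hY0 q hq))
  have hrsq : ∀ q ∈ U, r q * (r q * g.inner q (Y q) (Y q)) = 1 := fun q hq => by
    have h1 := Real.mul_self_sqrt (hY0 q hq).le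
    have h2 := (Real.sqrt_pos.mpr (hY0 q hq)).ne'
    rw [hr]
    field_simp
    rw [sq]; exact h1.symm
  have hVs : SmoothField U (fun q => r q • Y q) := ContMDiffOn.smul_section hrs hYs
  have hV1 : ∀ q ∈ U, g.inner q (r q • Y q) (r q • Y q) = 1 := fun q hq => by
    rw [map_smul, map_smul, smul_apply, smul_eq_mul, smul_eq_mul, hrsq q hq]
  have hV0 : ∀ q, ∀ y, g.inner q (r q • Y q) (𝔓.fund q y) = 0 := fun q y => by
    rw [map_smul, smul_apply, hYh, smul_zero]
  refine ⟨U, fun q => r q • Y q, hopen, hpU, hVs, hV1, fun q _ => hV0 q, ?_⟩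
  intro q hq a hqa
  obtain ⟨x, l, -, hx⟩ := 𝔓.exists_orthonormal g q he
  have hf : 𝔓.IsFrameAt g q (r q • Y q) x := ⟨hV1 q hq, hV0 q, hx⟩
  have hf1 := 𝔓.isFrameAt_push hg hf a
  obtain ⟨x', l', -, hx'⟩ := 𝔓.exists_orthonormal g (𝔓.act q a) he
  have hf2 : 𝔓.IsFrameAt g (𝔓.act q a) (r (𝔓.act q a) • Y (𝔓.act q a)) x' :=
    ⟨hV1 _ hqa, hV0 _, hx'⟩
  -- Unit horizontal vectors are unique up to sign. The wrong sign is excluded because `ρ` is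
  -- invariant and increases along the field at both points, so no invariance of `Z` is needed.
  rcases hf1.eq_or_eq_neg 𝔓 hf2 with h | h
  · exact h
  · exfalso
    have h1 : 0 < dirDeriv (𝔓.act q a) (r (𝔓.act q a) • Y (𝔓.act q a)) ρ := by
      rw [dirDeriv_smul_vec]
      exact mul_pos (hrpos _ hqa) (hYρ _ hqa)
    rw [h, dirDeriv_neg_vec, 𝔓.dirDeriv_push _ (hρd _ hqa)] at h1
    simp only [hρinv] at h1
    rw [dirDeriv_smul_vec] at h1
    have h2 := mul_pos (hrpos q hq) (hYρ q hq)
    linarith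

end PrincipalBundle

end InvariantFlow

namespace InvariantFlow

/-! ### The right-hand side of the fibre metric equation in a Heisenberg basis -/

theorem IsHeisenberg.lie_eq {L : Type*} [LieRing L] [LieAlgebra ℝ L] {e : Fin 3 → L} {l : ℝ}
    (h : IsHeisenberg e l) (i j : Fin 3) :
    ⁅e i, e j⁆ = (l * (!![0, 1, 0; -1, 0, 0; 0, 0, 0] : Mat3) i j) • e 2 := by
  have h1 := h.lie_zero_one
  have h2 := h.lie_one_zero
  fin_cases i <;> fin_cases j <;> simp [h1, h2, h.central, h.central']

/-- A bilinear function precomposed with brackets. -/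
theorem IsBilin.lie_lie {L : Type*} [LieRing L] [LieAlgebra ℝ L] {F : L → L → ℝ} (hF : IsBilin F)
    (y z : L) : IsBilin fun u w : L => F ⁅u, y⁆ ⁅w, z⁆ where
  add_left a b c := by simp only [add_lie, hF.add_left]
  smul_left r a b := by simp only [smul_lie, hF.smul_left]
  add_right a b c := by simp only [add_lie, hF.add_right]
  smul_right r a b := by simp only [smul_lie, hF.smul_right]

theorem IsBilin.lie_left {L : Type*} [LieRing L] [LieAlgebra ℝ L] {F : L → L → ℝ} (hF : IsBilin F)
    (z : L) : IsBilin fun u w : L => F ⁅u, w⁆ z where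
  add_left a b c := by simp only [add_lie, hF.add_left]
  smul_left r a b := by simp only [smul_lie, hF.smul_left]
  add_right a b c := by simp only [lie_add, hF.add_left]
  smul_right r a b := by simp only [lie_smul, hF.smul_left]

theorem IsBilin.mul_left_left {L : Type*} [AddCommGroup L] [Module ℝ L] {A C : L → L → ℝ}
    (hA : IsBilin A) (hC : IsBilin C) (y z : L) : IsBilin fun u w => A u y * C w z where
  add_left a b c := by simp only [hA.add_left, add_mul]
  smul_left r a b := by simp only [hA.smul_left, mul_assoc]
  add_right a b c := by simp only [hC.add_left, mul_add]
  smul_right r a b := by simp only [hC.smul_left]; ring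

theorem IsBilin.mul_right_right {L : Type*} [AddCommGroup L] [Module ℝ L] {A C : L → L → ℝ}
    (hA : IsBilin A) (hC : IsBilin C) (y z : L) : IsBilin fun u w => A y u * C z w where
  add_left a b c := by simp only [hA.add_right, add_mul]
  smul_left r a b := by simp only [hA.smul_right, mul_assoc]
  add_right a b c := by simp only [hC.add_right, mul_add]
  smul_right r a b := by simp only [hC.smul_right]; ring

theorem IsBilin.mul_right_left {L : Type*} [AddCommGroup L] [Module ℝ L] {A C : L → L → ℝ}
    (hA : IsBilin A) (hC : IsBilin C) (y z : L) : IsBilin fun u w => A y u * C w z where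
  add_left a b c := by simp only [hA.add_right, add_mul]
  smul_left r a b := by simp only [hA.smul_right, mul_assoc]
  add_right a b c := by simp only [hC.add_left, mul_add]
  smul_right r a b := by simp only [hC.smul_left]; ring

theorem IsBilin.zero_left {L : Type*} [AddCommGroup L] [Module ℝ L] {A : L → L → ℝ}
    (hA : IsBilin A) (z : L) : A 0 z = 0 := by
  have := hA.smul_left 0 0 z
  rwa [zero_smul, zero_mul] at this

theorem IsBilin.zero_right {L : Type*} [AddCommGroup L] [Module ℝ L] {A : L → L → ℝ}
    (hA : IsBilin A) (z : L) : A z 0 = 0 := by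
  have := hA.smul_right 0 z 0
  rwa [zero_smul, zero_mul] at this

variable {𝒢 M P : Type*}
  [Group 𝒢] [TopologicalSpace 𝒢] [ChartedSpace (EuclideanSpace ℝ (Fin 3)) 𝒢] [LieGroup (𝓡 3) ∞ 𝒢]
  [TopologicalSpace M] [ChartedSpace (EuclideanSpace ℝ (Fin 1)) M] [IsManifold (𝓡 1) ∞ M]
  [TopologicalSpace P] [ChartedSpace (EuclideanSpace ℝ (Fin 4)) P] [IsManifold (𝓡 4) ∞ P]

namespace PrincipalBundle

variable (𝔓 : PrincipalBundle 𝒢 M P) {g : Metric P} {p : P} {v : TangentSpace (𝓡 4) p}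
  {x : Fin 3 → GroupLieAlgebra (𝓡 3) 𝒢} {H : (p : P) → TangentSpace (𝓡 4) p [⋀^Fin 3]→L[ℝ] ℝ}

/-- The component of `H` on the fibre. -/
def formCoeff (H : (p : P) → TangentSpace (𝓡 4) p [⋀^Fin 3]→L[ℝ] ℝ)
    (e : Fin 3 → GroupLieAlgebra (𝓡 3) 𝒢) (p : P) : ℝ :=
  H p ![𝔓.fund p (e 0), 𝔓.fund p (e 1), 𝔓.fund p (e 2)]

theorem form_fund_basis (e : Fin 3 → GroupLieAlgebra (𝓡 3) 𝒢) (p : P) (i j k : Fin 3) :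
    H p ![𝔓.fund p (e i), 𝔓.fund p (e j), 𝔓.fund p (e k)] =
      (𝔓.formCoeff H e p • skewMatrix (Pi.single i 1)) j k :=
  alternating_basis (H p) (𝔓.fund p) e i j k

/-- The right-hand side of the equation for the fibre metric, in a Heisenberg basis. -/
theorem IsFrameAt.metricFlow_eq (h : 𝔓.IsFrameAt g p v x) (hsm : SmoothMetric g)
    {e : Module.Basis (Fin 3) ℝ (GroupLieAlgebra (𝓡 3) 𝒢)} {l : ℝ} (he : IsHeisenberg e l)
    (A : Mat3) (i j : Fin 3) :
    A i j - (∑ k, 𝔓.covG g p v (e i) (x k) * 𝔓.covG g p v (x k) (e j))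
      + (∑ k, 𝔓.fibreMetric g p (fibreBracket (x k) (e i)) (fibreBracket (x k) (e j)))
      - (1 / 2) * (∑ k, ∑ m, 𝔓.fibreMetric g p (fibreBracket (x k) (x m)) (e i) *
          𝔓.fibreMetric g p (fibreBracket (x k) (x m)) (e j))
      + (1 / 2) * 𝔓.formSq H p v x (𝔓.fund p (e i)) (𝔓.fund p (e j)) =
    metricFlow l (𝔓.formCoeff H e p) (gramMatrix (𝔓.fibreMetric g p) e)
      (gramMatrix (𝔓.covG g p v) e) A (𝔓.formMatrix H e p v) i j := by
  have hF := 𝔓.isBilin_fibreMetric g p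
  have hD := 𝔓.isBilin_covG (𝔓.mdifferentiable_fibreMetric hsm) p v
  have hneg : ∀ a b : GroupLieAlgebra (𝓡 3) 𝒢, fibreBracket a b = (-1 : ℝ) • ⁅a, b⁆ := fun a b => by
    rw [fibreBracket, neg_one_smul]
  simp only [hneg, hF.smul_left, hF.smul_right]
  have e1 := sum_orthonormal_eq hF e h.orthonormal (hD.mul_right_left hD (e i) (e j))
  have e2 := sum_orthonormal_eq hF e h.orthonormal (hF.lie_lie (e i) (e j))
  have e3 := sum_orthonormal_mul_eq hF e h.orthonormal (hF.lie_left (e i)) (hF.lie_left (e j))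
  have hK := 𝔓.isBilin_form H p v
  have e4 := sum_orthonormal_eq hF e h.orthonormal (hK.mul_right_right hK (e i) (e j))
  have e5 := sum_orthonormal_mul_eq hF e h.orthonormal
    (𝔓.isBilin_form H p (𝔓.fund p (e i))) (𝔓.isBilin_form H p (𝔓.fund p (e j)))
  rw [formSq_eq_sum, e1, e4, e5]
  have e2' : ∑ k, -1 * (-1 * 𝔓.fibreMetric g p ⁅x k, e i⁆ ⁅x k, e j⁆) =
      ∑ k, 𝔓.fibreMetric g p ⁅x k, e i⁆ ⁅x k, e j⁆ :=
    Finset.sum_congr rfl fun k _ => by ring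
  have e3' : ∑ k, ∑ m, -1 * 𝔓.fibreMetric g p ⁅x k, x m⁆ (e i) *
        (-1 * 𝔓.fibreMetric g p ⁅x k, x m⁆ (e j)) =
      ∑ k, ∑ m, 𝔓.fibreMetric g p ⁅x k, x m⁆ (e i) * 𝔓.fibreMetric g p ⁅x k, x m⁆ (e j) :=
    Finset.sum_congr rfl fun k _ => Finset.sum_congr rfl fun m _ => by ring
  rw [e2', e3', e2, e3]
  have hskew := fun a b => congrFun₂ (𝔓.formMatrix_skew H e p v) a b
  have hKm : ∀ a b, H p ![v, 𝔓.fund p (e a), 𝔓.fund p (e b)] = 𝔓.formMatrix H e p v a b :=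
    fun a b => rfl
  have hΓ : ∀ a b, 𝔓.fibreMetric g p (e a) (e b) = gramMatrix (𝔓.fibreMetric g p) e a b :=
    fun a b => rfl
  have hN : ∀ a b, 𝔓.covG g p v (e a) (e b) = gramMatrix (𝔓.covG g p v) e a b := fun a b => rfl
  have hJs := 𝔓.gramMatrix_inv_symm g p e
  simp only [he.lie_eq, hF.smul_left, hF.smul_right, form_fund_basis, hKm, hΓ, hN]
  obtain ⟨J, hJ⟩ : ∃ J, J = (gramMatrix (𝔓.fibreMetric g p) e)⁻¹ := ⟨_, rfl⟩
  obtain ⟨Γ, hΓ'⟩ : ∃ Γ, Γ = gramMatrix (𝔓.fibreMetric g p) e := ⟨_, rfl⟩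
  obtain ⟨N, hN'⟩ : ∃ N, N = gramMatrix (𝔓.covG g p v) e := ⟨_, rfl⟩
  obtain ⟨K, hK'⟩ : ∃ K, K = 𝔓.formMatrix H e p v := ⟨_, rfl⟩
  obtain ⟨η, hη⟩ : ∃ η, η = 𝔓.formCoeff H e p := ⟨_, rfl⟩
  rw [metricFlow, ← hJ, ← hN', ← hη]
  simp only [← hΓ', ← hK'] at hskew ⊢
  rw [← hJ] at hJs
  clear hJ hΓ' hN' hK' hη e1 e2 e3 e4 e5 e2' e3' hN hΓ hKm hneg
  have hKs : ∀ a b, K a b = -K b a := fun a b => hskew b a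
  -- The sign comes from the skewness of `K`; it is why `metricFlow` contains `-K Γ⁻¹ K` although
  -- the term is a sum of squares on the diagonal.
  have h1 : (K * J * K) i j = -∑ a, ∑ b, J a b * (K i a * K j b) := by
    simp only [hKs j, Matrix.mul_apply, Fin.sum_univ_three]
    ring
  have h2 : (N * J * N) i j = ∑ a, ∑ b, J a b * (N i a * N b j) := by
    simp only [Matrix.mul_apply, Fin.sum_univ_three]
    ring
  have hJs' : ∀ a b, J a b = J b a := fun a b => congrFun₂ hJs b a
  simp only [Matrix.sub_apply, Matrix.add_apply, h1, h2]
  have h3 : bracketMatrix l Γ J i j =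
      ∑ a, ∑ b, J a b * (l * (!![0, 1, 0; -1, 0, 0; 0, 0, 0] : Mat3) a i *
        (l * (!![0, 1, 0; -1, 0, 0; 0, 0, 0] : Mat3) b j * Γ 2 2))
      - 1 / 2 * ∑ a, ∑ b, ∑ c, ∑ d, J a b * J c d *
        (l * (!![0, 1, 0; -1, 0, 0; 0, 0, 0] : Mat3) a c * Γ 2 i *
          (l * (!![0, 1, 0; -1, 0, 0; 0, 0, 0] : Mat3) b d * Γ 2 j)) := by
    have s1 := hJs' 1 0
    have s2 := hJs' 2 0
    have s3 := hJs' 2 1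
    fin_cases i <;> fin_cases j <;> simp [bracketMatrix, Fin.sum_univ_three, s1, s2, s3] <;> ring
  -- Contracting two volume forms in two slots with `J` gives the cofactors of `J`, each counted
  -- twice.
  have h4 : (η ^ 2 • J.adjugate.transpose) i j = 1 / 2 * ∑ a, ∑ b, ∑ c, ∑ d, J a b * J c d *
      ((η • skewMatrix (Pi.single i 1)) a c * (η • skewMatrix (Pi.single j 1)) b d) := by
    have s1 := hJs' 1 0
    have s2 := hJs' 2 0
    have s3 := hJs' 2 1
    fin_cases i <;> fin_cases j <;>
      simp [Matrix.adjugate_fin_three, skewMatrix, Fin.sum_univ_three, s1, s2, s3] <;> ring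
  rw [h3, h4]
  ring

end PrincipalBundle

end InvariantFlow

namespace InvariantFlow

/-! ### Derivatives along a unit field, and the consequence of closedness -/

section Fields

variable {P : Type*} [TopologicalSpace P] [ChartedSpace (EuclideanSpace ℝ (Fin 4)) P]
  [IsManifold (𝓡 4) ∞ P]

/-- The values of the form on smooth fields are smooth. -/
def SmoothForm (H : (p : P) → TangentSpace (𝓡 4) p [⋀^Fin 3]→L[ℝ] ℝ) : Prop :=
  ∀ U : Set P, IsOpen U → ∀ X Y Z, SmoothField U X → SmoothField U Y → SmoothField U Z →
    ContMDiffOn (𝓡 4) 𝓘(ℝ, ℝ) ∞ (fun q => H q ![X q, Y q, Z q]) U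

/-- The exterior derivative of the form vanishes. -/
def ClosedForm (H : (p : P) → TangentSpace (𝓡 4) p [⋀^Fin 3]→L[ℝ] ℝ) : Prop :=
  ∀ U : Set P, IsOpen U → ∀ X Y Z W, SmoothField U X → SmoothField U Y → SmoothField U Z →
    SmoothField U W → ∀ p ∈ U, extDerivThree H X Y Z W p = 0

/-- The entrywise derivative of a matrix along a vector field. -/
def fieldDeriv (V : (p : P) → TangentSpace (𝓡 4) p) (F : P → Mat3) (q : P) : Mat3 :=
  Matrix.of fun i j => dirDeriv q (V q) (fun q' => F q' i j)

/-- A matrix with smooth entries. -/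
def SmoothMatrix (F : P → Mat3) (U : Set P) : Prop :=
  ∀ i j, ContMDiffOn (𝓡 4) 𝓘(ℝ, ℝ) ∞ (fun q => F q i j) U

theorem SmoothMatrix.fieldDeriv {F : P → Mat3} {U : Set P} (hU : IsOpen U)
    {V : (p : P) → TangentSpace (𝓡 4) p} (hV : SmoothField U V) (hF : SmoothMatrix F U) :
    SmoothMatrix (fieldDeriv V F) U := fun i j => contMDiffOn_dirDeriv_of_smooth hU hV (hF i j)

theorem mdifferentiableAt_of_smoothOn {f : P → ℝ} {U : Set P} (hU : IsOpen U)
    (hf : ContMDiffOn (𝓡 4) 𝓘(ℝ, ℝ) ∞ f U) {q : P} (hq : q ∈ U) :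
    MDifferentiableAt (𝓡 4) 𝓘(ℝ, ℝ) f q :=
  (hf.contMDiffAt (hU.mem_nhds hq)).mdifferentiableAt (by simp)

theorem IsBilin.dirDeriv {L : Type*} [AddCommGroup L] [Module ℝ L] {F : P → L → L → ℝ}
    (hF : ∀ q, IsBilin (F q)) {q : P} (v : TangentSpace (𝓡 4) q)
    (hd : ∀ y z, MDifferentiableAt (𝓡 4) 𝓘(ℝ, ℝ) (fun q' => F q' y z) q) :
    IsBilin fun y z => InvariantFlow.dirDeriv q v (fun q' => F q' y z) where
  add_left x y z := by
    simp only [(hF _).add_left]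
    exact dirDeriv_add v (hd _ _) (hd _ _)
  smul_left c x z := by
    simp only [(hF _).smul_left]
    exact dirDeriv_const_mul v c (hd _ _)
  add_right x y z := by
    simp only [(hF _).add_right]
    exact dirDeriv_add v (hd _ _) (hd _ _)
  smul_right c x z := by
    simp only [(hF _).smul_right]
    exact dirDeriv_const_mul v c (hd _ _)

/-- The derivative of a function along an integral curve. -/
theorem hasDerivAt_integralCurve {f : P → ℝ} {V : (p : P) → TangentSpace (𝓡 4) p} {γ : ℝ → P}
    {r : ℝ} (hf : MDifferentiableAt (𝓡 4) 𝓘(ℝ, ℝ) f (γ r)) (hγ : IsMIntegralCurveAt γ V r) :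
    HasDerivAt (fun s => f (γ s)) (dirDeriv (γ r) (V (γ r)) f) r := by
  have h1 := HasMFDerivAt.comp r hf.hasMFDerivAt hγ.self_of_nhds
  let L : EuclideanSpace ℝ (Fin 4) →L[ℝ] ℝ := mfderiv (𝓡 4) 𝓘(ℝ, ℝ) f (γ r)
  let w : EuclideanSpace ℝ (Fin 4) := V (γ r)
  have h2 : HasFDerivAt (fun s => f (γ s)) (L.comp ((1 : ℝ →L[ℝ] ℝ).smulRight w)) r :=
    HasMFDerivAt.hasFDerivAt h1
  refine h2.hasDerivAt.congr_deriv ?_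
  change L ((1 : ℝ) • w) = _
  rw [one_smul]
  rfl

theorem eventually_hasDerivAt_integralCurve {f : P → ℝ} {U : Set P} (hU : IsOpen U)
    {V : (p : P) → TangentSpace (𝓡 4) p} (hf : ContMDiffOn (𝓡 4) 𝓘(ℝ, ℝ) ∞ f U) {γ : ℝ → P}
    (hγ : IsMIntegralCurveAt γ V 0) (h0 : γ 0 ∈ U) :
    ∀ᶠ r in 𝓝 (0 : ℝ), HasDerivAt (fun s => f (γ s)) (dirDeriv (γ r) (V (γ r)) f) r := by
  filter_upwards [eventually_eventually_nhds.mpr hγ,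
    hγ.self_of_nhds.continuousAt.eventually_mem (hU.mem_nhds h0)] with r hr hrU
  exact hasDerivAt_integralCurve (mdifferentiableAt_of_smoothOn hU hf hrU) hr

theorem SmoothMatrix.eventually_hasMatrixDerivAt {F : P → Mat3} {U : Set P} (hU : IsOpen U)
    {V : (p : P) → TangentSpace (𝓡 4) p} (hF : SmoothMatrix F U) {γ : ℝ → P}
    (hγ : IsMIntegralCurveAt γ V 0) (h0 : γ 0 ∈ U) :
    ∀ᶠ r in 𝓝 (0 : ℝ), HasMatrixDerivAt (fun s => F (γ s))
      (InvariantFlow.fieldDeriv V F (γ r)) r := by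
  have h := fun i j => eventually_hasDerivAt_integralCurve hU (hF i j) hγ h0
  simp only [HasMatrixDerivAt, Filter.eventually_all]
  exact h

end Fields

variable {𝒢 M P : Type*}
  [Group 𝒢] [TopologicalSpace 𝒢] [ChartedSpace (EuclideanSpace ℝ (Fin 3)) 𝒢] [LieGroup (𝓡 3) ∞ 𝒢]
  [TopologicalSpace M] [ChartedSpace (EuclideanSpace ℝ (Fin 1)) M] [IsManifold (𝓡 1) ∞ M]
  [TopologicalSpace P] [ChartedSpace (EuclideanSpace ℝ (Fin 4)) P] [IsManifold (𝓡 4) ∞ P]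

/-- An invariant horizontal unit field on an open set. -/
structure PrincipalBundle.IsUnitField (𝔓 : PrincipalBundle 𝒢 M P) (g : Metric P) (U : Set P)
    (V : (p : P) → TangentSpace (𝓡 4) p) : Prop where
  isOpen : IsOpen U
  smooth : SmoothField U V
  unit : ∀ q ∈ U, g.inner q (V q) (V q) = 1
  horizontal : ∀ q ∈ U, ∀ y, g.inner q (V q) (𝔓.fund q y) = 0
  equivariant : ∀ q ∈ U, ∀ a, 𝔓.act q a ∈ U → V (𝔓.act q a) = 𝔓.push a q (V q)

namespace PrincipalBundle

variable {𝔓 : PrincipalBundle 𝒢 M P} {g : Metric P} {U : Set P}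
  {V : (p : P) → TangentSpace (𝓡 4) p} {H : (p : P) → TangentSpace (𝓡 4) p [⋀^Fin 3]→L[ℝ] ℝ}

theorem eventually_act_mem (𝔓 : PrincipalBundle 𝒢 M P) (hU : IsOpen U) {q : P} (hq : q ∈ U) :
    ∀ᶠ a in 𝓝 (1 : 𝒢), 𝔓.act q a ∈ U :=
  (𝔓.contMDiff_orbit q).continuous.continuousAt.eventually_mem
    (hU.mem_nhds (by rwa [𝔓.act_one]))

theorem contMDiffOn_formCoeff (hH : SmoothForm H) (e : Fin 3 → GroupLieAlgebra (𝓡 3) 𝒢) :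
    ContMDiffOn (𝓡 4) 𝓘(ℝ, ℝ) ∞ (𝔓.formCoeff H e) univ :=
  hH univ isOpen_univ _ _ _ (𝔓.smoothField_fund _) (𝔓.smoothField_fund _) (𝔓.smoothField_fund _)

theorem smoothMatrix_gramMatrix (hsm : SmoothMetric g) (e : Fin 3 → GroupLieAlgebra (𝓡 3) 𝒢) :
    SmoothMatrix (fun q => gramMatrix (𝔓.fibreMetric g q) e) U := fun i j =>
  (𝔓.contMDiffOn_fibreMetric hsm (e i) (e j)).mono (subset_univ _)

namespace IsUnitField

variable (hV : 𝔓.IsUnitField g U V)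
include hV

theorem mdifferentiableAt {q : P} (hq : q ∈ U) :
    MDifferentiableAt (𝓡 4) (𝓡 4).tangent (fun q => (⟨q, V q⟩ : TangentBundle (𝓡 4) P)) q :=
  (hV.smooth.contMDiffAt (hV.isOpen.mem_nhds hq)).mdifferentiableAt (by simp)

theorem lie_fund {q : P} (hq : q ∈ U) (y : GroupLieAlgebra (𝓡 3) 𝒢) :
    VectorField.mlieBracket (𝓡 4) (fun q => 𝔓.fund q y) V q = 0 :=
  𝔓.mlieBracket_fund_of_invariant y (hV.mdifferentiableAt hq) <|
    (𝔓.eventually_act_mem hV.isOpen hq).mono fun a ha => hV.equivariant q hq a ha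

theorem fund_lie {q : P} (hq : q ∈ U) (y : GroupLieAlgebra (𝓡 3) 𝒢) :
    VectorField.mlieBracket (𝓡 4) V (fun q => 𝔓.fund q y) q = 0 := by
  rw [VectorField.mlieBracket_swap_apply, hV.lie_fund hq, neg_zero]

theorem isFrameAt {q : P} (hq : q ∈ U) {x : Fin 3 → GroupLieAlgebra (𝓡 3) 𝒢}
    (hx : ∀ i j, 𝔓.fibreMetric g q (x i) (x j) = if i = j then 1 else 0) :
    𝔓.IsFrameAt g q (V q) x := ⟨hV.unit q hq, hV.horizontal q hq, hx⟩

theorem contMDiffOn_form (hH : SmoothForm H) (y z : GroupLieAlgebra (𝓡 3) 𝒢) :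
    ContMDiffOn (𝓡 4) 𝓘(ℝ, ℝ) ∞ (fun q => H q ![V q, 𝔓.fund q y, 𝔓.fund q z]) U :=
  hH U hV.isOpen _ _ _ hV.smooth ((𝔓.smoothField_fund _).mono (subset_univ _))
    ((𝔓.smoothField_fund _).mono (subset_univ _))

theorem smoothMatrix_form (hH : SmoothForm H) (e : Fin 3 → GroupLieAlgebra (𝓡 3) 𝒢) :
    SmoothMatrix (fun q => 𝔓.formMatrix H e q (V q)) U := fun i j =>
  hV.contMDiffOn_form hH (e i) (e j)

theorem form_act (hinv : 𝔓.InvariantForm H) {q : P} (hq : q ∈ U) {a : 𝒢} (ha : 𝔓.act q a ∈ U)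
    (y z : GroupLieAlgebra (𝓡 3) 𝒢) :
    H (𝔓.act q a) ![V (𝔓.act q a), 𝔓.fund (𝔓.act q a) y, 𝔓.fund (𝔓.act q a) z] =
      H q ![V q, 𝔓.fund q (adjointRep a y), 𝔓.fund q (adjointRep a z)] := by
  rw [hV.equivariant q hq a ha, 𝔓.form_act hinv]

theorem covG_act (hg : 𝔓.InvariantMetric g) (hsm : SmoothMetric g) {q : P} (hq : q ∈ U) {a : 𝒢}
    (ha : 𝔓.act q a ∈ U) (y z : GroupLieAlgebra (𝓡 3) 𝒢) :
    𝔓.covG g (𝔓.act q a) (V (𝔓.act q a)) y z =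
      𝔓.covG g q (V q) (adjointRep a y) (adjointRep a z) := by
  rw [hV.equivariant q hq a ha, covG, 𝔓.dirDeriv_push _ (𝔓.mdifferentiable_fibreMetric hsm y z _)]
  simp only [𝔓.fibreMetric_act hg]
  rfl

theorem dirDeriv_form_act (hinv : 𝔓.InvariantForm H) (hH : SmoothForm H) {q : P} (hq : q ∈ U)
    {a : 𝒢} (ha : 𝔓.act q a ∈ U) (y z : GroupLieAlgebra (𝓡 3) 𝒢) :
    dirDeriv (𝔓.act q a) (V (𝔓.act q a)) (fun q' => H q' ![V q', 𝔓.fund q' y, 𝔓.fund q' z]) =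
      dirDeriv q (V q)
        (fun q' => H q' ![V q', 𝔓.fund q' (adjointRep a y), 𝔓.fund q' (adjointRep a z)]) := by
  rw [hV.equivariant q hq a ha, 𝔓.dirDeriv_push _
    (mdifferentiableAt_of_smoothOn hV.isOpen (hV.contMDiffOn_form hH y z) ha)]
  refine dirDeriv_congr _ ?_
  filter_upwards [hV.isOpen.mem_nhds hq, (𝔓.contMDiff_translate a).continuous.continuousAt.eventually_mem
    (hV.isOpen.mem_nhds ha)] with q' h1 h2
  exact hV.form_act hinv h1 h2 y z

/-- The derivative of `H(V, ·, ·)` along a fundamental field. -/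
theorem dirDeriv_fund_form (hinv : 𝔓.InvariantForm H) (hH : SmoothForm H) {q : P} (hq : q ∈ U)
    (x y z : GroupLieAlgebra (𝓡 3) 𝒢) :
    dirDeriv q (𝔓.fund q x) (fun q' => H q' ![V q', 𝔓.fund q' y, 𝔓.fund q' z]) =
      H q ![V q, 𝔓.fund q ⁅x, y⁆, 𝔓.fund q z] + H q ![V q, 𝔓.fund q y, 𝔓.fund q ⁅x, z⁆] :=
  𝔓.dirDeriv_fund_of_equivariant (𝔓.isBilin_form H q (V q)).toLin x y z
    ((𝔓.eventually_act_mem hV.isOpen hq).mono fun _ ha => hV.form_act hinv hq ha y z)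
    (mdifferentiableAt_of_smoothOn hV.isOpen (hV.contMDiffOn_form hH y z) hq)

/-- The fibre component of a closed form is constant. -/
theorem dirDeriv_formCoeff (hinv : 𝔓.InvariantForm H) (hH : SmoothForm H) (hcl : ClosedForm H)
    {e : Fin 3 → GroupLieAlgebra (𝓡 3) 𝒢} {l : ℝ} (he : IsHeisenberg e l)
    {q : P} (hq : q ∈ U) : dirDeriv q (V q) (𝔓.formCoeff H e) = 0 := by
  -- Expand `dH(V, e₀, e₁, e₂) = 0`. Since `V` commutes with fundamental fields, all other terms are
  -- `H(V, ·, ·)` with a bracket in one slot; such a bracket is zero or a multiple of `e₂`, and in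
  -- the latter case `e₂` occurs twice. Only the derivative along `V` is left.
  have h := hcl U hV.isOpen V _ _ _ hV.smooth ((𝔓.smoothField_fund (e 0)).mono (subset_univ _))
    ((𝔓.smoothField_fund (e 1)).mono (subset_univ _))
    ((𝔓.smoothField_fund (e 2)).mono (subset_univ _)) q hq
  have hB := 𝔓.isBilin_form H q (V q)
  have hz : ∀ z, H q ![V q, 𝔓.fund q 0, 𝔓.fund q z] = 0 := fun z => hB.zero_left z
  have hz' : ∀ z, H q ![V q, 𝔓.fund q z, 𝔓.fund q 0] = 0 := fun z => hB.zero_right z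
  have hs : ∀ c y z, H q ![V q, 𝔓.fund q (c • y), 𝔓.fund q z] =
      c * H q ![V q, 𝔓.fund q y, 𝔓.fund q z] := hB.smul_left
  have h0 : ∀ z w, H q ![0, z, w] = 0 := fun z w => by
    have := alternating_smul (H q) 0 0 z w
    rwa [zero_smul, zero_mul] at this
  rw [extDerivThree] at h
  simp only [hV.fund_lie hq, 𝔓.mlieBracket_fund_fund, hV.dirDeriv_fund_form hinv hH hq, he.central,
    he.lie_zero_one, he.lie_one_zero, he.central', hs, hz, hz', h0] at h
  simp only [alternating_swap_left (H q) (V q), hz, hs,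
    alternating_self_right, mul_zero, neg_zero, add_zero, sub_zero] at h
  exact h

end IsUnitField

end PrincipalBundle

end InvariantFlow

namespace InvariantFlow

theorem alternating_rotate {E : Type*} [AddCommGroup E] [Module ℝ E] [TopologicalSpace E]
    (f : E [⋀^Fin 3]→L[ℝ] ℝ) (x y z : E) : f ![x, y, z] = f ![z, x, y] := by
  rw [alternating_swap_right f x z y, alternating_swap_left f z x y, neg_neg]

variable {𝒢 M P : Type*}
  [Group 𝒢] [TopologicalSpace 𝒢] [ChartedSpace (EuclideanSpace ℝ (Fin 3)) 𝒢] [LieGroup (𝓡 3) ∞ 𝒢]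
  [TopologicalSpace M] [ChartedSpace (EuclideanSpace ℝ (Fin 1)) M] [IsManifold (𝓡 1) ∞ M]
  [TopologicalSpace P] [ChartedSpace (EuclideanSpace ℝ (Fin 4)) P] [IsManifold (𝓡 4) ∞ P]

namespace PrincipalBundle

/-! ### The flow 2-form on vertical and mixed arguments -/

section Reduced

variable (𝔓 : PrincipalBundle 𝒢 M P) (g : Metric P)
  (H : (p : P) → TangentSpace (𝓡 4) p [⋀^Fin 3]→L[ℝ] ℝ) (V : (p : P) → TangentSpace (𝓡 4) p)

/-- The part of the flow form on the fibre that does not involve brackets. -/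
def reducedForm (q : P) (x : Fin 3 → GroupLieAlgebra (𝓡 3) 𝒢) (y z : GroupLieAlgebra (𝓡 3) 𝒢) : ℝ :=
  dirDeriv q (V q) (fun q' => H q' ![V q', 𝔓.fund q' y, 𝔓.fund q' z])
    - (∑ i, 𝔓.covG g q (V q) (x i) y * H q ![V q, 𝔓.fund q (x i), 𝔓.fund q z]
      - ∑ i, 𝔓.covG g q (V q) (x i) z * H q ![V q, 𝔓.fund q (x i), 𝔓.fund q y])

/-- The mixed part of the flow form. -/
def bracketForm (q : P) (x : Fin 3 → GroupLieAlgebra (𝓡 3) 𝒢) (z : GroupLieAlgebra (𝓡 3) 𝒢) : ℝ :=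
  1 / 2 * ∑ i, ∑ j, 𝔓.fibreMetric g q ⁅x i, x j⁆ z * H q ![V q, 𝔓.fund q (x i), 𝔓.fund q (x j)]

end Reduced

variable {𝔓 : PrincipalBundle 𝒢 M P} {g : Metric P} {U : Set P}
  {V : (p : P) → TangentSpace (𝓡 4) p} {H : (p : P) → TangentSpace (𝓡 4) p [⋀^Fin 3]→L[ℝ] ℝ}

/-- The connection form of `V` vanishes, and `V` twice in `H` gives zero, so of the three terms of
the flow form only the bracket term survives. -/
theorem flowForm_fund_left {x : P → Fin 3 → GroupLieAlgebra (𝓡 3) 𝒢} {q : P}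
    (h : 𝔓.IsFrameAt g q (V q) (x q)) (y : GroupLieAlgebra (𝓡 3) 𝒢) :
    𝔓.flowForm g H V x q (𝔓.fund q y) (V q) = -𝔓.bracketForm g H V q (x q) y := by
  have hF := 𝔓.isBilin_fibreMetric g q
  have hz : ∀ a, 𝔓.covG g q (V q) a 0 = 0 := fun a => by
    simp only [covG, (𝔓.isBilin_fibreMetric g _).zero_right]; exact dirDeriv_const _ 0
  have hB : ∀ (r : P) u y, H r ![u, 𝔓.fund r y, 𝔓.fund r 0] = 0 := fun r u y =>
    (𝔓.isBilin_form H r u).zero_right y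
  rw [flowForm, 𝔓.conn_fund, 𝔓.conn_of_horizontal g q h.horizontal]
  simp only [hB, hz, dirDeriv_const, alternating_self_outer, mul_zero, zero_mul, sub_zero,
    Finset.sum_const_zero, hF.zero_right]
  rw [bracketForm, ← mul_neg, zero_add]
  simp only [← Finset.sum_neg_distrib, alternating_rotate (H q) _ _ (V q)]
  refine congrArg _ (Finset.sum_congr rfl fun i _ => Finset.sum_congr rfl fun j _ => ?_)
  rw [fibreBracket, ← neg_one_smul ℝ ⁅x q i, x q j⁆, hF.smul_left]
  ring

theorem flowForm_fund_right {x : P → Fin 3 → GroupLieAlgebra (𝓡 3) 𝒢} {q : P}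
    (h : 𝔓.IsFrameAt g q (V q) (x q)) (y : GroupLieAlgebra (𝓡 3) 𝒢) :
    𝔓.flowForm g H V x q (V q) (𝔓.fund q y) = 𝔓.bracketForm g H V q (x q) y := by
  have hF := 𝔓.isBilin_fibreMetric g q
  have hz : ∀ a, 𝔓.covG g q (V q) a 0 = 0 := fun a => by
    simp only [covG, (𝔓.isBilin_fibreMetric g _).zero_right]; exact dirDeriv_const _ 0
  have hB : ∀ (r : P) u y, H r ![u, 𝔓.fund r 0, 𝔓.fund r y] = 0 := fun r u y =>
    (𝔓.isBilin_form H r u).zero_left y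
  rw [flowForm, 𝔓.conn_fund, 𝔓.conn_of_horizontal g q h.horizontal]
  simp only [hB, hz, dirDeriv_const, alternating_self_outer, mul_zero, zero_mul, sub_zero,
    Finset.sum_const_zero, hF.zero_right]
  rw [bracketForm, zero_add]
  simp only [alternating_rotate (H q) _ _ (V q)]
  refine congrArg _ (Finset.sum_congr rfl fun i _ => Finset.sum_congr rfl fun j _ => ?_)
  rw [fibreBracket, ← neg_one_smul ℝ ⁅x q i, x q j⁆, hF.smul_left]
  ring

theorem flowForm_zero_left (x : P → Fin 3 → GroupLieAlgebra (𝓡 3) 𝒢) (q : P)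
    (w : TangentSpace (𝓡 4) q) : 𝔓.flowForm g H V x q 0 w = 0 := by
  have hF := 𝔓.isBilin_fibreMetric g q
  have hz : ∀ a, 𝔓.covG g q (V q) a 0 = 0 := fun a => by
    simp only [covG, (𝔓.isBilin_fibreMetric g _).zero_right]; exact dirDeriv_const _ 0
  have hB : ∀ (r : P) u y, H r ![u, 𝔓.fund r 0, 𝔓.fund r y] = 0 := fun r u y =>
    (𝔓.isBilin_form H r u).zero_left y
  have h0 : ∀ u v, H q ![u, v, 0] = 0 := fun u v => by
    have := alternating_smul (H q) 0 0 u v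
    rw [zero_smul, zero_mul] at this
    rw [alternating_rotate, this]
  have hc : 𝔓.conn g q 0 = 0 := 𝔓.conn_of_horizontal g q fun y => by
    rw [map_zero, zero_apply]
  rw [flowForm, hc]
  simp [hB, hz, dirDeriv_const, hF.zero_right, h0]

/-- The bracket term vanishes on vertical arguments. In an orthonormal Heisenberg basis `X` it is a
multiple of `G(X₂, y) H(X₀, X₁, z)` antisymmetrised in `y, z`, and `H(X₀, X₁, z)` is itself a
multiple of `G(X₂, z)`. -/
theorem flowForm_fund_fund {x : P → Fin 3 → GroupLieAlgebra (𝓡 3) 𝒢} {q : P}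
    (h : 𝔓.IsFrameAt g q (V q) (x q)) {X : Module.Basis (Fin 3) ℝ (GroupLieAlgebra (𝓡 3) 𝒢)}
    (hX : x q = X) {l : ℝ} (hl : IsHeisenberg X l) (y z : GroupLieAlgebra (𝓡 3) 𝒢) :
    𝔓.flowForm g H V x q (𝔓.fund q y) (𝔓.fund q z) = 𝔓.reducedForm g H V q (x q) y z := by
  have hF := 𝔓.isBilin_fibreMetric g q
  have horth := h.orthonormal
  rw [hX] at horth
  have hrepr : ∀ w i, X.repr w i = 𝔓.fibreMetric g q (X i) w := by
    intro w i
    conv_rhs => rw [← X.sum_repr w, ← hF.toLin_apply, map_sum]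
    simp only [hF.toLin_apply, hF.smul_right, horth, mul_ite, mul_one, mul_zero,
      Finset.sum_ite_eq, Finset.mem_univ, if_true]
  obtain ⟨η, hη⟩ : ∃ η, H q ![𝔓.fund q (X 0), 𝔓.fund q (X 1), 𝔓.fund q (X 2)] = η := ⟨_, rfl⟩
  have hH : ∀ w, H q ![𝔓.fund q (X 0), 𝔓.fund q (X 1), 𝔓.fund q w] =
      𝔓.fibreMetric g q (X 2) w * η := by
    intro w
    have hB := 𝔓.isBilin_form H q (𝔓.fund q (X 0))
    have hs : ∀ c u, H q ![𝔓.fund q (X 0), 𝔓.fund q (X 1), 𝔓.fund q (c • u)] =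
        c * H q ![𝔓.fund q (X 0), 𝔓.fund q (X 1), 𝔓.fund q u] := fun c u => hB.smul_right c (X 1) u
    have h1 := hB.toLin_apply (X 1) w
    rw [← X.sum_repr w, map_sum, Fin.sum_univ_three] at h1
    simp only [hB.toLin_apply, hs, alternating_self_right,
      alternating_self_outer, mul_zero, zero_add, X.sum_repr] at h1
    rw [← h1, hrepr, hη]
  rw [flowForm, 𝔓.conn_fund, 𝔓.conn_fund, reducedForm, Finset.sum_sub_distrib, add_eq_left]
  have hb : ∀ i j w, 𝔓.fibreMetric g q (fibreBracket (X i) (X j)) w =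
      -(l * (!![0, 1, 0; -1, 0, 0; 0, 0, 0] : Mat3) i j) * 𝔓.fibreMetric g q (X 2) w :=
    fun i j w => by rw [fibreBracket, hl.lie_eq, ← neg_smul, hF.smul_left]
  simp only [hX, hb]
  have h10 : ∀ w, H q ![𝔓.fund q (X 1), 𝔓.fund q (X 0), 𝔓.fund q w] =
      -(𝔓.fibreMetric g q (X 2) w * η) := fun w => by rw [alternating_swap_left, hH]
  simp [Fin.sum_univ_three, hH, h10]
  ring

/-- The reduced form does not depend on the orthonormal basis. -/
theorem reducedForm_eq (hd : ∀ y z, MDifferentiable (𝓡 4) 𝓘(ℝ, ℝ) (fun q => 𝔓.fibreMetric g q y z))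
    (e : Module.Basis (Fin 3) ℝ (GroupLieAlgebra (𝓡 3) 𝒢)) {q : P}
    {x : Fin 3 → GroupLieAlgebra (𝓡 3) 𝒢} (h : 𝔓.IsFrameAt g q (V q) x)
    (y z : GroupLieAlgebra (𝓡 3) 𝒢) :
    𝔓.reducedForm g H V q x y z =
      dirDeriv q (V q) (fun q' => H q' ![V q', 𝔓.fund q' y, 𝔓.fund q' z])
        - (∑ a, ∑ b, (gramMatrix (𝔓.fibreMetric g q) e)⁻¹ a b *
            (𝔓.covG g q (V q) (e a) y * H q ![V q, 𝔓.fund q (e b), 𝔓.fund q z])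
          - ∑ a, ∑ b, (gramMatrix (𝔓.fibreMetric g q) e)⁻¹ a b *
            (𝔓.covG g q (V q) (e a) z * H q ![V q, 𝔓.fund q (e b), 𝔓.fund q y])) := by
  have hF := 𝔓.isBilin_fibreMetric g q
  have hD := 𝔓.isBilin_covG hd q (V q)
  have hK := 𝔓.isBilin_form H q (V q)
  have h1 := fun y z => sum_orthonormal_eq hF e h.orthonormal (hD.mul_left_left hK y z)
  rw [reducedForm, h1 y z, h1 z y]

theorem bracketForm_eq (e : Module.Basis (Fin 3) ℝ (GroupLieAlgebra (𝓡 3) 𝒢)) {q : P}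
    {x : Fin 3 → GroupLieAlgebra (𝓡 3) 𝒢} (h : 𝔓.IsFrameAt g q (V q) x)
    (z : GroupLieAlgebra (𝓡 3) 𝒢) :
    𝔓.bracketForm g H V q x z = 1 / 2 * ∑ a, ∑ b, ∑ c, ∑ d,
      (gramMatrix (𝔓.fibreMetric g q) e)⁻¹ a b * (gramMatrix (𝔓.fibreMetric g q) e)⁻¹ c d *
        (𝔓.fibreMetric g q ⁅e a, e c⁆ z * H q ![V q, 𝔓.fund q (e b), 𝔓.fund q (e d)]) := by
  have hF := 𝔓.isBilin_fibreMetric g q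
  rw [bracketForm, sum_orthonormal_mul_eq hF e h.orthonormal (hF.lie_left z)
    (𝔓.isBilin_form H q (V q))]

namespace IsUnitField

variable (hV : 𝔓.IsUnitField g U V)
include hV

theorem isBilin_reducedForm (hsm : SmoothMetric g) (hH : SmoothForm H) {q : P} (hq : q ∈ U)
    (x : Fin 3 → GroupLieAlgebra (𝓡 3) 𝒢) : IsBilin (𝔓.reducedForm g H V q x) := by
  have hD := 𝔓.isBilin_covG (𝔓.mdifferentiable_fibreMetric hsm) q (V q)
  have hK := 𝔓.isBilin_form H q (V q)
  have h1 := IsBilin.dirDeriv (fun q => 𝔓.isBilin_form H q (V q)) (V q) fun y z =>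
    mdifferentiableAt_of_smoothOn hV.isOpen (hV.contMDiffOn_form hH y z) hq
  constructor
  · intro a b c
    simp only [reducedForm, h1.add_left, hD.add_right, hK.add_right, add_mul, mul_add,
      Finset.sum_add_distrib]
    ring
  · intro r a c
    simp only [reducedForm, h1.smul_left, hD.smul_right, hK.smul_right, mul_assoc,
      mul_left_comm _ r, ← Finset.mul_sum]
    ring
  · intro a b c
    simp only [reducedForm, h1.add_right, hD.add_right, hK.add_right, add_mul, mul_add,
      Finset.sum_add_distrib]
    ring
  · intro r a c
    simp only [reducedForm, h1.smul_right, hD.smul_right, hK.smul_right, mul_assoc,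
      mul_left_comm _ r, ← Finset.mul_sum]
    ring

/-- The frame at `q · a` bears no relation to the one at `q`. It is first exchanged, by independence
of the orthonormal basis, for the translated frame, and then every ingredient is equivariant. -/
theorem reducedForm_act (hg : 𝔓.InvariantMetric g) (hsm : SmoothMetric g)
    (hinv : 𝔓.InvariantForm H) (hH : SmoothForm H)
    (e : Module.Basis (Fin 3) ℝ (GroupLieAlgebra (𝓡 3) 𝒢)) {q : P} (hq : q ∈ U) {a : 𝒢}
    (ha : 𝔓.act q a ∈ U) {x x' : Fin 3 → GroupLieAlgebra (𝓡 3) 𝒢}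
    (h : 𝔓.IsFrameAt g q (V q) x)
    (h' : 𝔓.IsFrameAt g (𝔓.act q a) (V (𝔓.act q a)) x') (y z : GroupLieAlgebra (𝓡 3) 𝒢) :
    𝔓.reducedForm g H V (𝔓.act q a) x' y z =
      𝔓.reducedForm g H V q x (adjointRep a y) (adjointRep a z) := by
  have h2 : 𝔓.IsFrameAt g (𝔓.act q a) (V (𝔓.act q a)) fun i => adjointRep a⁻¹ (x i) := by
    rw [hV.equivariant q hq a ha]; exact 𝔓.isFrameAt_push hg h a
  have hd := 𝔓.mdifferentiable_fibreMetric hsm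
  rw [reducedForm_eq hd e h', ← reducedForm_eq hd e h2, reducedForm, reducedForm,
    hV.dirDeriv_form_act hinv hH hq ha]
  simp only [hV.covG_act hg hsm hq ha, hV.form_act hinv hq ha, adjointRep_inv_apply]

theorem bracketForm_act (hg : 𝔓.InvariantMetric g) (hinv : 𝔓.InvariantForm H)
    (e : Module.Basis (Fin 3) ℝ (GroupLieAlgebra (𝓡 3) 𝒢)) {q : P} (hq : q ∈ U) {a : 𝒢}
    (ha : 𝔓.act q a ∈ U) {x x' : Fin 3 → GroupLieAlgebra (𝓡 3) 𝒢}
    (h : 𝔓.IsFrameAt g q (V q) x)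
    (h' : 𝔓.IsFrameAt g (𝔓.act q a) (V (𝔓.act q a)) x') (z : GroupLieAlgebra (𝓡 3) 𝒢) :
    𝔓.bracketForm g H V (𝔓.act q a) x' z = 𝔓.bracketForm g H V q x (adjointRep a z) := by
  have h2 : 𝔓.IsFrameAt g (𝔓.act q a) (V (𝔓.act q a)) fun i => adjointRep a⁻¹ (x i) := by
    rw [hV.equivariant q hq a ha]; exact 𝔓.isFrameAt_push hg h a
  rw [bracketForm_eq e h', ← bracketForm_eq e h2, bracketForm, bracketForm]
  simp only [𝔓.fibreMetric_act hg, hV.form_act hinv hq ha, adjointRep_inv_apply, adjointRep_lie]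

end IsUnitField

end PrincipalBundle

end InvariantFlow

/-! ### The exterior derivative of the flow 2-form -/

namespace InvariantFlow

variable {𝒢 M P : Type*}
  [Group 𝒢] [TopologicalSpace 𝒢] [ChartedSpace (EuclideanSpace ℝ (Fin 3)) 𝒢] [LieGroup (𝓡 3) ∞ 𝒢]
  [TopologicalSpace M] [ChartedSpace (EuclideanSpace ℝ (Fin 1)) M] [IsManifold (𝓡 1) ∞ M]
  [TopologicalSpace P] [ChartedSpace (EuclideanSpace ℝ (Fin 4)) P] [IsManifold (𝓡 4) ∞ P]

/-- A smooth invariant metric with a smooth invariant closed 3-form. -/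
structure PrincipalBundle.IsInvariantPair (𝔓 : PrincipalBundle 𝒢 M P) (g : Metric P)
    (H : (p : P) → TangentSpace (𝓡 4) p [⋀^Fin 3]→L[ℝ] ℝ) : Prop where
  invariant_metric : 𝔓.InvariantMetric g
  smooth_metric : SmoothMetric g
  invariant_form : 𝔓.InvariantForm H
  smooth_form : SmoothForm H
  closed : ClosedForm H

/-- Orthonormal frames that are Heisenberg bases. -/
structure PrincipalBundle.IsHeisenbergFrame (𝔓 : PrincipalBundle 𝒢 M P) (g : Metric P) (U : Set P)
    (V : (p : P) → TangentSpace (𝓡 4) p) (x : P → Fin 3 → GroupLieAlgebra (𝓡 3) 𝒢) : Prop where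
  frame : ∀ q ∈ U, 𝔓.IsFrameAt g q (V q) (x q)
  heisenberg : ∀ q ∈ U, ∃ (X : Module.Basis (Fin 3) ℝ (GroupLieAlgebra (𝓡 3) 𝒢)) (l : ℝ),
    x q = X ∧ IsHeisenberg X l

namespace PrincipalBundle

variable {𝔓 : PrincipalBundle 𝒢 M P} {g : Metric P} {U : Set P}
  {V : (p : P) → TangentSpace (𝓡 4) p} {H : (p : P) → TangentSpace (𝓡 4) p [⋀^Fin 3]→L[ℝ] ℝ}

namespace IsUnitField

variable (hV : 𝔓.IsUnitField g U V)
include hV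

theorem exists_isHeisenbergFrame {e : Module.Basis (Fin 3) ℝ (GroupLieAlgebra (𝓡 3) 𝒢)} {l : ℝ}
    (he : IsHeisenberg e l) : ∃ x, 𝔓.IsHeisenbergFrame g U V x := by
  choose X lX hX hXo using fun q => 𝔓.exists_orthonormal g q he
  exact ⟨fun q => X q, fun q hq => hV.isFrameAt hq (hXo q), fun q _ => ⟨X q, lX q, rfl, hX q⟩⟩

variable {x : P → Fin 3 → GroupLieAlgebra (𝓡 3) 𝒢} (hx : 𝔓.IsHeisenbergFrame g U V x)
  (hgH : 𝔓.IsInvariantPair g H) (e : Module.Basis (Fin 3) ℝ (GroupLieAlgebra (𝓡 3) 𝒢))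
include hx hgH e

/-- The frame `x` is not assumed smooth; the expression with the inverse Gram matrix of the fixed
basis `e` is. -/
theorem contMDiffOn_reducedForm (y z : GroupLieAlgebra (𝓡 3) 𝒢) :
    ContMDiffOn (𝓡 4) 𝓘(ℝ, ℝ) ∞ (fun q => 𝔓.reducedForm g H V q (x q) y z) U := by
  have hd := 𝔓.mdifferentiable_fibreMetric hgH.smooth_metric
  have hJ := contMDiffOn_matrix_inv (S := U) (Γ := fun q => gramMatrix (𝔓.fibreMetric g q) e)
    (smoothMatrix_gramMatrix hgH.smooth_metric e) fun q _ => 𝔓.isUnit_gramMatrix g q e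
  have hK := hV.contMDiffOn_form hgH.smooth_form
  have hN : ∀ y z, ContMDiffOn (𝓡 4) 𝓘(ℝ, ℝ) ∞ (fun q => 𝔓.covG g q (V q) y z) U := fun y z =>
    contMDiffOn_dirDeriv_of_smooth hV.isOpen hV.smooth
      ((𝔓.contMDiffOn_fibreMetric hgH.smooth_metric y z).mono (subset_univ _))
  have hS : ∀ y z, ContMDiffOn (𝓡 4) 𝓘(ℝ, ℝ) ∞ (fun q =>
      ∑ a, ∑ b, (gramMatrix (𝔓.fibreMetric g q) e)⁻¹ a b *
        (𝔓.covG g q (V q) (e a) y * H q ![V q, 𝔓.fund q (e b), 𝔓.fund q z])) U := fun y z =>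
    contMDiffOn_finsetSum fun a _ => contMDiffOn_finsetSum fun b _ =>
      (hJ a b).mul ((hN (e a) y).mul (hK (e b) z))
  exact ((contMDiffOn_dirDeriv_of_smooth hV.isOpen hV.smooth (hK y z)).sub
    ((hS y z).sub (hS z y))).congr fun q hq => reducedForm_eq hd e (hx.frame q hq) y z

theorem contMDiffOn_bracketForm (z : GroupLieAlgebra (𝓡 3) 𝒢) :
    ContMDiffOn (𝓡 4) 𝓘(ℝ, ℝ) ∞ (fun q => 𝔓.bracketForm g H V q (x q) z) U := by
  have hJ := contMDiffOn_matrix_inv (S := U) (Γ := fun q => gramMatrix (𝔓.fibreMetric g q) e)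
    (smoothMatrix_gramMatrix hgH.smooth_metric e) fun q _ => 𝔓.isUnit_gramMatrix g q e
  have hK := hV.contMDiffOn_form hgH.smooth_form
  have hF : ∀ y z, ContMDiffOn (𝓡 4) 𝓘(ℝ, ℝ) ∞ (fun q => 𝔓.fibreMetric g q y z) U := fun y z =>
    (𝔓.contMDiffOn_fibreMetric hgH.smooth_metric y z).mono (subset_univ _)
  refine (contMDiffOn_const.mul (contMDiffOn_finsetSum fun a _ => contMDiffOn_finsetSum fun b _ =>
      contMDiffOn_finsetSum fun c _ => contMDiffOn_finsetSum fun d _ =>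
      ((hJ a b).mul (hJ c d)).mul ((hF ⁅e a, e c⁆ z).mul (hK (e b) (e d))))).congr
    fun q hq => bracketForm_eq e (hx.frame q hq) z

/-- On vertical arguments the flow form agrees near `q` with the reduced form, which is equivariant;
differentiating along the orbit gives the coadjoint action. -/
theorem dirDeriv_fund_flowForm {q : P} (hq : q ∈ U) (u y z : GroupLieAlgebra (𝓡 3) 𝒢) :
    dirDeriv q (𝔓.fund q u) (fun q => 𝔓.flowForm g H V x q (𝔓.fund q y) (𝔓.fund q z)) =
      𝔓.flowForm g H V x q (𝔓.fund q ⁅u, y⁆) (𝔓.fund q z) +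
        𝔓.flowForm g H V x q (𝔓.fund q y) (𝔓.fund q ⁅u, z⁆) := by
  have hfund : ∀ q ∈ U, ∀ y z, 𝔓.flowForm g H V x q (𝔓.fund q y) (𝔓.fund q z) =
      𝔓.reducedForm g H V q (x q) y z := fun q hq y z => by
    obtain ⟨X, l, hX, hl⟩ := hx.heisenberg q hq
    exact flowForm_fund_fund (hx.frame q hq) hX hl y z
  rw [hfund q hq, hfund q hq, dirDeriv_congr _ (f := fun q => 𝔓.flowForm g H V x q (𝔓.fund q y) (𝔓.fund q z))
    (k := fun q => 𝔓.reducedForm g H V q (x q) y z)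
    (by filter_upwards [hV.isOpen.mem_nhds hq] with q' hq' using hfund q' hq' y z)]
  exact 𝔓.dirDeriv_fund_of_equivariant
    (hV.isBilin_reducedForm hgH.smooth_metric hgH.smooth_form hq (x q)).toLin u y z
    ((𝔓.eventually_act_mem hV.isOpen hq).mono fun a ha =>
      hV.reducedForm_act hgH.invariant_metric hgH.smooth_metric hgH.invariant_form hgH.smooth_form
        e hq ha (hx.frame q hq) (hx.frame _ ha) y z)
    (mdifferentiableAt_of_smoothOn hV.isOpen (hV.contMDiffOn_reducedForm hx hgH e y z) hq)

theorem dirDeriv_fund_flowForm_right {q : P} (hq : q ∈ U) (u y : GroupLieAlgebra (𝓡 3) 𝒢) :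
    dirDeriv q (𝔓.fund q u) (fun q => 𝔓.flowForm g H V x q (V q) (𝔓.fund q y)) =
      𝔓.bracketForm g H V q (x q) ⁅u, y⁆ := by
  rw [dirDeriv_congr _ (f := fun q => 𝔓.flowForm g H V x q (V q) (𝔓.fund q y))
    (k := fun q => 𝔓.bracketForm g H V q (x q) y)
    (by filter_upwards [hV.isOpen.mem_nhds hq] with q' hq' using
      flowForm_fund_right (hx.frame q' hq') y)]
  have hF := 𝔓.isBilin_fibreMetric g q
  let B : GroupLieAlgebra (𝓡 3) 𝒢 →ₗ[ℝ] ℝ :=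
    { toFun := 𝔓.bracketForm g H V q (x q)
      map_add' := fun a b => by
        simp only [bracketForm, hF.add_right, add_mul, Finset.sum_add_distrib, mul_add]
      map_smul' := fun r a => by
        simp only [bracketForm, hF.smul_right, mul_assoc, ← Finset.mul_sum, RingHom.id_apply,
          smul_eq_mul, mul_left_comm _ r] }
  exact 𝔓.dirDeriv_fund_of_equivariant_one B u y
    ((𝔓.eventually_act_mem hV.isOpen hq).mono fun a ha =>
      hV.bracketForm_act hgH.invariant_metric hgH.invariant_form
        e hq ha (hx.frame q hq) (hx.frame _ ha) y)
    (mdifferentiableAt_of_smoothOn hV.isOpen (hV.contMDiffOn_bracketForm hx hgH e y) hq)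

/-- Every term contains a bracket of basis vectors. Either the bracket involves `e₂` and vanishes,
or it is a multiple of `e₂` paired with `e₂`. This is what makes the fibre component of `H` constant
in time. -/
theorem extDerivTwo_flowForm_fund {l : ℝ} (he : IsHeisenberg e l) {q : P} (hq : q ∈ U) :
    extDerivTwo (𝔓.flowForm g H V x) (fun q => 𝔓.fund q (e 0)) (fun q => 𝔓.fund q (e 1))
      (fun q => 𝔓.fund q (e 2)) q = 0 := by
  have hfund : ∀ y z, 𝔓.flowForm g H V x q (𝔓.fund q y) (𝔓.fund q z) =
      𝔓.reducedForm g H V q (x q) y z := fun y z => by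
    obtain ⟨X, l, hX, hl⟩ := hx.heisenberg q hq
    exact flowForm_fund_fund (hx.frame q hq) hX hl y z
  have hR := hV.isBilin_reducedForm hgH.smooth_metric hgH.smooth_form hq (x q)
  have h22 : 𝔓.reducedForm g H V q (x q) (e 2) (e 2) = 0 := by
    have h0 : ∀ q', H q' ![V q', 𝔓.fund q' (e 2), 𝔓.fund q' (e 2)] = 0 := fun q' =>
      alternating_self_right _ _ _
    simp only [reducedForm, h0, dirDeriv_const, sub_self]
  simp only [extDerivTwo, hV.dirDeriv_fund_flowForm hx hgH e hq, 𝔓.mlieBracket_fund_fund, hfund,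
    he.lie_zero_one, he.lie_one_zero, he.central, he.central', hR.smul_left,
    hR.zero_left, hR.zero_right, h22]
  simp

/-- `V` commutes with fundamental fields. The mixed part is met three times, twice as a derivative
along a fundamental field and once with the bracket of `y` and `z`, with total coefficient `-1`. -/
theorem extDerivTwo_flowForm {q : P} (hq : q ∈ U) (y z : GroupLieAlgebra (𝓡 3) 𝒢) :
    extDerivTwo (𝔓.flowForm g H V x) V (fun q => 𝔓.fund q y) (fun q => 𝔓.fund q z) q =
      dirDeriv q (V q) (fun q => 𝔓.reducedForm g H V q (x q) y z)
        - 𝔓.bracketForm g H V q (x q) ⁅y, z⁆ := by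
  have hfund : ∀ q ∈ U, ∀ y z, 𝔓.flowForm g H V x q (𝔓.fund q y) (𝔓.fund q z) =
      𝔓.reducedForm g H V q (x q) y z := fun q hq y z => by
    obtain ⟨X, l, hX, hl⟩ := hx.heisenberg q hq
    exact flowForm_fund_fund (hx.frame q hq) hX hl y z
  have hneg : 𝔓.bracketForm g H V q (x q) ⁅z, y⁆ = -𝔓.bracketForm g H V q (x q) ⁅y, z⁆ := by
    rw [← lie_skew, ← neg_one_smul ℝ ⁅y, z⁆]
    simp only [bracketForm, (𝔓.isBilin_fibreMetric g q).smul_right, neg_mul, one_mul,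
      Finset.sum_neg_distrib, mul_neg]
  rw [extDerivTwo, hV.dirDeriv_fund_flowForm_right hx hgH e hq,
    hV.dirDeriv_fund_flowForm_right hx hgH e hq, hV.fund_lie hq, hV.fund_lie hq,
    𝔓.mlieBracket_fund_fund, flowForm_zero_left, flowForm_zero_left,
    flowForm_fund_left (hx.frame q hq), hneg,
    dirDeriv_congr _ (f := fun q => 𝔓.flowForm g H V x q (𝔓.fund q y) (𝔓.fund q z))
      (k := fun q => 𝔓.reducedForm g H V q (x q) y z)
      (by filter_upwards [hV.isOpen.mem_nhds hq] with q' hq' using hfund q' hq' y z)]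
  ring

end IsUnitField

end PrincipalBundle

end InvariantFlow

/-! ### Smooth dependence on time; evolution of the fibre metric and of `H` on the fibre -/

namespace InvariantFlow

variable {𝒢 M P : Type*}
  [Group 𝒢] [TopologicalSpace 𝒢] [ChartedSpace (EuclideanSpace ℝ (Fin 3)) 𝒢] [LieGroup (𝓡 3) ∞ 𝒢]
  [TopologicalSpace M] [ChartedSpace (EuclideanSpace ℝ (Fin 1)) M] [IsManifold (𝓡 1) ∞ M]
  [TopologicalSpace P] [ChartedSpace (EuclideanSpace ℝ (Fin 4)) P] [IsManifold (𝓡 4) ∞ P]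

namespace PrincipalBundle

variable {𝔓 : PrincipalBundle 𝒢 M P} {T t : ℝ} {g : ℝ → Metric P}
  {H : ℝ → (p : P) → TangentSpace (𝓡 4) p [⋀^Fin 3]→L[ℝ] ℝ} {U : Set P}
  {V : (p : P) → TangentSpace (𝓡 4) p}

theorem differentiableAt_slice {f : ℝ × P → ℝ}
    (hf : ContMDiffOn (𝓘(ℝ, ℝ).prod (𝓡 4)) 𝓘(ℝ, ℝ) ∞ f (Ioo 0 T ×ˢ U))
    (ht : t ∈ Ioo 0 T) {q : P} (hq : q ∈ U) :
    DifferentiableAt ℝ (fun s => f (s, q)) t := by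
  have h1 : ContMDiffOn 𝓘(ℝ, ℝ) 𝓘(ℝ, ℝ) ∞ (fun s => f (s, q)) (Ioo 0 T) :=
    hf.comp (contMDiff_id.prodMk contMDiff_const).contMDiffOn fun _ hs => ⟨hs, hq⟩
  exact ((h1.contMDiffAt (isOpen_Ioo.mem_nhds ht)).contDiffAt).differentiableAt (by simp)

namespace IsFlow

variable (hflow : 𝔓.IsFlow T g H)
include hflow

theorem contMDiffOn_fibreMetric (y z : GroupLieAlgebra (𝓡 3) 𝒢) :
    ContMDiffOn (𝓘(ℝ, ℝ).prod (𝓡 4)) 𝓘(ℝ, ℝ) ∞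
      (fun q : ℝ × P => 𝔓.fibreMetric (g q.1) q.2 y z) (Ioo 0 T ×ˢ U) :=
  (hflow.smooth_metric univ isOpen_univ _ _ (𝔓.smoothField_fund y) (𝔓.smoothField_fund z)).mono
    (prod_mono_right (subset_univ _))

theorem contMDiffOn_formCoeff (e : Fin 3 → GroupLieAlgebra (𝓡 3) 𝒢) :
    ContMDiffOn (𝓘(ℝ, ℝ).prod (𝓡 4)) 𝓘(ℝ, ℝ) ∞
      (fun q : ℝ × P => 𝔓.formCoeff (H q.1) e q.2) (Ioo 0 T ×ˢ U) :=
  (hflow.smooth_form univ isOpen_univ _ _ _ (𝔓.smoothField_fund (e 0)) (𝔓.smoothField_fund (e 1))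
    (𝔓.smoothField_fund (e 2))).mono (prod_mono_right (subset_univ _))

theorem contMDiffOn_form (hU : IsOpen U) (hV : SmoothField U V) (y z : GroupLieAlgebra (𝓡 3) 𝒢) :
    ContMDiffOn (𝓘(ℝ, ℝ).prod (𝓡 4)) 𝓘(ℝ, ℝ) ∞
      (fun q : ℝ × P => H q.1 q.2 ![V q.2, 𝔓.fund q.2 y, 𝔓.fund q.2 z]) (Ioo 0 T ×ˢ U) :=
  hflow.smooth_form U hU _ _ _ hV ((𝔓.smoothField_fund y).mono (subset_univ _))
    ((𝔓.smoothField_fund z).mono (subset_univ _))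

theorem contMDiffOn_inv_gramMatrix (e : Module.Basis (Fin 3) ℝ (GroupLieAlgebra (𝓡 3) 𝒢))
    (i j : Fin 3) : ContMDiffOn (𝓘(ℝ, ℝ).prod (𝓡 4)) 𝓘(ℝ, ℝ) ∞
      (fun q : ℝ × P => (gramMatrix (𝔓.fibreMetric (g q.1) q.2) e)⁻¹ i j) (Ioo 0 T ×ˢ U) :=
  contMDiffOn_matrix_inv (Γ := fun q : ℝ × P => gramMatrix (𝔓.fibreMetric (g q.1) q.2) e)
    (fun i j => hflow.contMDiffOn_fibreMetric (e i) (e j))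
    (fun q _ => 𝔓.isUnit_gramMatrix (g q.1) q.2 e) i j

theorem contMDiffOn_inner_fund (hU : IsOpen U) (hV : SmoothField U V)
    (y : GroupLieAlgebra (𝓡 3) 𝒢) :
    ContMDiffOn (𝓘(ℝ, ℝ).prod (𝓡 4)) 𝓘(ℝ, ℝ) ∞
      (fun q : ℝ × P => (g q.1).inner q.2 (V q.2) (𝔓.fund q.2 y)) (Ioo 0 T ×ˢ U) :=
  hflow.smooth_metric U hU _ _ hV ((𝔓.smoothField_fund y).mono (subset_univ _))

theorem contMDiffOn_connCoeff (hU : IsOpen U) (hV : SmoothField U V)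
    (e : Module.Basis (Fin 3) ℝ (GroupLieAlgebra (𝓡 3) 𝒢)) (i : Fin 3) :
    ContMDiffOn (𝓘(ℝ, ℝ).prod (𝓡 4)) 𝓘(ℝ, ℝ) ∞
      (fun q : ℝ × P => 𝔓.connCoeff (g q.1) q.2 e (V q.2) i) (Ioo 0 T ×ˢ U) := by
  have hJ := hflow.contMDiffOn_inv_gramMatrix e (U := U)
  have hm := fun j => hflow.contMDiffOn_inner_fund hU hV (e j)
  simp only [connCoeff, Matrix.mulVec, dotProduct, Fin.sum_univ_three]
  exact (((hJ i 0).mul (hm 0)).add ((hJ i 1).mul (hm 1))).add ((hJ i 2).mul (hm 2))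

omit hflow in
-- Pythagoras: the horizontal part is orthogonal to the vertical part. The formula shows smoothness
-- in time and space.
theorem _root_.InvariantFlow.PrincipalBundle.baseMetric_eq (g : Metric P) (q : P)
    (e : Module.Basis (Fin 3) ℝ (GroupLieAlgebra (𝓡 3) 𝒢)) (Z : TangentSpace (𝓡 4) q) :
    𝔓.baseMetric g q Z Z = g.inner q Z Z -
      ∑ i, 𝔓.connCoeff g q e Z i * g.inner q Z (𝔓.fund q (e i)) := by
  have h := 𝔓.connCoeff_spec g q e Z
  rw [baseMetric, 𝔓.conn_eq_sum g q e]
  rw [map_sub, h, sub_zero]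
  rw [g.symm, map_sub]
  rw [𝔓.fund_sum, map_sum]
  simp only [𝔓.fund_smul, map_smul, smul_eq_mul]

theorem contMDiffOn_baseMetric (hU : IsOpen U) (hV : SmoothField U V)
    (e : Module.Basis (Fin 3) ℝ (GroupLieAlgebra (𝓡 3) 𝒢)) :
    ContMDiffOn (𝓘(ℝ, ℝ).prod (𝓡 4)) 𝓘(ℝ, ℝ) ∞
      (fun q : ℝ × P => 𝔓.baseMetric (g q.1) q.2 (V q.2) (V q.2)) (Ioo 0 T ×ˢ U) := by
  simp only [𝔓.baseMetric_eq _ _ e, Fin.sum_univ_three]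
  have ha := hflow.contMDiffOn_connCoeff hU hV e
  have hm := fun j => hflow.contMDiffOn_inner_fund hU hV (e j)
  exact (hflow.smooth_metric U hU _ _ hV hV).sub
    ((((ha 0).mul (hm 0)).add ((ha 1).mul (hm 1))).add ((ha 2).mul (hm 2)))

theorem isInvariantPair (ht : t ∈ Ioo 0 T) : 𝔓.IsInvariantPair (g t) (H t) where
  invariant_metric := hflow.invariant_metric t ht
  smooth_metric U hU X Y hX hY := contMDiffOn_slice (hflow.smooth_metric U hU X Y hX hY) ht
  invariant_form := hflow.invariant_form t ht
  smooth_form U hU X Y Z hX hY hZ := contMDiffOn_slice (hflow.smooth_form U hU X Y Z hX hY hZ) ht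
  closed := hflow.closed t ht

variable (ht : t ∈ Ioo 0 T) (hV : 𝔓.IsUnitField (g t) U V)
  {e : Module.Basis (Fin 3) ℝ (GroupLieAlgebra (𝓡 3) 𝒢)} {l : ℝ} (he : IsHeisenberg e l)
include ht hV he

/-- The evolution of the fibre metric. -/
theorem hasMatrixDerivAt_gramMatrix {q : P} (hq : q ∈ U) :
    HasMatrixDerivAt (fun s => gramMatrix (𝔓.fibreMetric (g s) q) e)
      (metricFlow l (𝔓.formCoeff (H t) e q) (gramMatrix (𝔓.fibreMetric (g t) q) e)
        (fieldDeriv V (fun q => gramMatrix (𝔓.fibreMetric (g t) q) e) q)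
        (fieldDeriv V (fieldDeriv V fun q => gramMatrix (𝔓.fibreMetric (g t) q) e) q)
        (𝔓.formMatrix (H t) e q (V q))) t := by
  intro i j
  obtain ⟨x, hx⟩ := hV.exists_isHeisenbergFrame he
  have h1 := (differentiableAt_slice (hflow.contMDiffOn_fibreMetric (e i) (e j) (U := U)) ht hq).hasDerivAt
  refine h1.congr_deriv ?_
  refine (hflow.flow_fibreMetric t ht U hV.isOpen V x ⟨hV.smooth, hx.frame⟩ q hq (e i) (e j)).trans ?_
  exact IsFrameAt.metricFlow_eq 𝔓 (hx.frame q hq) (hflow.isInvariantPair ht).smooth_metric he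
    (fieldDeriv V (fieldDeriv V fun q => gramMatrix (𝔓.fibreMetric (g t) q) e) q) i j

/-- The fibre component of the form is constant in time. -/
theorem hasDerivAt_formCoeff {q : P} (hq : q ∈ U) :
    HasDerivAt (fun s => 𝔓.formCoeff (H s) e q) 0 t := by
  obtain ⟨x, hx⟩ := hV.exists_isHeisenbergFrame he
  have h1 := (differentiableAt_slice (hflow.contMDiffOn_formCoeff e (U := U)) ht hq).hasDerivAt
  refine h1.congr_deriv ?_
  refine (hflow.flow_form t ht U hV.isOpen V x ⟨hV.smooth, hx.frame⟩ _ _ _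
    ((𝔓.smoothField_fund (e 0)).mono (subset_univ _))
    ((𝔓.smoothField_fund (e 1)).mono (subset_univ _))
    ((𝔓.smoothField_fund (e 2)).mono (subset_univ _)) q hq).trans ?_
  exact hV.extDerivTwo_flowForm_fund hx (hflow.isInvariantPair ht) e he hq

end IsFlow

end PrincipalBundle

end InvariantFlow

/-! ### Evolution of the mixed part of `H` -/

namespace InvariantFlow

variable {𝒢 M P : Type*}
  [Group 𝒢] [TopologicalSpace 𝒢] [ChartedSpace (EuclideanSpace ℝ (Fin 3)) 𝒢] [LieGroup (𝓡 3) ∞ 𝒢]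
  [TopologicalSpace M] [ChartedSpace (EuclideanSpace ℝ (Fin 1)) M] [IsManifold (𝓡 1) ∞ M]
  [TopologicalSpace P] [ChartedSpace (EuclideanSpace ℝ (Fin 4)) P] [IsManifold (𝓡 4) ∞ P]

namespace PrincipalBundle

section Fixed

variable {𝔓 : PrincipalBundle 𝒢 M P} {g : Metric P} {U : Set P}
  {V : (p : P) → TangentSpace (𝓡 4) p} {H : (p : P) → TangentSpace (𝓡 4) p [⋀^Fin 3]→L[ℝ] ℝ}

/-- Symmetry of `DG` and of the inverse Gram matrix and skewness of `H(V, ·, ·)` turn the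
contractions into matrix products, which the product rule can differentiate along `V`. -/
theorem reducedForm_matrix (hsm : SmoothMetric g)
    (e : Module.Basis (Fin 3) ℝ (GroupLieAlgebra (𝓡 3) 𝒢)) {q : P}
    {x : Fin 3 → GroupLieAlgebra (𝓡 3) 𝒢} (h : 𝔓.IsFrameAt g q (V q) x) (i j : Fin 3) :
    𝔓.reducedForm g H V q x (e i) (e j) =
      (fieldDeriv V (fun q => 𝔓.formMatrix H e q (V q)) q
        - gramMatrix (𝔓.covG g q (V q)) e * (gramMatrix (𝔓.fibreMetric g q) e)⁻¹ *
          𝔓.formMatrix H e q (V q)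
        - 𝔓.formMatrix H e q (V q) * (gramMatrix (𝔓.fibreMetric g q) e)⁻¹ *
          gramMatrix (𝔓.covG g q (V q)) e) i j := by
  rw [reducedForm_eq (𝔓.mdifferentiable_fibreMetric hsm) e h]
  have hJ := fun i j => congrFun₂ (𝔓.gramMatrix_inv_symm g q e) i j
  have hK := fun i j => congrFun₂ (𝔓.formMatrix_skew H e q (V q)) i j
  have hN : ∀ i j, gramMatrix (𝔓.covG g q (V q)) e i j = gramMatrix (𝔓.covG g q (V q)) e j i :=
    fun i j => 𝔓.covG_symm g q (V q) _ _
  have e1 : ∀ a b, H q ![V q, 𝔓.fund q (e a), 𝔓.fund q (e b)] = 𝔓.formMatrix H e q (V q) a b :=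
    fun a b => rfl
  have e2 : ∀ a b, 𝔓.covG g q (V q) (e a) (e b) = gramMatrix (𝔓.covG g q (V q)) e a b :=
    fun a b => rfl
  simp only [e1, e2]
  generalize gramMatrix (𝔓.covG g q (V q)) e = N at *
  generalize hKK : 𝔓.formMatrix H e q (V q) = K at *
  generalize (gramMatrix (𝔓.fibreMetric g q) e)⁻¹ = J at *
  simp only [Matrix.transpose_apply, Matrix.neg_apply] at hJ hK
  have h1 : ∑ a, ∑ b, J a b * (N a i * K b j) = (N * J * K) i j := by
    simp only [Matrix.mul_apply, Fin.sum_univ_three]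
    rw [hN 0 i, hN 1 i, hN 2 i]
    ring
  have h2 : ∑ a, ∑ b, J a b * (N a j * K b i) = -(K * J * N) i j := by
    simp only [Matrix.mul_apply, Fin.sum_univ_three, hK i, hJ 1 0, hJ 2 0, hJ 2 1]
    ring
  rw [h1, h2, Matrix.sub_apply, Matrix.sub_apply, sub_sub, sub_neg_eq_add]
  rfl

end Fixed

variable {𝔓 : PrincipalBundle 𝒢 M P} {T t : ℝ} {g : ℝ → Metric P}
  {H : ℝ → (p : P) → TangentSpace (𝓡 4) p [⋀^Fin 3]→L[ℝ] ℝ} {U : Set P}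
  {V : (p : P) → TangentSpace (𝓡 4) p}

namespace IsFlow

variable (hflow : 𝔓.IsFlow T g H) (ht : t ∈ Ioo 0 T) (hV : 𝔓.IsUnitField (g t) U V)
  {e : Module.Basis (Fin 3) ℝ (GroupLieAlgebra (𝓡 3) 𝒢)} {l : ℝ} (he : IsHeisenberg e l)
include hflow ht hV he

theorem exists_integralCurve {q : P} (hq : q ∈ U) :
    ∃ γ : ℝ → P, γ 0 = q ∧ IsMIntegralCurveAt γ V 0 := by
  have : IsManifold (𝓡 4) 1 P := .of_le (n := ∞) (by simp)
  exact exists_isMIntegralCurveAt_of_contMDiffAt_boundaryless (t₀ := 0)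
    ((hV.smooth.contMDiffAt (hV.isOpen.mem_nhds hq)).of_le (by simp))

/-- The evolution of `H(V, ·, ·)`, at a point where the basis is orthonormal. -/
theorem hasMatrixDerivAt_formMatrix {q : P} (hq : q ∈ U)
    (h1 : gramMatrix (𝔓.fibreMetric (g t) q) e = 1) :
    HasMatrixDerivAt (fun s => 𝔓.formMatrix (H s) e q (V q))
      (formFlow l (fieldDeriv V (fun q => gramMatrix (𝔓.fibreMetric (g t) q) e) q)
        (fieldDeriv V (fieldDeriv V fun q => gramMatrix (𝔓.fibreMetric (g t) q) e) q)
        (𝔓.formMatrix (H t) e q (V q)) (fieldDeriv V (fun q => 𝔓.formMatrix (H t) e q (V q)) q)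
        (fieldDeriv V (fieldDeriv V fun q => 𝔓.formMatrix (H t) e q (V q)) q)) t := by
  intro i j
  have hgH := hflow.isInvariantPair ht
  obtain ⟨x, hx⟩ := hV.exists_isHeisenbergFrame he
  have hd := (differentiableAt_slice (hflow.contMDiffOn_form hV.isOpen hV.smooth (e i) (e j)) ht
    hq).hasDerivAt
  refine hd.congr_deriv ?_
  refine (hflow.flow_form t ht U hV.isOpen V x ⟨hV.smooth, hx.frame⟩ V _ _ hV.smooth
    ((𝔓.smoothField_fund (e i)).mono (subset_univ _))
    ((𝔓.smoothField_fund (e j)).mono (subset_univ _)) q hq).trans ?_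
  rw [hV.extDerivTwo_flowForm hx hgH e hq]
  have hF := 𝔓.isBilin_fibreMetric (g t) q
  -- One factor `l` comes from `⁅e i, e j⁆`, the other from the bracket inside the form; both
  -- require the index pair `(0, 1)` up to order.
  have hb : 𝔓.bracketForm (g t) (H t) V q (x q) ⁅e i, e j⁆ =
      (l ^ 2 • (!![0, 𝔓.formMatrix (H t) e q (V q) 0 1, 0;
        -𝔓.formMatrix (H t) e q (V q) 0 1, 0, 0; 0, 0, 0] : Mat3)) i j := by
    have hF22 : 𝔓.fibreMetric (g t) q (e 2) (e 2) = 1 := congrFun₂ h1 2 2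
    have hk : ∀ a b, H t q ![V q, 𝔓.fund q (e a), 𝔓.fund q (e b)] =
      𝔓.formMatrix (H t) e q (V q) a b := fun a b => rfl
    have hk10 : 𝔓.formMatrix (H t) e q (V q) 1 0 = -𝔓.formMatrix (H t) e q (V q) 0 1 :=
      congrFun₂ (𝔓.formMatrix_skew (H t) e q (V q)) 0 1
    rw [bracketForm_eq e (hx.frame q hq), h1, inv_one, he.lie_eq]
    simp only [he.lie_eq, hF.smul_left, hF.smul_right, hF22, hk]
    generalize 𝔓.formMatrix (H t) e q (V q) = K at *
    fin_cases i <;> fin_cases j <;> simp [Fin.sum_univ_three, Matrix.one_apply, hk10] <;> ring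
  rw [hb, formFlow, Matrix.sub_apply]
  congr 1
  obtain ⟨γ, h0, hγ⟩ := exists_integralCurve hflow ht hV he hq
  subst h0
  have hsΓ : SmoothMatrix (fun q => gramMatrix (𝔓.fibreMetric (g t) q) e) U :=
    smoothMatrix_gramMatrix hgH.smooth_metric e
  have hsK := hV.smoothMatrix_form hgH.smooth_form e
  have dΓ := (hsΓ.eventually_hasMatrixDerivAt hV.isOpen hγ hq).self_of_nhds
  have dΓ1 := ((hsΓ.fieldDeriv hV.isOpen hV.smooth).eventually_hasMatrixDerivAt hV.isOpen hγ
    hq).self_of_nhds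
  have dK := (hsK.eventually_hasMatrixDerivAt hV.isOpen hγ hq).self_of_nhds
  have dK1 := ((hsK.fieldDeriv hV.isOpen hV.smooth).eventually_hasMatrixDerivAt hV.isOpen hγ
    hq).self_of_nhds
  have dJ := dΓ.inv (𝔓.isUnit_gramMatrix (g t) _ e)
  have dR := (dK1.sub ((dΓ1.mul dJ).mul dK)).sub ((dK.mul dJ).mul dΓ1) i j
  have dR' := (eventually_hasDerivAt_integralCurve hV.isOpen
    (hV.contMDiffOn_reducedForm hx hgH e (e i) (e j)) hγ hq).self_of_nhds
  have h3 := dR'.unique (dR.congr_of_eventuallyEq (by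
    filter_upwards [hγ.self_of_nhds.continuousAt.eventually_mem (hV.isOpen.mem_nhds hq)] with s hs
    exact reducedForm_matrix hgH.smooth_metric e (hx.frame _ hs) i j))
  rw [h3]
  simp only [h1, inv_one]
  simp only [mul_one, one_mul]
  noncomm_ring

end IsFlow

end PrincipalBundle

end InvariantFlow

/-! ### Evolution of the connection and of the base metric -/

namespace InvariantFlow

theorem IsBilin.lie_fst {L : Type*} [LieRing L] [LieAlgebra ℝ L] {F : L → L → ℝ} (hF : IsBilin F)
    (y : L) : IsBilin fun u w : L => F ⁅u, y⁆ w where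
  add_left a b c := by simp only [add_lie, hF.add_left]
  smul_left r a b := by simp only [smul_lie, hF.smul_left]
  add_right a b c := by simp only [hF.add_right]
  smul_right r a b := by simp only [hF.smul_right]

variable {𝒢 M P : Type*}
  [Group 𝒢] [TopologicalSpace 𝒢] [ChartedSpace (EuclideanSpace ℝ (Fin 3)) 𝒢] [LieGroup (𝓡 3) ∞ 𝒢]
  [TopologicalSpace M] [ChartedSpace (EuclideanSpace ℝ (Fin 1)) M] [IsManifold (𝓡 1) ∞ M]
  [TopologicalSpace P] [ChartedSpace (EuclideanSpace ℝ (Fin 4)) P] [IsManifold (𝓡 4) ∞ P]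

namespace PrincipalBundle

variable {𝔓 : PrincipalBundle 𝒢 M P} {T t : ℝ} {g : ℝ → Metric P}
  {H : ℝ → (p : P) → TangentSpace (𝓡 4) p [⋀^Fin 3]→L[ℝ] ℝ} {U : Set P}
  {V : (p : P) → TangentSpace (𝓡 4) p}

/-- The right-hand side of the equation for the connection, in an orthonormal Heisenberg basis. -/
theorem IsFrameAt.connFlow_eq {g : Metric P} {p : P} {v : TangentSpace (𝓡 4) p}
    {x : Fin 3 → GroupLieAlgebra (𝓡 3) 𝒢} {H : (p : P) → TangentSpace (𝓡 4) p [⋀^Fin 3]→L[ℝ] ℝ}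
    (h : 𝔓.IsFrameAt g p v x) (hsm : SmoothMetric g)
    {e : Module.Basis (Fin 3) ℝ (GroupLieAlgebra (𝓡 3) 𝒢)} {l : ℝ} (he : IsHeisenberg e l)
    (h1 : gramMatrix (𝔓.fibreMetric g p) e = 1) (j : Fin 3) :
    (∑ i, 𝔓.covG g p v (fibreBracket (x i) (e j)) (x i))
        + (1 / 2) * 𝔓.formSq H p v x v (𝔓.fund p (e j)) =
      ![l * gramMatrix (𝔓.covG g p v) e 1 2 + 𝔓.formCoeff H e p * 𝔓.formMatrix H e p v 1 2,
        -(l * gramMatrix (𝔓.covG g p v) e 0 2) - 𝔓.formCoeff H e p * 𝔓.formMatrix H e p v 0 2,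
        𝔓.formCoeff H e p * 𝔓.formMatrix H e p v 0 1] j := by
  have hF := 𝔓.isBilin_fibreMetric g p
  have hD := 𝔓.isBilin_covG (𝔓.mdifferentiable_fibreMetric hsm) p v
  have e1 := sum_orthonormal_eq hF e h.orthonormal (hD.lie_fst (e j))
  have e2 := sum_orthonormal_mul_eq hF e h.orthonormal
    (𝔓.isBilin_form H p v) (𝔓.isBilin_form H p (𝔓.fund p (e j)))
  have hneg : ∀ a b c : GroupLieAlgebra (𝓡 3) 𝒢,
      𝔓.covG g p v (fibreBracket a b) c = -𝔓.covG g p v ⁅a, b⁆ c := fun a b c => by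
    rw [fibreBracket, ← neg_one_smul ℝ ⁅a, b⁆, hD.smul_left, neg_one_mul]
  have hz : ∀ i, H p ![v, v, 𝔓.fund p (x i)] = 0 := fun i => alternating_self_left _ _ _
  have hN : ∀ a b, 𝔓.covG g p v (e a) (e b) = gramMatrix (𝔓.covG g p v) e a b := fun a b => rfl
  have hK : ∀ a b, H p ![v, 𝔓.fund p (e a), 𝔓.fund p (e b)] = 𝔓.formMatrix H e p v a b :=
    fun a b => rfl
  have hN20 : gramMatrix (𝔓.covG g p v) e 2 0 = gramMatrix (𝔓.covG g p v) e 0 2 :=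
    𝔓.covG_symm g p v _ _
  have hN21 : gramMatrix (𝔓.covG g p v) e 2 1 = gramMatrix (𝔓.covG g p v) e 1 2 :=
    𝔓.covG_symm g p v _ _
  have hsk := fun a b => congrFun₂ (𝔓.formMatrix_skew H e p v) a b
  simp only [Matrix.transpose_apply, Matrix.neg_apply] at hsk
  have k1 := hsk 0 1
  have k2 := hsk 0 2
  have k3 := hsk 1 2
  rw [formSq_eq_sum]
  simp only [hneg, Finset.sum_neg_distrib, hz, zero_mul, Finset.sum_const_zero, mul_zero, zero_add]
  rw [e1, e2, h1, inv_one]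
  simp only [he.lie_eq, hD.smul_left, hN, hK, form_fund_basis]
  clear e1 e2 hneg hz hN hK hsk h1
  generalize gramMatrix (𝔓.covG g p v) e = N at *
  generalize 𝔓.formMatrix H e p v = K at *
  generalize 𝔓.formCoeff H e p = η at *
  fin_cases j <;>
    simp [Fin.sum_univ_three, Matrix.one_apply, skewMatrix, hN20, hN21, k1, k2, k3] <;> ring

namespace IsFlow

variable (hflow : 𝔓.IsFlow T g H) (ht : t ∈ Ioo 0 T) (hV : 𝔓.IsUnitField (g t) U V)
  {e : Module.Basis (Fin 3) ℝ (GroupLieAlgebra (𝓡 3) 𝒢)} {l : ℝ} (he : IsHeisenberg e l)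
include hflow ht hV he

/-- The evolution of the connection, at a point where the basis is orthonormal. -/
theorem hasDerivAt_connCoeff {q : P} (hq : q ∈ U)
    (h1 : gramMatrix (𝔓.fibreMetric (g t) q) e = 1) (j : Fin 3) :
    HasDerivAt (fun s => 𝔓.connCoeff (g s) q e (V q) j)
      (![l * gramMatrix (𝔓.covG (g t) q (V q)) e 1 2
            + 𝔓.formCoeff (H t) e q * 𝔓.formMatrix (H t) e q (V q) 1 2,
          -(l * gramMatrix (𝔓.covG (g t) q (V q)) e 0 2)
            - 𝔓.formCoeff (H t) e q * 𝔓.formMatrix (H t) e q (V q) 0 2,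
          𝔓.formCoeff (H t) e q * 𝔓.formMatrix (H t) e q (V q) 0 1] j) t := by
  obtain ⟨x, hx⟩ := hV.exists_isHeisenbergFrame he
  have hd := fun i => (differentiableAt_slice
    (hflow.contMDiffOn_connCoeff hV.isOpen hV.smooth e i) ht hq).hasDerivAt
  refine (hd j).congr_deriv ?_
  rw [← (hx.frame q hq).connFlow_eq (hflow.isInvariantPair ht).smooth_metric he h1 j]
  -- As `e` is orthonormal at `q` and time `t`, testing the velocity of the connection against `e j`
  -- gives its `j`-th coordinate.
  refine Eq.trans ?_ (hflow.flow_conn t ht U hV.isOpen V x ⟨hV.smooth, hx.frame⟩ q hq (e j))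
  have hF := 𝔓.isBilin_fibreMetric (g t) q
  let e' : Fin 3 → EuclideanSpace ℝ (Fin 3) := e
  have hs : HasDerivAt (F := EuclideanSpace ℝ (Fin 3))
      (fun s => ∑ i, 𝔓.connCoeff (g s) q e (V q) i • e' i) _ t :=
    HasDerivAt.fun_sum fun i _ => (hd i).smul_const (e' i)
  have hc : (fun s => 𝔓.conn (g s) q (V q)) =
      fun s => ∑ i, 𝔓.connCoeff (g s) q e (V q) i • e i := by
    ext1 s; exact 𝔓.conn_eq_sum (g s) q e (V q)
  have hds : deriv (fun s => 𝔓.conn (g s) q (V q)) t =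
      ∑ i, deriv (fun s => 𝔓.connCoeff (g s) q e (V q) i) t • e i := by
    rw [hc]; exact hs.deriv
  rw [hds, ← hF.toLin_apply, map_sum, LinearMap.sum_apply]
  have h2 : ∀ i, 𝔓.fibreMetric (g t) q (e i) (e j) = if i = j then 1 else 0 := fun i => by
    rw [← Matrix.one_apply, ← h1]; rfl
  simp only [hF.toLin_apply, hF.smul_left, h2]
  simp

/-- The evolution of the metric on the base. -/
theorem hasDerivAt_baseMetric {q : P} (hq : q ∈ U) :
    HasDerivAt (fun s => 𝔓.baseMetric (g s) q (V q) (V q))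
      (1 / 2 * energyDensity (gramMatrix (𝔓.fibreMetric (g t) q) e)⁻¹
        (gramMatrix (𝔓.covG (g t) q (V q)) e) (𝔓.formMatrix (H t) e q (V q))) t := by
  obtain ⟨x, hx⟩ := hV.exists_isHeisenbergFrame he
  have hd := (differentiableAt_slice
    (hflow.contMDiffOn_baseMetric hV.isOpen hV.smooth e) ht hq).hasDerivAt
  refine hd.congr_deriv ?_
  rw [← IsFrameAt.covGNormSq_add_formSq 𝔓 (hx.frame q hq)
    (𝔓.mdifferentiable_fibreMetric (hflow.isInvariantPair ht).smooth_metric), mul_add]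
  exact hflow.flow_baseMetric t ht U hV.isOpen V x ⟨hV.smooth, hx.frame⟩ q hq

end IsFlow

end PrincipalBundle

end InvariantFlow

/-! ### The energy in terms of a transverse vector -/

namespace InvariantFlow

theorem energyDensity_neg (J N K : Mat3) : energyDensity J (-N) (-K) = energyDensity J N K := by
  simp [energyDensity]

variable {𝒢 M P : Type*}
  [Group 𝒢] [TopologicalSpace 𝒢] [ChartedSpace (EuclideanSpace ℝ (Fin 3)) 𝒢] [LieGroup (𝓡 3) ∞ 𝒢]
  [TopologicalSpace M] [ChartedSpace (EuclideanSpace ℝ (Fin 1)) M] [IsManifold (𝓡 1) ∞ M]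
  [TopologicalSpace P] [ChartedSpace (EuclideanSpace ℝ (Fin 4)) P] [IsManifold (𝓡 4) ∞ P]

namespace PrincipalBundle

section Fixed

variable {𝔓 : PrincipalBundle 𝒢 M P} {g : Metric P} {q : P}
  {H : (p : P) → TangentSpace (𝓡 4) p [⋀^Fin 3]→L[ℝ] ℝ}

theorem baseMetric_pos {Z : TangentSpace (𝓡 4) q} (hZ : ∀ y, Z ≠ 𝔓.fund q y) :
    0 < 𝔓.baseMetric g q Z Z := g.pos _ _ (sub_ne_zero.mpr (hZ _))

/-- The frame vector obtained from a transverse vector. -/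
theorem IsFrameAt.of_transverse {v Z : TangentSpace (𝓡 4) q}
    {x : Fin 3 → GroupLieAlgebra (𝓡 3) 𝒢} (h : 𝔓.IsFrameAt g q v x)
    (e : Module.Basis (Fin 3) ℝ (GroupLieAlgebra (𝓡 3) 𝒢)) (hZ : ∀ y, Z ≠ 𝔓.fund q y) :
    𝔓.IsFrameAt g q ((Real.sqrt (𝔓.baseMetric g q Z Z))⁻¹ •
      (Z - 𝔓.fund q (∑ i, 𝔓.connCoeff g q e Z i • e i))) x where
  unit := by
    have hp := baseMetric_pos (g := g) hZ
    have hb : g.inner q (Z - 𝔓.fund q (∑ i, 𝔓.connCoeff g q e Z i • e i))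
        (Z - 𝔓.fund q (∑ i, 𝔓.connCoeff g q e Z i • e i)) = 𝔓.baseMetric g q Z Z := by
      rw [← 𝔓.conn_eq_sum g q e]; rfl
    have h2 := Real.mul_self_sqrt hp.le
    have h3 : Real.sqrt (𝔓.baseMetric g q Z Z) ≠ 0 := (Real.sqrt_pos.mpr hp).ne'
    rw [map_smul, map_smul, smul_apply, hb, smul_eq_mul, smul_eq_mul]
    field_simp
    rw [sq, h2]
  horizontal y := by
    rw [map_smul, smul_apply, 𝔓.connCoeff_spec, smul_zero]
  orthonormal := h.orthonormal

theorem dirDeriv_fund_fibreMetric (hg : 𝔓.InvariantMetric g) (hsm : SmoothMetric g)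
    (u y z : GroupLieAlgebra (𝓡 3) 𝒢) :
    dirDeriv q (𝔓.fund q u) (fun q => 𝔓.fibreMetric g q y z) =
      𝔓.fibreMetric g q ⁅u, y⁆ z + 𝔓.fibreMetric g q y ⁅u, z⁆ :=
  𝔓.dirDeriv_fund_of_equivariant (𝔓.isBilin_fibreMetric g q).toLin u y z
    (Filter.Eventually.of_forall fun a => 𝔓.fibreMetric_act hg q a y z)
    (𝔓.mdifferentiable_fibreMetric hsm y z q)

/-- `|DG|² + |i_v H|²` in terms of an arbitrary transverse vector. -/
theorem IsFrameAt.eq_flowEnergy {v Z : TangentSpace (𝓡 4) q}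
    {x : Fin 3 → GroupLieAlgebra (𝓡 3) 𝒢} (h : 𝔓.IsFrameAt g q v x)
    (hgH : 𝔓.IsInvariantPair g H)
    {e : Module.Basis (Fin 3) ℝ (GroupLieAlgebra (𝓡 3) 𝒢)} {l : ℝ} (he : IsHeisenberg e l)
    (hZ : ∀ y, Z ≠ 𝔓.fund q y) :
    𝔓.covGNormSq g q v x + 𝔓.formSq H q v x v v =
      flowEnergy l (Real.sqrt (𝔓.baseMetric g q Z Z))⁻¹ (𝔓.formCoeff H e q)
        (𝔓.connCoeff g q e Z) (gramMatrix (𝔓.fibreMetric g q) e)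
        (gramMatrix (𝔓.covG g q Z) e) (𝔓.formMatrix H e q Z) := by
  have hd := 𝔓.mdifferentiable_fibreMetric hgH.smooth_metric
  obtain ⟨w, hw⟩ : ∃ w, w = (Real.sqrt (𝔓.baseMetric g q Z Z))⁻¹ •
      (Z - 𝔓.fund q (∑ i, 𝔓.connCoeff g q e Z i • e i)) := ⟨_, rfl⟩
  have hfw : 𝔓.IsFrameAt g q w x := hw ▸ h.of_transverse e hZ
  rw [IsFrameAt.covGNormSq_add_formSq 𝔓 h hd H e]
  have hvw : energyDensity (gramMatrix (𝔓.fibreMetric g q) e)⁻¹ (gramMatrix (𝔓.covG g q v) e)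
        (𝔓.formMatrix H e q v) =
      energyDensity (gramMatrix (𝔓.fibreMetric g q) e)⁻¹ (gramMatrix (𝔓.covG g q w) e)
        (𝔓.formMatrix H e q w) := by
    -- The normalised horizontal part of `Z` is `v` or `-v`, and the energy is quadratic, so the
    -- sign does not matter.
    rcases IsFrameAt.eq_or_eq_neg 𝔓 h hfw with rfl | rfl
    · rfl
    · have h1 : gramMatrix (𝔓.covG g q (-v)) e = -gramMatrix (𝔓.covG g q v) e := by
        ext i j; exact dirDeriv_neg_vec q v _
      have h2 : 𝔓.formMatrix H e q (-v) = -𝔓.formMatrix H e q v := by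
        ext i j
        have := alternating_smul (H q) (-1) v (𝔓.fund q (e i)) (𝔓.fund q (e j))
        rw [neg_one_smul, neg_one_mul] at this
        exact this
      rw [h1, h2, energyDensity_neg]
  rw [hvw, flowEnergy]
  have hF := 𝔓.isBilin_fibreMetric g q
  obtain ⟨a, ha⟩ : ∃ a, a = 𝔓.connCoeff g q e Z := ⟨_, rfl⟩
  obtain ⟨c, hc⟩ : ∃ c, c = (Real.sqrt (𝔓.baseMetric g q Z Z))⁻¹ := ⟨_, rfl⟩
  rw [← ha, ← hc] at hw ⊢
  -- Removing the vertical part of `Z` subtracts from the derivative of the metric a derivative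
  -- along a fundamental field. By equivariance this is given by brackets, and yields
  -- `lieDerivMatrix`.
  have hlie : ∀ i, ⁅∑ k, a k • e k, e i⁆ = (![-(l * a 1), l * a 0, 0] i) • e 2 := by
    intro i
    simp only [Fin.sum_univ_three, add_lie, smul_lie, he.lie_eq, smul_smul, ← add_smul]
    congr 1
    fin_cases i <;> simp <;> ring
  congr 1
  · ext i j
    rw [gramMatrix_apply, covG, hw, dirDeriv_smul_vec, dirDeriv_sub_vec,
      dirDeriv_fund_fibreMetric hgH.invariant_metric hgH.smooth_metric, hlie, hlie, hF.smul_left,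
      hF.smul_right]
    rfl
  · ext i j
    have hsub := (alternating_add (H q) Z (-(1 : ℝ) • 𝔓.fund q (∑ k, a k • e k))
      (𝔓.fund q (e i)) (𝔓.fund q (e j)))
    rw [alternating_smul, neg_one_smul, ← sub_eq_add_neg] at hsub
    have hsum : H q ![𝔓.fund q (∑ k, a k • e k), 𝔓.fund q (e i), 𝔓.fund q (e j)] =
        (𝔓.formCoeff H e q • skewMatrix a) i j := by
      simp only [Fin.sum_univ_three, 𝔓.fund_add, 𝔓.fund_smul]
      rw [alternating_add, alternating_add, alternating_smul, alternating_smul, alternating_smul]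
      simp only [form_fund_basis]
      fin_cases i <;> fin_cases j <;> simp [skewMatrix] <;> ring
    change H q ![w, 𝔓.fund q (e i), 𝔓.fund q (e j)] = _
    rw [hw, alternating_smul, hsub, hsum, neg_one_mul, ← sub_eq_add_neg]
    rfl

end Fixed

end PrincipalBundle

end InvariantFlow

/-! ### The differential inequality for the energy -/

namespace InvariantFlow

theorem dirDeriv_neg {P : Type*} [TopologicalSpace P] [ChartedSpace (EuclideanSpace ℝ (Fin 4)) P]
    {p : P} (v : TangentSpace (𝓡 4) p) (f : P → ℝ) :
    dirDeriv p v (fun q => -f q) = -dirDeriv p v f :=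
  congrArg (fun L : EuclideanSpace ℝ (Fin 4) →L[ℝ] ℝ => L v)
    (mfderiv_neg (I := 𝓡 4) (f := f) (x := p))

variable {𝒢 M P : Type*}
  [Group 𝒢] [TopologicalSpace 𝒢] [ChartedSpace (EuclideanSpace ℝ (Fin 3)) 𝒢] [LieGroup (𝓡 3) ∞ 𝒢]
  [TopologicalSpace M] [ChartedSpace (EuclideanSpace ℝ (Fin 1)) M] [IsManifold (𝓡 1) ∞ M]
  [TopologicalSpace P] [ChartedSpace (EuclideanSpace ℝ (Fin 4)) P] [IsManifold (𝓡 4) ∞ P]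

namespace PrincipalBundle

variable {𝔓 : PrincipalBundle 𝒢 M P} {T t : ℝ} {g : ℝ → Metric P}
  {H : ℝ → (p : P) → TangentSpace (𝓡 4) p [⋀^Fin 3]→L[ℝ] ℝ} {U : Set P}
  {V : (p : P) → TangentSpace (𝓡 4) p}

/-- `|DG|² + |i_V H|²` for the metric and the form at time `s`, in a fixed basis and with respect
to a fixed field. -/
def energyOf (𝔓 : PrincipalBundle 𝒢 M P) (g : ℝ → Metric P)
    (H : ℝ → (p : P) → TangentSpace (𝓡 4) p [⋀^Fin 3]→L[ℝ] ℝ)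
    (e : Module.Basis (Fin 3) ℝ (GroupLieAlgebra (𝓡 3) 𝒢)) (l : ℝ)
    (V : (p : P) → TangentSpace (𝓡 4) p) (s : ℝ) (q : P) : ℝ :=
  flowEnergy l (Real.sqrt (𝔓.baseMetric (g s) q (V q) (V q)))⁻¹ (𝔓.formCoeff (H s) e q)
    (𝔓.connCoeff (g s) q e (V q)) (gramMatrix (𝔓.fibreMetric (g s) q) e)
    (gramMatrix (𝔓.covG (g s) q (V q)) e) (𝔓.formMatrix (H s) e q (V q))

namespace IsUnitField

variable {g : Metric P} (hV : 𝔓.IsUnitField g U V)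
include hV

theorem ne_fund {q : P} (hq : q ∈ U) (y : GroupLieAlgebra (𝓡 3) 𝒢) : V q ≠ 𝔓.fund q y := by
  intro h
  have h1 := hV.unit q hq
  have h2 := hV.horizontal q hq y
  rw [← h, h1] at h2
  exact one_ne_zero h2

theorem connCoeff_eq_zero (e : Module.Basis (Fin 3) ℝ (GroupLieAlgebra (𝓡 3) 𝒢)) {q : P}
    (hq : q ∈ U) : 𝔓.connCoeff g q e (V q) = 0 := by
  have : (fun i => g.inner q (V q) (𝔓.fund q (e i))) = 0 := funext fun i => hV.horizontal q hq _
  rw [connCoeff, this, Matrix.mulVec_zero]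

theorem baseMetric_eq_one (e : Module.Basis (Fin 3) ℝ (GroupLieAlgebra (𝓡 3) 𝒢)) {q : P}
    (hq : q ∈ U) : 𝔓.baseMetric g q (V q) (V q) = 1 := by
  rw [baseMetric_eq g q e, hV.unit q hq, hV.connCoeff_eq_zero e hq]
  simp

end IsUnitField

namespace IsFlow

variable (hflow : 𝔓.IsFlow T g H) (ht : t ∈ Ioo 0 T) (hV : 𝔓.IsUnitField (g t) U V)
  {e : Module.Basis (Fin 3) ℝ (GroupLieAlgebra (𝓡 3) 𝒢)} {l : ℝ} (he : IsHeisenberg e l)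
include hflow ht hV he

/-- `V` does not depend on time, so the time derivative of `VΓ` is the `V`-derivative of the
right-hand side of the metric equation. That equation holds at all points of `U`, though the basis
is orthonormal only at `q`; this is why `metricFlow` is stated for general `Γ`. -/
theorem hasMatrixDerivAt_covG {q : P} (hq : q ∈ U)
    (h1 : gramMatrix (𝔓.fibreMetric (g t) q) e = 1) :
    HasMatrixDerivAt (fun s => gramMatrix (𝔓.covG (g s) q (V q)) e)
      (metricFlowDeriv l (𝔓.formCoeff (H t) e q)
        (fieldDeriv V (fun q => gramMatrix (𝔓.fibreMetric (g t) q) e) q)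
        (fieldDeriv V (fieldDeriv V fun q => gramMatrix (𝔓.fibreMetric (g t) q) e) q)
        (fieldDeriv V (fieldDeriv V (fieldDeriv V fun q => gramMatrix (𝔓.fibreMetric (g t) q) e)) q)
        (𝔓.formMatrix (H t) e q (V q))
        (fieldDeriv V (fun q => 𝔓.formMatrix (H t) e q (V q)) q)) t := by
  intro i j
  have hgH := hflow.isInvariantPair ht
  have hf := hflow.contMDiffOn_fibreMetric (e i) (e j) (U := U)
  refine (hasDerivAt_dirDeriv isOpen_Ioo hV.isOpen hf ht hq (V q)).congr_deriv ?_
  obtain ⟨γ, h0, hγ⟩ := exists_integralCurve hflow ht hV he hq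
  subst h0
  have d1 := hasDerivAt_integralCurve
    (mdifferentiableAt_deriv_slice isOpen_Ioo hV.isOpen hf ht hq) hγ
  have hsΓ : SmoothMatrix (fun q => gramMatrix (𝔓.fibreMetric (g t) q) e) U :=
    smoothMatrix_gramMatrix hgH.smooth_metric e
  have hsΓ1 := hsΓ.fieldDeriv hV.isOpen hV.smooth
  have hsΓ2 := hsΓ1.fieldDeriv hV.isOpen hV.smooth
  have hsK := hV.smoothMatrix_form hgH.smooth_form e
  have dΓ := (hsΓ.eventually_hasMatrixDerivAt hV.isOpen hγ hq).self_of_nhds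
  have dΓ1 := (hsΓ1.eventually_hasMatrixDerivAt hV.isOpen hγ hq).self_of_nhds
  have dΓ2 := (hsΓ2.eventually_hasMatrixDerivAt hV.isOpen hγ hq).self_of_nhds
  have dK := (hsK.eventually_hasMatrixDerivAt hV.isOpen hγ hq).self_of_nhds
  have dh := hasDerivAt_integralCurve (mdifferentiableAt_of_smoothOn isOpen_univ
    (𝔓.contMDiffOn_formCoeff hgH.smooth_form e) (mem_univ (γ 0))) hγ
  rw [hV.dirDeriv_formCoeff hgH.invariant_form hgH.smooth_form hgH.closed he hq] at dh
  have dM := HasMatrixDerivAt.metricFlow (l := l) (h := fun s => 𝔓.formCoeff (H t) e (γ s))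
    (Γ := fun s => gramMatrix (𝔓.fibreMetric (g t) (γ s)) e)
    (Γ1 := fun s => fieldDeriv V (fun q => gramMatrix (𝔓.fibreMetric (g t) q) e) (γ s))
    (Γ2 := fun s => fieldDeriv V (fieldDeriv V fun q => gramMatrix (𝔓.fibreMetric (g t) q) e) (γ s))
    (K := fun s => 𝔓.formMatrix (H t) e (γ s) (V (γ s))) dΓ dΓ1 dΓ2 dK dh h1 i j
  refine d1.unique (dM.congr_of_eventuallyEq ?_)
  filter_upwards [hγ.self_of_nhds.continuousAt.eventually_mem (hV.isOpen.mem_nhds hq)] with s hs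
  exact (hasMatrixDerivAt_gramMatrix hflow ht hV he hs i j).deriv

/-- At a spatial maximum, `|DG|² + |i_V H|²` satisfies a differential inequality. -/
theorem exists_hasDerivAt_energyOf {q : P} (hq : q ∈ U)
    (h1 : gramMatrix (𝔓.fibreMetric (g t) q) e = 1)
    (hmax : ∀ᶠ q' in 𝓝 q, 𝔓.energyOf g H e l V t q' ≤ 𝔓.energyOf g H e l V t q) :
    ∃ d, HasDerivAt (fun s => 𝔓.energyOf g H e l V s q) d t ∧
      d ≤ -(1 / 2) * 𝔓.energyOf g H e l V t q ^ 2 := by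
  have hgH := hflow.isInvariantPair ht
  have hl0 : ∀ Γ : Mat3, lieDerivMatrix l 0 Γ = 0 := fun Γ => by
    ext i j; fin_cases i <;> fin_cases j <;> simp [lieDerivMatrix]
  have hs0 : skewMatrix 0 = 0 := by
    ext i j; fin_cases i <;> fin_cases j <;> simp [skewMatrix]
  have heq : ∀ q' ∈ U, 𝔓.energyOf g H e l V t q' =
      energyDensity (gramMatrix (𝔓.fibreMetric (g t) q') e)⁻¹
        (gramMatrix (𝔓.covG (g t) q' (V q')) e) (𝔓.formMatrix (H t) e q' (V q')) := by
    intro q' hq'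
    rw [energyOf, flowEnergy, hV.baseMetric_eq_one e hq', hV.connCoeff_eq_zero e hq', hl0, hs0]
    simp
  -- Along an integral curve, derivatives in the direction of `V` become ordinary derivatives and
  -- the spatial maximum becomes a maximum of a function of one variable.
  obtain ⟨γ, h0, hγ⟩ := exists_integralCurve hflow ht hV he hq
  subst h0
  have hsΓ : SmoothMatrix (fun q => gramMatrix (𝔓.fibreMetric (g t) q) e) U :=
    smoothMatrix_gramMatrix hgH.smooth_metric e
  have hsΓ1 := hsΓ.fieldDeriv hV.isOpen hV.smooth
  have hsΓ2 := hsΓ1.fieldDeriv hV.isOpen hV.smooth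
  have hsK := hV.smoothMatrix_form hgH.smooth_form e
  have hsK1 := hsK.fieldDeriv hV.isOpen hV.smooth
  have hlm : IsLocalMax (fun r => energyDensity (gramMatrix (𝔓.fibreMetric (g t) (γ r)) e)⁻¹
        (fieldDeriv V (fun q => gramMatrix (𝔓.fibreMetric (g t) q) e) (γ r))
        (𝔓.formMatrix (H t) e (γ r) (V (γ r)))) 0 := by
    have hc := hγ.self_of_nhds.continuousAt
    filter_upwards [hc.eventually hmax, hc.eventually_mem (hV.isOpen.mem_nhds hq)] with r h2 h3
    rw [heq _ h3, heq _ hq] at h2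
    exact h2
  have hsec := secondDeriv_energyDensity_nonpos
    (hsΓ.eventually_hasMatrixDerivAt hV.isOpen hγ hq)
    (hsΓ1.eventually_hasMatrixDerivAt hV.isOpen hγ hq)
    (hsΓ2.eventually_hasMatrixDerivAt hV.isOpen hγ hq).self_of_nhds
    (hsK.eventually_hasMatrixDerivAt hV.isOpen hγ hq)
    (hsK1.eventually_hasMatrixDerivAt hV.isOpen hγ hq).self_of_nhds h1 hlm
  have hb := hasDerivAt_baseMetric hflow ht hV he hq
  rw [← heq _ hq] at hb
  have hb1 := hV.baseMetric_eq_one e hq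
  have hc := (hb.sqrt (by rw [hb1]; exact one_ne_zero)).inv
    (by simp only [hb1, Real.sqrt_one]; exact one_ne_zero)
  have hφ := heq _ hq
  obtain ⟨φ, hφ'⟩ : ∃ φ, φ = 𝔓.energyOf g H e l V t (γ 0) := ⟨_, rfl⟩
  rw [← hφ'] at hb hc hφ ⊢
  -- The base metric of `V` equals 1 and grows at rate `φ/2`, so its inverse square root changes at
  -- rate `-φ/4`.
  have hc' := hc.congr_deriv (g' := -(φ / 4)) (by simp only [hb1, Real.sqrt_one]; ring)
  have hΓ := hasMatrixDerivAt_gramMatrix hflow ht hV he hq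
  rw [h1, metricFlow_one] at hΓ
  have hd := hasDerivAt_flowEnergy (l := l) hc' (hasDerivAt_formCoeff hflow ht hV he hq)
    (fun i => hasDerivAt_connCoeff hflow ht hV he hq h1 i) hΓ
    (hasMatrixDerivAt_covG hflow ht hV he hq h1) (hasMatrixDerivAt_formMatrix hflow ht hV he hq h1)
    (by simp [hb1]) (hV.connCoeff_eq_zero e hq) h1
  refine ⟨_, hd, ?_⟩
  rw [h1, inv_one, energyDensity] at hφ
  simp only [one_mul] at hφ
  have htr : ∀ F : P → Mat3, (∀ q, (F q).transpose = F q) → ∀ q,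
      (fieldDeriv V F q).transpose = fieldDeriv V F q := fun F hF q => by
    ext i j
    exact congrArg (dirDeriv q (V q)) (funext fun q' => congrFun₂ (hF q') i j)
  have hsk : ∀ F : P → Mat3, (∀ q, (F q).transpose = -F q) → ∀ q,
      (fieldDeriv V F q).transpose = -fieldDeriv V F q := fun F hF q => by
    ext i j
    have h2 : (fun q' => F q' j i) = fun q' => -F q' i j := funext fun q' =>
      congrFun₂ (hF q') i j
    change dirDeriv q (V q) (fun q' => F q' j i) = -dirDeriv q (V q) (fun q' => F q' i j)
    rw [h2, dirDeriv_neg]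
  have hΓs := fun q => 𝔓.gramMatrix_symm (g t) q e
  have hN := htr _ hΓs
  have hA := htr _ hN
  have hC := htr _ hA
  have hk := fun q => 𝔓.formMatrix_skew (H t) e q (V q)
  have hk1 := hsk _ hk
  have hk2 := hsk _ hk1
  refine le_of_eq_of_le (energy_identity (hN (γ 0)) (hA (γ 0)) (hC (γ 0)) (hk (γ 0)) (hk1 (γ 0))
    (hk2 (γ 0)) l (𝔓.formCoeff (H t) e (γ 0)) φ hφ _ rfl rfl rfl) ?_
  have hN0 := hN (γ 0)
  have hA0 := hA (γ 0)
  have hk0 := hk (γ 0)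
  have hk10 := hk1 (γ 0)
  clear hN hA hC hk hk1 hk2 hd hΓ hc' hc hb hφ
  generalize fieldDeriv V (fieldDeriv V (fieldDeriv V fun q =>
    gramMatrix (𝔓.fibreMetric (g t) q) e)) (γ 0) = C at *
  generalize fieldDeriv V (fieldDeriv V fun q => gramMatrix (𝔓.fibreMetric (g t) q) e) (γ 0) = A at *
  generalize fieldDeriv V (fun q => gramMatrix (𝔓.fibreMetric (g t) q) e) (γ 0) = N at *
  generalize fieldDeriv V (fieldDeriv V fun q => 𝔓.formMatrix (H t) e q (V q)) (γ 0) = k2 at *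
  generalize fieldDeriv V (fun q => 𝔓.formMatrix (H t) e q (V q)) (γ 0) = k1 at *
  generalize 𝔓.formMatrix (H t) e (γ 0) (V (γ 0)) = k at *
  generalize 𝔓.formCoeff (H t) e (γ 0) = η at *
  -- This matrix is symmetric and the one in `s2` is skew, so each trace of a square has the sign
  -- that lowers the right-hand side of the identity.
  have s1 : 0 ≤ ((A - N * N - k * k) * (A - N * N - k * k)).trace :=
    trace_mul_self_nonneg (by
      simp only [Matrix.transpose_sub, Matrix.transpose_mul, hN0, hA0, hk0, neg_mul_neg])
  have s2 : ((k1 - N * k - k * N) * (k1 - N * k - k * N)).trace ≤ 0 :=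
    trace_mul_self_nonpos (by
      simp only [Matrix.transpose_sub, Matrix.transpose_mul, hN0, hk10, hk0]
      noncomm_ring)
  have p1 : 0 ≤ η ^ 2 * N.trace ^ 2 := by positivity
  have p2 : 0 ≤ η ^ 2 * (k 0 1 ^ 2 + k 0 2 ^ 2 + k 1 2 ^ 2) := by positivity
  have p3 : 0 ≤ l ^ 2 * (N.trace - 2 * N 2 2) ^ 2 := by positivity
  have p4 : 0 ≤ l ^ 2 * (N 0 2 ^ 2 + N 1 2 ^ 2) := by positivity
  have p5 : 0 ≤ l ^ 2 * k 0 1 ^ 2 := by positivity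
  have p6 : 0 ≤ (l * N 0 2 + η * k 0 2) ^ 2 := sq_nonneg _
  have p7 : 0 ≤ (l * N 1 2 + η * k 1 2) ^ 2 := sq_nonneg _
  have p8 : 0 ≤ (l ^ 2 + η ^ 2) * k 0 1 ^ 2 := by positivity
  linarith

end IsFlow

end PrincipalBundle

end InvariantFlow

/-! ### The differential inequalities for the bracket and for `H` on the fibre -/

namespace InvariantFlow

/-- The derivative of the determinant at `A` in the direction of `B`. -/
def detDeriv (A B : Mat3) : ℝ :=
  B 0 0 * (A 1 1 * A 2 2 - A 1 2 * A 2 1) + A 0 0 * (B 1 1 * A 2 2 + A 1 1 * B 2 2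
      - B 1 2 * A 2 1 - A 1 2 * B 2 1)
    - B 0 1 * (A 1 0 * A 2 2 - A 1 2 * A 2 0) - A 0 1 * (B 1 0 * A 2 2 + A 1 0 * B 2 2
      - B 1 2 * A 2 0 - A 1 2 * B 2 0)
    + B 0 2 * (A 1 0 * A 2 1 - A 1 1 * A 2 0) + A 0 2 * (B 1 0 * A 2 1 + A 1 0 * B 2 1
      - B 1 1 * A 2 0 - A 1 1 * B 2 0)

theorem detDeriv_one (B : Mat3) : detDeriv 1 B = B.trace := by
  simp [detDeriv, Matrix.trace_fin_three]
  ring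

namespace HasMatrixDerivAt

variable {X Y : ℝ → Mat3} {X' Y' : Mat3} {r : ℝ}

theorem det (hX : HasMatrixDerivAt X X' r) :
    HasDerivAt (fun s => (X s).det) (detDeriv (X r) X') r := by
  simp only [Matrix.det_fin_three]
  have h := fun a b c d => (hX a b).mul (hX c d)
  refine (((((((h 0 0 1 1).mul (hX 2 2)).sub ((h 0 0 1 2).mul (hX 2 1))).sub
    ((h 0 1 1 0).mul (hX 2 2))).add ((h 0 1 1 2).mul (hX 2 0))).add
    ((h 0 2 1 0).mul (hX 2 1))).sub ((h 0 2 1 1).mul (hX 2 0))).congr_deriv ?_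
  simp only [detDeriv, Pi.mul_apply]
  ring

theorem detDeriv (hX : HasMatrixDerivAt X X' r) (hY : HasMatrixDerivAt Y Y' r) (h1 : X r = 1) :
    HasDerivAt (fun s => detDeriv (X s) (Y s))
      (Y'.trace + X'.trace * (Y r).trace - (X' * Y r).trace) r := by
  have h := fun a b c d => (hX a b).mul (hX c d)
  have k := fun a b c d => (hY a b).mul (hX c d)
  have k' := fun a b c d => (hX a b).mul (hY c d)
  refine (((((((hY 0 0).mul ((h 1 1 2 2).sub (h 1 2 2 1))).add ((hX 0 0).mul
    ((((k 1 1 2 2).add (k' 1 1 2 2)).sub (k 1 2 2 1)).sub (k' 1 2 2 1)))).sub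
    ((hY 0 1).mul ((h 1 0 2 2).sub (h 1 2 2 0)))).sub ((hX 0 1).mul
    ((((k 1 0 2 2).add (k' 1 0 2 2)).sub (k 1 2 2 0)).sub (k' 1 2 2 0)))).add
    ((hY 0 2).mul ((h 1 0 2 1).sub (h 1 1 2 0)))).add ((hX 0 2).mul
    ((((k 1 0 2 1).add (k' 1 0 2 1)).sub (k 1 1 2 0)).sub (k' 1 1 2 0)))).congr_deriv ?_
  simp [h1, Matrix.trace_fin_three, Matrix.mul_apply, Fin.sum_univ_three]
  ring

end HasMatrixDerivAt

variable {𝒢 M P : Type*}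
  [Group 𝒢] [TopologicalSpace 𝒢] [ChartedSpace (EuclideanSpace ℝ (Fin 3)) 𝒢] [LieGroup (𝓡 3) ∞ 𝒢]
  [TopologicalSpace M] [ChartedSpace (EuclideanSpace ℝ (Fin 1)) M] [IsManifold (𝓡 1) ∞ M]
  [TopologicalSpace P] [ChartedSpace (EuclideanSpace ℝ (Fin 4)) P] [IsManifold (𝓡 4) ∞ P]

namespace PrincipalBundle

variable {𝔓 : PrincipalBundle 𝒢 M P} {T t : ℝ} {g : ℝ → Metric P}
  {H : ℝ → (p : P) → TangentSpace (𝓡 4) p [⋀^Fin 3]→L[ℝ] ℝ} {U : Set P}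
  {V : (p : P) → TangentSpace (𝓡 4) p}

/-- `|[,]|²` in a Heisenberg basis. -/
def bracketOf (𝔓 : PrincipalBundle 𝒢 M P) (g : Metric P)
    (e : Fin 3 → GroupLieAlgebra (𝓡 3) 𝒢) (l : ℝ) (q : P) : ℝ :=
  2 * l ^ 2 * gramMatrix (𝔓.fibreMetric g q) e 2 2 ^ 2 / (gramMatrix (𝔓.fibreMetric g q) e).det

/-- `|H^𝔊|²` in a basis. -/
def verticalOf (𝔓 : PrincipalBundle 𝒢 M P) (g : Metric P)
    (H : (p : P) → TangentSpace (𝓡 4) p [⋀^Fin 3]→L[ℝ] ℝ)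
    (e : Fin 3 → GroupLieAlgebra (𝓡 3) 𝒢) (q : P) : ℝ :=
  6 * 𝔓.formCoeff H e q ^ 2 / (gramMatrix (𝔓.fibreMetric g q) e).det

theorem trace_mul_self_of_skew {k : Mat3} (h : k.transpose = -k) :
    (k * k).trace = -2 * (k 0 1 ^ 2 + k 0 2 ^ 2 + k 1 2 ^ 2) ∧
      (k * k) 2 2 = -(k 0 2 ^ 2 + k 1 2 ^ 2) := by
  have e := eq_of_skew h
  generalize k 0 1 = a at *
  generalize k 0 2 = b at *
  generalize k 1 2 = c at *
  subst e
  constructor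
  · simp [Matrix.trace_fin_three]; ring
  · simp [Matrix.mul_apply, Fin.sum_univ_three]; ring

theorem sq_le_mul_self_apply {N : Mat3} (h : N.transpose = N) : N 2 2 ^ 2 ≤ (N * N) 2 2 := by
  have e : ∀ i, N i 2 = N 2 i := fun i => congrFun₂ h 2 i
  simp only [Matrix.mul_apply, Fin.sum_univ_three, e]
  nlinarith [sq_nonneg (N 2 0), sq_nonneg (N 2 1)]

theorem trace_metricFlowOne (l η : ℝ) (N A k : Mat3) :
    (metricFlowOne l η N A k).trace = A.trace - (N * N).trace + l ^ 2 + 3 * η ^ 2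
      - (k * k).trace := by
  simp only [metricFlowOne, Matrix.trace_add, Matrix.trace_sub, Matrix.trace_smul,
    Matrix.trace_one]
  simp [Matrix.trace_fin_three, Fin.sum_univ_three]
  ring

namespace IsFlow

variable (hflow : 𝔓.IsFlow T g H) (ht : t ∈ Ioo 0 T) (hV : 𝔓.IsUnitField (g t) U V)
  {e : Module.Basis (Fin 3) ℝ (GroupLieAlgebra (𝓡 3) 𝒢)} {l : ℝ} (he : IsHeisenberg e l)
include hflow ht hV he

/-- At `Γ = 1` the time derivative is `2 l² (2 Γ'₂₂ - tr Γ')`. The second derivative test bounds the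
terms in `A`; the bracket terms give `2 l² · (-3 l²) = -(3/2) (2 l²)²`, and all that remains is
nonpositive. -/
theorem exists_hasDerivAt_bracketOf {q : P} (hq : q ∈ U)
    (h1 : gramMatrix (𝔓.fibreMetric (g t) q) e = 1)
    (hmax : ∀ᶠ q' in 𝓝 q, 𝔓.bracketOf (g t) e l q' ≤ 𝔓.bracketOf (g t) e l q) :
    ∃ d, HasDerivAt (fun s => 𝔓.bracketOf (g s) e l q) d t ∧
      d ≤ -(3 / 2) * 𝔓.bracketOf (g t) e l q ^ 2 := by
  have hgH := hflow.isInvariantPair ht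
  have hq1 : 𝔓.bracketOf (g t) e l q = 2 * l ^ 2 := by
    rw [bracketOf, h1]; simp
  have hΓ := hasMatrixDerivAt_gramMatrix hflow ht hV he hq
  have hdet := hΓ.det
  have hd := ((hΓ 2 2).pow 2).const_mul (2 * l ^ 2) |>.div hdet (by rw [h1]; simp)
  refine ⟨_, hd, ?_⟩
  rw [hq1] at hmax ⊢
  simp only [h1, metricFlow_one, detDeriv_one]
  obtain ⟨γ, h0, hγ⟩ := exists_integralCurve hflow ht hV he hq
  subst h0
  have hsΓ : SmoothMatrix (fun q => gramMatrix (𝔓.fibreMetric (g t) q) e) U :=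
    smoothMatrix_gramMatrix hgH.smooth_metric e
  have hsΓ1 := hsΓ.fieldDeriv hV.isOpen hV.smooth
  have dΓ := hsΓ.eventually_hasMatrixDerivAt hV.isOpen hγ hq
  have dΓ1 := (hsΓ1.eventually_hasMatrixDerivAt hV.isOpen hγ hq).self_of_nhds
  -- Multiplying by the positive determinant turns maximality of the quotient into a statement about
  -- a polynomial in the entries, which is zero at the maximum. The factor `l²` is kept because `l`
  -- may vanish.
  have hlm : IsLocalMax (fun r => l ^ 2 * (gramMatrix (𝔓.fibreMetric (g t) (γ r)) e 2 2 ^ 2 -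
      (gramMatrix (𝔓.fibreMetric (g t) (γ r)) e).det)) 0 := by
    have hpos : ∀ᶠ r in 𝓝 (0 : ℝ), 0 < (gramMatrix (𝔓.fibreMetric (g t) (γ r)) e).det :=
      dΓ.self_of_nhds.det.continuousAt.eventually_const_lt (by
        change 0 < (gramMatrix (𝔓.fibreMetric (g t) (γ 0)) e).det
        rw [h1]; simp)
    filter_upwards [hγ.self_of_nhds.continuousAt.eventually hmax, hpos] with r h2 h3
    rw [bracketOf, div_le_iff₀ h3] at h2
    have h4 : (1 : Mat3) 2 2 ^ 2 - (1 : Mat3).det = 0 := by simp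
    change _ ≤ l ^ 2 * (gramMatrix (𝔓.fibreMetric (g t) (γ 0)) e 2 2 ^ 2 -
      (gramMatrix (𝔓.fibreMetric (g t) (γ 0)) e).det)
    rw [h1, h4]
    linarith
  have hf1 : ∀ᶠ r in 𝓝 (0 : ℝ), HasDerivAt
      (fun r => l ^ 2 * (gramMatrix (𝔓.fibreMetric (g t) (γ r)) e 2 2 ^ 2 -
        (gramMatrix (𝔓.fibreMetric (g t) (γ r)) e).det))
      (l ^ 2 * (2 * (gramMatrix (𝔓.fibreMetric (g t) (γ r)) e 2 2 *
        fieldDeriv V (fun q => gramMatrix (𝔓.fibreMetric (g t) q) e) (γ r) 2 2)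
        - detDeriv (gramMatrix (𝔓.fibreMetric (g t) (γ r)) e)
          (fieldDeriv V (fun q => gramMatrix (𝔓.fibreMetric (g t) q) e) (γ r)))) r := by
    filter_upwards [dΓ] with r hr
    refine ((((hr 2 2).pow 2).sub hr.det).const_mul (l ^ 2)).congr_deriv ?_
    simp only [Nat.cast_ofNat, pow_one, Nat.add_one_sub_one]
    ring
  have hf2 := ((((dΓ.self_of_nhds 2 2).mul (dΓ1 2 2)).const_mul 2).sub
    (dΓ.self_of_nhds.detDeriv dΓ1 h1)).const_mul (l ^ 2)
  have hz := hlm.hasDerivAt_eq_zero hf1.self_of_nhds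
  have hs := secondDeriv_nonpos_of_isLocalMax hf1 hf2 hlm
  beta_reduce at hs
  have hN0 : (fieldDeriv V (fun q => gramMatrix (𝔓.fibreMetric (g t) q) e) (γ 0)).transpose =
      fieldDeriv V (fun q => gramMatrix (𝔓.fibreMetric (g t) q) e) (γ 0) := by
    ext i j; exact 𝔓.covG_symm (g t) _ _ _ _
  have hk0 := 𝔓.formMatrix_skew (H t) e (γ 0) (V (γ 0))
  rw [h1, detDeriv_one] at hz
  rw [h1] at hs
  clear hf1 hf2 hlm dΓ dΓ1 hd hdet hΓ
  generalize fieldDeriv V (fieldDeriv V fun q => gramMatrix (𝔓.fibreMetric (g t) q) e) (γ 0) = A at *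
  generalize fieldDeriv V (fun q => gramMatrix (𝔓.fibreMetric (g t) q) e) (γ 0) = N at *
  generalize 𝔓.formMatrix (H t) e (γ 0) (V (γ 0)) = k at *
  generalize 𝔓.formCoeff (H t) e (γ 0) = η at *
  obtain ⟨k1, k2⟩ := trace_mul_self_of_skew hk0
  have n1 := sq_le_mul_self_apply hN0
  have m2 : metricFlowOne l η N A k 2 2 = A 2 2 - (N * N) 2 2 - l ^ 2 + η ^ 2 - (k * k) 2 2 := by
    simp [metricFlowOne]
    ring
  simp only [trace_metricFlowOne, m2, k1, k2]
  rw [Matrix.one_apply_eq, one_mul] at hz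
  -- The first derivative test gives `l² (2 N₂₂ - tr N) = 0`; this trades the square of the trace in
  -- the second derivative of `det` for `N₂₂²`.
  have hz2 : l ^ 2 * N.trace ^ 2 = 4 * l ^ 2 * N 2 2 ^ 2 := by
    linear_combination -(2 * N 2 2 + N.trace) * hz
  have h22 : 𝔓.fibreMetric (g t) (γ 0) (e 2) (e 2) = 1 := by simpa using congrFun₂ h1 2 2
  have q1 := mul_le_mul_of_nonneg_left n1 (sq_nonneg l)
  have q2 := mul_nonneg (sq_nonneg l) (sq_nonneg (k 0 1))
  have q3 := mul_nonneg (sq_nonneg l) (sq_nonneg η)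
  simp [h22] at hs ⊢
  linarith

/-- The numerator is constant in space and time, so the derivative is `-6 c² tr Γ'` with `c` the
fibre component of `H`. At a maximum the second derivative of `det Γ` bounds the terms in `A` and
`N`; the term `3 c²` of the trace gives `-18 c⁴ = -(1/2) (6 c²)²`. -/
theorem exists_hasDerivAt_verticalOf {q : P} (hq : q ∈ U)
    (h1 : gramMatrix (𝔓.fibreMetric (g t) q) e = 1)
    (hmax : ∀ᶠ q' in 𝓝 q, 𝔓.verticalOf (g t) (H t) e q' ≤ 𝔓.verticalOf (g t) (H t) e q) :
    ∃ d, HasDerivAt (fun s => 𝔓.verticalOf (g s) (H s) e q) d t ∧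
      d ≤ -(1 / 2) * 𝔓.verticalOf (g t) (H t) e q ^ 2 := by
  have hgH := hflow.isInvariantPair ht
  have hq1 : 𝔓.verticalOf (g t) (H t) e q = 6 * 𝔓.formCoeff (H t) e q ^ 2 := by
    rw [verticalOf, h1]; simp
  have hΓ := hasMatrixDerivAt_gramMatrix hflow ht hV he hq
  have hη := hasDerivAt_formCoeff hflow ht hV he hq
  have hdet := hΓ.det
  have hd := ((hη.pow 2).const_mul 6).div hdet (by rw [h1]; simp)
  refine ⟨_, hd, ?_⟩
  rw [hq1] at hmax ⊢
  simp only [h1, metricFlow_one, detDeriv_one]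
  obtain ⟨γ, h0, hγ⟩ := exists_integralCurve hflow ht hV he hq
  subst h0
  have hsΓ : SmoothMatrix (fun q => gramMatrix (𝔓.fibreMetric (g t) q) e) U :=
    smoothMatrix_gramMatrix hgH.smooth_metric e
  have hsΓ1 := hsΓ.fieldDeriv hV.isOpen hV.smooth
  have dΓ := hsΓ.eventually_hasMatrixDerivAt hV.isOpen hγ hq
  have dΓ1 := (hsΓ1.eventually_hasMatrixDerivAt hV.isOpen hγ hq).self_of_nhds
  have hη1 : ∀ᶠ r in 𝓝 (0 : ℝ), HasDerivAt (fun r => 𝔓.formCoeff (H t) e (γ r)) 0 r := by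
    filter_upwards [eventually_hasDerivAt_integralCurve isOpen_univ
      (PrincipalBundle.contMDiffOn_formCoeff (𝔓 := 𝔓) hgH.smooth_form e) hγ (mem_univ _),
      hγ.self_of_nhds.continuousAt.eventually (hV.isOpen.mem_nhds hq)] with r hr hrU
    exact hr.congr_deriv
      (hV.dirDeriv_formCoeff hgH.invariant_form hgH.smooth_form hgH.closed he hrU)
  set c := 𝔓.formCoeff (H t) e (γ 0) with hc
  have hlm : IsLocalMax (fun r => 𝔓.formCoeff (H t) e (γ r) ^ 2 -
      c ^ 2 * (gramMatrix (𝔓.fibreMetric (g t) (γ r)) e).det) 0 := by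
    have hpos : ∀ᶠ r in 𝓝 (0 : ℝ), 0 < (gramMatrix (𝔓.fibreMetric (g t) (γ r)) e).det :=
      dΓ.self_of_nhds.det.continuousAt.eventually_const_lt (by
        change 0 < (gramMatrix (𝔓.fibreMetric (g t) (γ 0)) e).det
        rw [h1]; simp)
    filter_upwards [hγ.self_of_nhds.continuousAt.eventually hmax, hpos] with r h2 h3
    rw [verticalOf, div_le_iff₀ h3] at h2
    change _ ≤ c ^ 2 - c ^ 2 * (gramMatrix (𝔓.fibreMetric (g t) (γ 0)) e).det
    rw [h1, Matrix.det_one]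
    linarith
  have hf1 : ∀ᶠ r in 𝓝 (0 : ℝ), HasDerivAt
      (fun r => 𝔓.formCoeff (H t) e (γ r) ^ 2 -
        c ^ 2 * (gramMatrix (𝔓.fibreMetric (g t) (γ r)) e).det)
      (-(c ^ 2 * detDeriv (gramMatrix (𝔓.fibreMetric (g t) (γ r)) e)
          (fieldDeriv V (fun q => gramMatrix (𝔓.fibreMetric (g t) q) e) (γ r)))) r := by
    filter_upwards [dΓ, hη1] with r hr hr'
    refine ((hr'.pow 2).sub (hr.det.const_mul (c ^ 2))).congr_deriv ?_
    ring
  have hf2 := ((dΓ.self_of_nhds.detDeriv dΓ1 h1).const_mul (c ^ 2)).neg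
  have hz := hlm.hasDerivAt_eq_zero hf1.self_of_nhds
  have hs := secondDeriv_nonpos_of_isLocalMax hf1 hf2 hlm
  have hk0 := 𝔓.formMatrix_skew (H t) e (γ 0) (V (γ 0))
  rw [h1, detDeriv_one] at hz
  clear hf1 hf2 hlm dΓ dΓ1 hd hdet hΓ
  generalize fieldDeriv V (fieldDeriv V fun q => gramMatrix (𝔓.fibreMetric (g t) q) e) (γ 0) = A at *
  generalize fieldDeriv V (fun q => gramMatrix (𝔓.fibreMetric (g t) q) e) (γ 0) = N at *
  generalize 𝔓.formMatrix (H t) e (γ 0) (V (γ 0)) = k at *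
  obtain ⟨k1, -⟩ := trace_mul_self_of_skew hk0
  simp only [trace_metricFlowOne, k1]
  have hz2 : c ^ 2 * N.trace ^ 2 = 0 := by linear_combination -N.trace * hz
  have q1 := mul_nonneg (sq_nonneg c) (sq_nonneg l)
  have q2 := mul_nonneg (sq_nonneg c) (sq_nonneg (k 0 1))
  have q3 := mul_nonneg (sq_nonneg c) (sq_nonneg (k 0 2))
  have q4 := mul_nonneg (sq_nonneg c) (sq_nonneg (k 1 2))
  simp [← hc] at hs ⊢
  linarith

end IsFlow

end PrincipalBundle

end InvariantFlow

/-! ### From local expressions to the global bounds -/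

namespace InvariantFlow

theorem continuousAt_energyDensity {X : Type*} [TopologicalSpace X] {z : X} {J N K : X → Mat3}
    (hJ : ∀ i j, ContinuousAt (fun y => J y i j) z) (hN : ∀ i j, ContinuousAt (fun y => N y i j) z)
    (hK : ∀ i j, ContinuousAt (fun y => K y i j) z) :
    ContinuousAt (fun y => energyDensity (J y) (N y) (K y)) z := by
  have h : ∀ A : X → Mat3, (∀ i j, ContinuousAt (fun y => A y i j) z) →
      ContinuousAt (fun y => (J y * A y * (J y * A y)).trace) z := by
    intro A hA
    have h1 : ∀ i j, ContinuousAt (fun y => (J y * A y) i j) z := fun i j => by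
      simp only [Matrix.mul_apply]
      exact tendsto_finsetSum _ fun k _ => (hJ i k).mul (hA k j)
    simp only [Matrix.trace, Matrix.diag, Matrix.mul_apply (M := J _ * A _)]
    exact tendsto_finsetSum _ fun i _ => tendsto_finsetSum _ fun k _ => (h1 i k).mul (h1 k i)
  exact (h N hN).sub (h K hK)

theorem continuousAt_flowEnergy {X : Type*} [TopologicalSpace X] {z : X} (l : ℝ) {c h : X → ℝ}
    {a : X → Fin 3 → ℝ} {Γ D κ : X → Mat3} (hc : ContinuousAt c z) (hh : ContinuousAt h z)
    (ha : ∀ i, ContinuousAt (fun y => a y i) z)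
    (hJ : ∀ i j, ContinuousAt (fun y => (Γ y)⁻¹ i j) z)
    (hΓ : ∀ i j, ContinuousAt (fun y => Γ y i j) z) (hD : ∀ i j, ContinuousAt (fun y => D y i j) z)
    (hκ : ∀ i j, ContinuousAt (fun y => κ y i j) z) :
    ContinuousAt (fun y => flowEnergy l (c y) (h y) (a y) (Γ y) (D y) (κ y)) z := by
  have hw : ∀ i, ContinuousAt (fun y => ![-(l * a y 1), l * a y 0, 0] i) z := fun i => by
    fin_cases i
    · exact (continuousAt_const.mul (ha 1)).neg
    · exact continuousAt_const.mul (ha 0)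
    · exact continuousAt_const
  have hs : ∀ i j, ContinuousAt (fun y => skewMatrix (a y) i j) z := fun i j => by
    fin_cases i <;> fin_cases j
    all_goals first | exact continuousAt_const | exact ha _ | exact (ha _).neg
  exact continuousAt_energyDensity hJ
    (fun i j => hc.mul ((hD i j).sub (((hw i).mul (hΓ 2 j)).add ((hw j).mul (hΓ i 2)))))
    (fun i j => hc.mul ((hκ i j).sub (hh.mul (hs i j))))

variable {𝒢 M P : Type*}
  [Group 𝒢] [TopologicalSpace 𝒢] [ChartedSpace (EuclideanSpace ℝ (Fin 3)) 𝒢] [LieGroup (𝓡 3) ∞ 𝒢]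
  [TopologicalSpace M] [ChartedSpace (EuclideanSpace ℝ (Fin 1)) M] [IsManifold (𝓡 1) ∞ M]
  [TopologicalSpace P] [ChartedSpace (EuclideanSpace ℝ (Fin 4)) P] [IsManifold (𝓡 4) ∞ P]

theorem exists_isHeisenberg_groupLieAlgebra (𝒢 : Type*)
    [Group 𝒢] [TopologicalSpace 𝒢] [ChartedSpace (EuclideanSpace ℝ (Fin 3)) 𝒢]
    [LieGroup (𝓡 3) ∞ 𝒢] [LieRing.IsNilpotent (GroupLieAlgebra (𝓡 3) 𝒢)] :
    ∃ (e : Module.Basis (Fin 3) ℝ (GroupLieAlgebra (𝓡 3) 𝒢)) (c : ℝ), IsHeisenberg e c := by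
  have : Module.Finite ℝ (GroupLieAlgebra (𝓡 3) 𝒢) :=
    inferInstanceAs (Module.Finite ℝ (EuclideanSpace ℝ (Fin 3)))
  exact exists_basis_isHeisenberg (finrank_euclideanSpace_fin (𝕜 := ℝ) (n := 3))

namespace PrincipalBundle

variable {𝔓 : PrincipalBundle 𝒢 M P} {T t : ℝ} {g : ℝ → Metric P}
  {H : ℝ → (p : P) → TangentSpace (𝓡 4) p [⋀^Fin 3]→L[ℝ] ℝ} {U : Set P}
  {V : (p : P) → TangentSpace (𝓡 4) p}

section Push

variable {g : Metric P}

theorem bracketNormSq_push (hg : 𝔓.InvariantMetric g) (p : P) (a : 𝒢)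
    (x : Fin 3 → GroupLieAlgebra (𝓡 3) 𝒢) :
    𝔓.bracketNormSq g (𝔓.act p a) (fun i => adjointRep a⁻¹ (x i)) = 𝔓.bracketNormSq g p x := by
  simp only [bracketNormSq, 𝔓.fibreMetric_act hg, fibreBracket, map_neg, adjointRep_lie,
    adjointRep_inv_apply]

theorem verticalNormSq_push {H : (p : P) → TangentSpace (𝓡 4) p [⋀^Fin 3]→L[ℝ] ℝ}
    (hH : 𝔓.InvariantForm H) (p : P) (a : 𝒢) (x : Fin 3 → GroupLieAlgebra (𝓡 3) 𝒢) :
    𝔓.verticalNormSq H (𝔓.act p a) (fun i => adjointRep a⁻¹ (x i)) = 𝔓.verticalNormSq H p x := by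
  simp only [verticalNormSq, fund_act, 𝔓.form_push hH, adjointRep_inv_apply]

theorem covGNormSq_push (hg : 𝔓.InvariantMetric g) (hsm : SmoothMetric g) (p : P) (a : 𝒢)
    (v : TangentSpace (𝓡 4) p) (x : Fin 3 → GroupLieAlgebra (𝓡 3) 𝒢) :
    𝔓.covGNormSq g (𝔓.act p a) (𝔓.push a p v) (fun i => adjointRep a⁻¹ (x i)) =
      𝔓.covGNormSq g p v x := by
  have h : ∀ y z, 𝔓.covG g (𝔓.act p a) (𝔓.push a p v) y z =
      𝔓.covG g p v (adjointRep a y) (adjointRep a z) := fun y z => by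
    rw [covG, 𝔓.dirDeriv_push v (𝔓.mdifferentiable_fibreMetric hsm y z _)]
    simp only [𝔓.fibreMetric_act hg]
    rfl
  simp only [covGNormSq, h, adjointRep_inv_apply]

theorem formSq_push {H : (p : P) → TangentSpace (𝓡 4) p [⋀^Fin 3]→L[ℝ] ℝ}
    (hH : 𝔓.InvariantForm H) (p : P) (a : 𝒢) (v : TangentSpace (𝓡 4) p)
    (x : Fin 3 → GroupLieAlgebra (𝓡 3) 𝒢) :
    𝔓.formSq H (𝔓.act p a) (𝔓.push a p v) (fun i => adjointRep a⁻¹ (x i)) (𝔓.push a p v)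
      (𝔓.push a p v) = 𝔓.formSq H p v x v v := by
  have h : ∀ b, 𝔓.fullFrame (𝔓.act p a) (𝔓.push a p v) (fun i => adjointRep a⁻¹ (x i)) b =
      𝔓.push a p (𝔓.fullFrame p v x b) := fun b => by
    refine Fin.cases ?_ (fun i => ?_) b
    · rfl
    · simp only [fullFrame_succ, fund_act, adjointRep_inv_apply]
  simp only [formSq, h, 𝔓.form_push hH]

end Push

namespace IsFlow

variable (hflow : 𝔓.IsFlow T g H)
include hflow

theorem exists_isUnitField (ht : t ∈ Ioo 0 T)
    {e : Module.Basis (Fin 3) ℝ (GroupLieAlgebra (𝓡 3) 𝒢)} {c : ℝ} (he : IsHeisenberg e c) (p : P) :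
    ∃ U V, 𝔓.IsUnitField (g t) U V ∧ p ∈ U := by
  obtain ⟨U, V, h1, h2, h3, h4, h5, h6⟩ := 𝔓.exists_unit_horizontal
    (hflow.isInvariantPair ht).invariant_metric (hflow.isInvariantPair ht).smooth_metric he p
  exact ⟨U, V, ⟨h1, h3, h4, h5, h6⟩, h2⟩

theorem continuousAt_det (ht : t ∈ Ioo 0 T) (e : Module.Basis (Fin 3) ℝ (GroupLieAlgebra (𝓡 3) 𝒢))
    (p : P) : ContinuousAt
      (fun q : ℝ × P => (gramMatrix (𝔓.fibreMetric (g q.1) q.2) e).det) (t, p) := by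
  have hO : Ioo 0 T ×ˢ (univ : Set P) ∈ 𝓝 (t, p) :=
    (isOpen_Ioo.prod isOpen_univ).mem_nhds ⟨ht, mem_univ _⟩
  have h : ∀ i j, ContinuousAt (fun q : ℝ × P => 𝔓.fibreMetric (g q.1) q.2 (e i) (e j)) (t, p) :=
    fun i j => (hflow.contMDiffOn_fibreMetric (e i) (e j)).continuousOn.continuousAt hO
  simp only [Matrix.det_fin_three, gramMatrix_apply]
  fun_prop

theorem continuousAt_bracketOf (ht : t ∈ Ioo 0 T)
    (e : Module.Basis (Fin 3) ℝ (GroupLieAlgebra (𝓡 3) 𝒢)) (l : ℝ) (p : P) :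
    ContinuousAt (fun q : ℝ × P => 𝔓.bracketOf (g q.1) e l q.2) (t, p) := by
  have hO : Ioo 0 T ×ˢ (univ : Set P) ∈ 𝓝 (t, p) :=
    (isOpen_Ioo.prod isOpen_univ).mem_nhds ⟨ht, mem_univ _⟩
  have h : ContinuousAt (fun q : ℝ × P => 𝔓.fibreMetric (g q.1) q.2 (e 2) (e 2)) (t, p) :=
    (hflow.contMDiffOn_fibreMetric (e 2) (e 2)).continuousOn.continuousAt hO
  exact (continuousAt_const.mul (h.pow 2)).div (hflow.continuousAt_det ht e p)
    ((Matrix.isUnit_iff_isUnit_det _).mp (𝔓.isUnit_gramMatrix (g t) p e)).ne_zero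

theorem continuousAt_verticalOf (ht : t ∈ Ioo 0 T)
    (e : Module.Basis (Fin 3) ℝ (GroupLieAlgebra (𝓡 3) 𝒢)) (p : P) :
    ContinuousAt (fun q : ℝ × P => 𝔓.verticalOf (g q.1) (H q.1) e q.2) (t, p) := by
  have hO : Ioo 0 T ×ˢ (univ : Set P) ∈ 𝓝 (t, p) :=
    (isOpen_Ioo.prod isOpen_univ).mem_nhds ⟨ht, mem_univ _⟩
  have h : ContinuousAt (fun q : ℝ × P => 𝔓.formCoeff (H q.1) e q.2) (t, p) :=
    (hflow.contMDiffOn_formCoeff e).continuousOn.continuousAt hO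
  exact (continuousAt_const.mul (h.pow 2)).div (hflow.continuousAt_det ht e p)
    ((Matrix.isUnit_iff_isUnit_det _).mp (𝔓.isUnit_gramMatrix (g t) p e)).ne_zero

theorem continuousAt_energyOf (ht : t ∈ Ioo 0 T) (hV : 𝔓.IsUnitField (g t) U V)
    (e : Module.Basis (Fin 3) ℝ (GroupLieAlgebra (𝓡 3) 𝒢)) (l : ℝ) {p : P} (hp : p ∈ U) :
    ContinuousAt (fun q : ℝ × P => 𝔓.energyOf g H e l V q.1 q.2) (t, p) := by
  have hO : Ioo 0 T ×ˢ U ∈ 𝓝 (t, p) := (isOpen_Ioo.prod hV.isOpen).mem_nhds ⟨ht, hp⟩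
  have h0 : ContinuousAt
      (fun q : ℝ × P => (Real.sqrt (𝔓.baseMetric (g q.1) q.2 (V q.2) (V q.2)))⁻¹) (t, p) :=
    ((hflow.contMDiffOn_baseMetric hV.isOpen hV.smooth e).continuousOn.continuousAt hO).sqrt.inv₀
      (Real.sqrt_pos.mpr (baseMetric_pos (hV.ne_fund hp))).ne'
  have h1 : ContinuousAt (fun q : ℝ × P => 𝔓.formCoeff (H q.1) e q.2) (t, p) :=
    (hflow.contMDiffOn_formCoeff e).continuousOn.continuousAt hO
  exact continuousAt_flowEnergy l h0 h1
    (fun i => (hflow.contMDiffOn_connCoeff hV.isOpen hV.smooth e i).continuousOn.continuousAt hO)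
    (fun i j => (hflow.contMDiffOn_inv_gramMatrix e i j).continuousOn.continuousAt hO)
    (fun i j => (hflow.contMDiffOn_fibreMetric (e i) (e j)).continuousOn.continuousAt hO)
    (fun i j => (contMDiffOn_dirDeriv_slice isOpen_Ioo hV.isOpen hV.smooth
      (hflow.contMDiffOn_fibreMetric (e i) (e j))).continuousOn.continuousAt hO)
    (fun i j =>
      (hflow.contMDiffOn_form hV.isOpen hV.smooth (e i) (e j)).continuousOn.continuousAt hO)

/-- A scalar depending on a frame is at most `1 / (c t)` if it is invariant under the group and
is locally given by functions that satisfy `∂F/∂t ≤ -c F²` at spatial maxima. -/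
theorem le_of_local_expression [CompactSpace M] {c : ℝ} (hc : 0 < c)
    {N : ℝ → (p : P) → TangentSpace (𝓡 4) p → (Fin 3 → GroupLieAlgebra (𝓡 3) 𝒢) → ℝ}
    {e : Module.Basis (Fin 3) ℝ (GroupLieAlgebra (𝓡 3) 𝒢)} {l : ℝ} (he : IsHeisenberg e l)
    (hinv : ∀ t ∈ Ioo 0 T, ∀ p a v x,
      N t (𝔓.act p a) (𝔓.push a p v) (fun i => adjointRep a⁻¹ (x i)) = N t p v x)
    (hloc : ∀ t ∈ Ioo 0 T, ∀ p : P, ∃ (U : Set P) (F : ℝ → P → ℝ), IsOpen U ∧ p ∈ U ∧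
      (∀ s ∈ Ioo 0 T, ∀ q ∈ U, ∀ v x, 𝔓.IsFrameAt (g s) q v x → N s q v x = F s q) ∧
      ContinuousAt (fun q : ℝ × P => F q.1 q.2) (t, p) ∧
      ((∀ᶠ q in 𝓝 p, F t q ≤ F t p) →
        ∃ d, HasDerivAt (fun s => F s p) d t ∧ d ≤ -c * F t p ^ 2))
    (ht : t ∈ Ioo 0 T) {p : P} {v : TangentSpace (𝓡 4) p}
    {x : Fin 3 → GroupLieAlgebra (𝓡 3) 𝒢} (h : 𝔓.IsFrameAt (g t) p v x) :
    N t p v x ≤ 1 / (c * t) := by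
  have hframe : ∀ s p, ∃ v x, s ∈ Ioo 0 T → 𝔓.IsFrameAt (g s) p v x := by
    intro s p
    by_cases hs : s ∈ Ioo 0 T
    · obtain ⟨U, V, hV, hp⟩ := hflow.exists_isUnitField hs he p
      obtain ⟨x, -, -, hx⟩ := 𝔓.exists_orthonormal (g s) p he
      exact ⟨V p, x, fun _ => ⟨hV.unit p hp, hV.horizontal p hp, hx⟩⟩
    -- A junk value outside the time interval, so that the choice of frames is total.
    · exact ⟨0, 0, fun h => (hs h).elim⟩
  choose v₀ x₀ h₀ using hframe
  -- The local expression does not mention the frame, so all frames at a point give the same value.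
  -- Hence the chosen frames may jump from point to point without harming continuity.
  have hindep : ∀ s ∈ Ioo 0 T, ∀ p v x, 𝔓.IsFrameAt (g s) p v x →
      N s p v x = N s p (v₀ s p) (x₀ s p) := by
    intro s hs p v x h
    obtain ⟨U, F, -, hp, hF, -⟩ := hloc s hs p
    rw [hF s hs p hp v x h, hF s hs p hp _ _ (h₀ s p hs)]
  rw [hindep t ht p v x h]
  refine 𝔓.le_of_maximum_principle (f := fun s p => N s p (v₀ s p) (x₀ s p)) hc ?_ ?_ ?_ ht p
  · rintro ⟨s, p⟩ ⟨hs, -⟩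
    obtain ⟨U, F, hU, hp, hF, hFc, -⟩ := hloc s hs p
    refine (hFc.congr ?_).continuousWithinAt
    filter_upwards [(isOpen_Ioo.prod hU).mem_nhds ⟨hs, hp⟩] with q hq
    exact (hF q.1 hq.1 q.2 hq.2 _ _ (h₀ _ _ hq.1)).symm
  · intro s hs p a
    have h1 := 𝔓.isFrameAt_push (hflow.invariant_metric s hs) (h₀ s p hs) a
    exact (hindep s hs _ _ _ h1).symm.trans (hinv s hs p a _ _)
  · intro s hs p hmax _
    obtain ⟨U, F, hU, hp, hF, -, hFd⟩ := hloc s hs p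
    have hFN : ∀ q ∈ U, N s q (v₀ s q) (x₀ s q) = F s q :=
      fun q hq => hF s hs q hq _ _ (h₀ s q hs)
    obtain ⟨d, hd, hle⟩ := hFd (by
      filter_upwards [hU.mem_nhds hp] with q hq
      rw [← hFN q hq, ← hFN p hp]
      exact hmax q)
    refine ⟨d, hd.congr_of_eventuallyEq ?_, (hFN p hp).symm ▸ hle⟩
    filter_upwards [isOpen_Ioo.mem_nhds hs] with r hr
    exact hF r hr p hp _ _ (h₀ r p hr)

/-- Near a point, there are an orthonormal Heisenberg basis at that point and a unit field. -/
theorem exists_isHeisenberg_isUnitField (ht : t ∈ Ioo 0 T)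
    {e : Module.Basis (Fin 3) ℝ (GroupLieAlgebra (𝓡 3) 𝒢)} {l : ℝ} (he : IsHeisenberg e l) (p : P) :
    ∃ (b : Module.Basis (Fin 3) ℝ (GroupLieAlgebra (𝓡 3) 𝒢)) (m : ℝ) (U : Set P)
      (V : (p : P) → TangentSpace (𝓡 4) p), IsHeisenberg b m ∧
      gramMatrix (𝔓.fibreMetric (g t) p) b = 1 ∧ 𝔓.IsUnitField (g t) U V ∧ p ∈ U := by
  obtain ⟨b, m, hb, hb1⟩ := 𝔓.exists_orthonormal (g t) p he
  obtain ⟨U, V, hV, hp⟩ := hflow.exists_isUnitField ht he p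
  refine ⟨b, m, U, V, hb, ?_, hV, hp⟩
  ext i j
  rw [gramMatrix_apply, hb1, Matrix.one_apply]

variable [CompactSpace M] [LieRing.IsNilpotent (GroupLieAlgebra (𝓡 3) 𝒢)]
  (ht : t ∈ Ioo 0 T) {p : P} {v : TangentSpace (𝓡 4) p}
  {x : Fin 3 → GroupLieAlgebra (𝓡 3) 𝒢} (h : 𝔓.IsFrameAt (g t) p v x)
include ht h

theorem bracketNormSq_le : 𝔓.bracketNormSq (g t) p x ≤ 1 / (3 / 2 * t) := by
  obtain ⟨e, l, he⟩ := exists_isHeisenberg_groupLieAlgebra 𝒢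
  refine hflow.le_of_local_expression (N := fun t p _ x => 𝔓.bracketNormSq (g t) p x)
    (by norm_num) he (fun t ht p a _ x => bracketNormSq_push (hflow.invariant_metric t ht) p a x)
    (fun t ht p => ?_) ht h
  obtain ⟨b, m, U, V, hb, hb1, hV, hp⟩ := hflow.exists_isHeisenberg_isUnitField ht he p
  exact ⟨U, fun s => 𝔓.bracketOf (g s) b m, hV.isOpen, hp,
    fun s _ q _ v x h => h.bracketNormSq_eq 𝔓 hb, hflow.continuousAt_bracketOf ht b m p,
    hflow.exists_hasDerivAt_bracketOf ht hV hb hp hb1⟩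

theorem verticalNormSq_le : 𝔓.verticalNormSq (H t) p x ≤ 1 / (1 / 2 * t) := by
  obtain ⟨e, l, he⟩ := exists_isHeisenberg_groupLieAlgebra 𝒢
  refine hflow.le_of_local_expression (N := fun t p _ x => 𝔓.verticalNormSq (H t) p x)
    (by norm_num) he (fun t ht p a _ x => verticalNormSq_push (hflow.invariant_form t ht) p a x)
    (fun t ht p => ?_) ht h
  obtain ⟨b, m, U, V, hb, hb1, hV, hp⟩ := hflow.exists_isHeisenberg_isUnitField ht he p
  exact ⟨U, fun s => 𝔓.verticalOf (g s) (H s) b, hV.isOpen, hp,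
    fun s _ q _ v x h => h.verticalNormSq_eq 𝔓 (H s) b, hflow.continuousAt_verticalOf ht b p,
    hflow.exists_hasDerivAt_verticalOf ht hV hb hp hb1⟩

theorem covGNormSq_add_formSq_le :
    𝔓.covGNormSq (g t) p v x + 𝔓.formSq (H t) p v x v v ≤ 1 / (1 / 2 * t) := by
  obtain ⟨e, l, he⟩ := exists_isHeisenberg_groupLieAlgebra 𝒢
  refine hflow.le_of_local_expression
    (N := fun t p v x => 𝔓.covGNormSq (g t) p v x + 𝔓.formSq (H t) p v x v v)
    (by norm_num) he (fun t ht p a v x => congrArg₂ (· + ·)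
      (covGNormSq_push (hflow.invariant_metric t ht) (hflow.isInvariantPair ht).smooth_metric p a v x)
      (formSq_push (hflow.invariant_form t ht) p a v x))
    (fun t ht p => ?_) ht h
  obtain ⟨b, m, U, V, hb, hb1, hV, hp⟩ := hflow.exists_isHeisenberg_isUnitField ht he p
  -- `V` is unit and horizontal only for the metric at time `t`. At other times `s` what remains is
  -- that it is not vertical, a property independent of the metric, and this is enough to express
  -- the energy.
  exact ⟨U, 𝔓.energyOf g H b m V, hV.isOpen, hp,
    fun s hs q hq v x h => h.eq_flowEnergy (hflow.isInvariantPair hs) hb (hV.ne_fund hq),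
    hflow.continuousAt_energyOf ht hV b m hp,
    hflow.exists_hasDerivAt_energyOf ht hV hb hp hb1⟩

end IsFlow

end PrincipalBundle

end InvariantFlow

end

theorem corollary3p6 {𝒢 M P : Type*}
    [Group 𝒢] [TopologicalSpace 𝒢] [ChartedSpace (EuclideanSpace ℝ (Fin 3)) 𝒢]
    [LieGroup (𝓡 3) ∞ 𝒢]
    [LieRing.IsNilpotent (GroupLieAlgebra (𝓡 3) 𝒢)]
    [TopologicalSpace M] [ChartedSpace (EuclideanSpace ℝ (Fin 1)) M]
    [IsManifold (𝓡 1) ∞ M] [T2Space M] [CompactSpace M]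
    [TopologicalSpace P] [ChartedSpace (EuclideanSpace ℝ (Fin 4)) P]
    [IsManifold (𝓡 4) ∞ P] [T2Space P]
    (𝔓 : InvariantFlow.PrincipalBundle 𝒢 M P) (T : ℝ)
    (g : ℝ → InvariantFlow.Metric P)
    (H : ℝ → (p : P) → TangentSpace (𝓡 4) p [⋀^Fin 3]→L[ℝ] ℝ)
    (hflow : 𝔓.IsFlow T g H) (t : ℝ) (ht : t ∈ Set.Ioo 0 T) (p : P)
    (v : TangentSpace (𝓡 4) p) (x : Fin 3 → GroupLieAlgebra (𝓡 3) 𝒢)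
    (hframe : 𝔓.IsFrameAt (g t) p v x) :
    𝔓.bracketNormSq (g t) p x ≤ 2 / (3 * t) ∧
    𝔓.verticalNormSq (H t) p x ≤ 2 / t ∧
    𝔓.covGNormSq (g t) p v x + 𝔓.formSq (H t) p v x v v ≤ 2 / t := by
  refine ⟨(hflow.bracketNormSq_le ht hframe).trans_eq ?_,
    (hflow.verticalNormSq_le ht hframe).trans_eq ?_,
    (hflow.covGNormSq_add_formSq_le ht hframe).trans_eq ?_⟩
  all_goals
    have := ht.1.ne'
    field_simp
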